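/- Let $(W_t)_{t\ge 0}$ be a Brownian motion with $W_0=0$ on a filtered probability space $(\Omega,\mathcal F,(\mathcal F_t)_{t\ge0},P)$, such that $W_t$ is $\mathcal F_t$-measurable and $W_t-W_s$ is independent of $\mathcal F_s$ for all $0\le s<t$. The Itô integral $\int_0^T f\,dW$ is the limit in probability of $\sum_i f(t_{i-1})\,(W_{t_i}-W_{t_{i-1}})$, and the Stratonovich integral $\int_0^T f\circ dW$ is the limit in probability of $\sum_i f\big(\tfrac{t_{i-1}+t_i}{2}\big)(W_{t_i}-W_{t_{i-1}})$, as the diameter of the partition of $[0,T]$ tends to $0$. For $x\ge 0$, a solution of $dX=\sqrt{2X}\circ dW$ (resp. $dX=\sqrt{2X}\,dW$) with $X_0=x$ is an adapted process (up to null sets) with a.s. continuous, nonnegative paths such that $X_0=x$ a.s. and, for every $t\ge 0$, the integral $\int_0^t\sqrt{2X_s}\circ dW_s$ (resp. $\int_0^t\sqrt{2X_s}\,dW_s$) exists and equals $X_t-x$; $\sqrt{\cdot}$ is the nonnegative root, and the driving Brownian motion is the given $W$. The law of a process means its law on $\mathbb R^{[0,\infty)}$ with the product $\sigma$-algebra.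 Let $x_0>0$, $S_t=\big(\sqrt{x_0}+W_t/\sqrt2\big)^2$, $T_0=0$ and $T_{n}=\inf\{t>T_{n-1}: S_t=0\}$ for $n\ge1$ (with $\inf\emptyset=\infty$). Then: 1. The solutions of the Stratonovich equation $dX=\sqrt{2X}\circ dW$, $X_0=x_0$, have uncountably many different laws. In particular, the equation has uncountably many solutions, no two of them indistinguishable. 2. For every $n\ge1$ the killed process $S_t\mathbf 1_{t<T_n}$ is a solution of this equation. 3. This equation has a solution that a.s. equals $S_t$ for all $t\le T_1$ and has the same law as the process $S$. 4. For every $\tau\ge0$, the equation $dX=\sqrt{2X}\circ dW$ with $X_0=0$ has a solution with the same law as the process $\tfrac12 W_{t-\tau}^2\,\mathbf 1_{t>\tau}$. 5. There is a family $(X^{n,\tau})_{n\ge1,\ \tau\ge0}$ of solutions of $dX=\sqrt{2X}\circ dW$, $X_0=x_0$, such that a.s. $X^{n,\tau}_t=S_t\mathbf 1_{t<T_n}$ for all $t\le T_n+\tau$, and $X^{n,\tau}$ has the same law as the killed process restarted after the delay $\tau$, $$S_t\,\mathbf 1_{t<T_n}+\tfrac12\,(W_t-W_{\sigma})^2\,\mathbf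 1_{t>\sigma},\qquad \sigma=T_n+\tau;$$ and $X^{n,\tau}$ and $X^{m,\tau'}$ have different laws whenever $\tau\ne\tau'$. 6. By contrast, the Itô equation $dX=\sqrt{2X}\,dW$, $X_0=x_0$, has a solution, and any two of its solutions are indistinguishable. -/

import Mathlib

open MeasureTheory ProbabilityTheory Filter Topology
open scoped NNReal ENNReal

namespace StratFeller

/-- `W` is a Brownian motion with respect to the filtration `F`: it is a Brownian motion
(started at `0`, with almost surely continuous paths), `W t` is `F t`-measurable for all `t`, and
`W t - W s` is independent of `F s` for all `s < t`. -/
structure IsBrownianWrt {Ω : Type*} {mΩ : MeasurableSpace Ω} (F : Filtration ℝ≥0 mΩ)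
    (P : Measure Ω) (W : ℝ≥0 → Ω → ℝ) : Prop where
  isBrownian : IsBrownianReal W P
  adapted : ∀ t, Measurable[F t] (W t)
  indep_increment : ∀ s t, s < t →
    Indep ((inferInstance : MeasurableSpace ℝ).comap fun ω => W t ω - W s ω) (F s) P

/-- A finite partition `0 = pt 0 ≤ pt 1 ≤ ⋯ ≤ pt n = T` of `[0, T]` (the values `pt i` with
`i > n` play no role). -/
structure TimePartition (T : ℝ≥0) where
  n : ℕ
  pt : ℕ → ℝ≥0
  mono : Monotone pt
  pt_zero : pt 0 = 0
  pt_last : pt n = T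

/-- The diameter of a partition: its largest step. -/
noncomputable def TimePartition.diam {T : ℝ≥0} (p : TimePartition T) : ℝ≥0 :=
  (Finset.range p.n).sup fun i => p.pt (i + 1) - p.pt i

/-- The filter on the partitions of `[0, T]` that expresses that the diameter tends to `0`. -/
noncomputable def diamToZero (T : ℝ≥0) : Filter (TimePartition T) :=
  Filter.comap TimePartition.diam (𝓝 0)

/-- `∑ f(t_{i-1}) (W(t_i) - W(t_{i-1}))`. -/
noncomputable def itoSum {Ω : Type*} (W f : ℝ≥0 → Ω → ℝ) {T : ℝ≥0} (p : TimePartition T)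
    (ω : Ω) : ℝ :=
  ∑ i ∈ Finset.range p.n, f (p.pt i) ω * (W (p.pt (i + 1)) ω - W (p.pt i) ω)

/-- `∑ f((t_{i-1} + t_i) / 2) (W(t_i) - W(t_{i-1}))`. -/
noncomputable def stratonovichSum {Ω : Type*} (W f : ℝ≥0 → Ω → ℝ) {T : ℝ≥0}
    (p : TimePartition T) (ω : Ω) : ℝ :=
  ∑ i ∈ Finset.range p.n,
    f ((p.pt i + p.pt (i + 1)) / 2) ω * (W (p.pt (i + 1)) ω - W (p.pt i) ω)

/-- The Itô integral of `f` over `[0, T]` against `W` exists and equals `I`. -/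
def HasItoIntegral {Ω : Type*} {mΩ : MeasurableSpace Ω} (P : Measure Ω) (W f : ℝ≥0 → Ω → ℝ)
    (T : ℝ≥0) (I : Ω → ℝ) : Prop :=
  TendstoInMeasure P (fun p : TimePartition T => itoSum W f p) (diamToZero T) I

/-- The Stratonovich integral of `f` over `[0, T]` against `W` exists and equals `I`. -/
def HasStratonovichIntegral {Ω : Type*} {mΩ : MeasurableSpace Ω} (P : Measure Ω)
    (W f : ℝ≥0 → Ω → ℝ) (T : ℝ≥0) (I : Ω → ℝ) : Prop :=
  TendstoInMeasure P (fun p : TimePartition T => stratonovichSum W f p) (diamToZero T) I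

/-- The processes in which solutions are sought: adapted (as usual, up to null sets, that is, to
the `P`-completion of `F`), with almost surely continuous and nonnegative paths. -/
structure IsAdmissible {Ω : Type*} {mΩ : MeasurableSpace Ω} (F : Filtration ℝ≥0 mΩ)
    (P : Measure Ω) (X : ℝ≥0 → Ω → ℝ) : Prop where
  adapted : ∀ t, AEStronglyMeasurable[F t] (X t) P
  continuous : ∀ᵐ ω ∂P, Continuous fun t => X t ω
  nonneg : ∀ᵐ ω ∂P, ∀ t, 0 ≤ X t ω

/-- `X` solves `dX = √(2X) dW`, `X_0 = x₀` in the sense of Itô, for the given `W`. -/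
structure IsItoSolution {Ω : Type*} {mΩ : MeasurableSpace Ω} (F : Filtration ℝ≥0 mΩ)
    (P : Measure Ω) (W : ℝ≥0 → Ω → ℝ) (x₀ : ℝ) (X : ℝ≥0 → Ω → ℝ) : Prop
    extends IsAdmissible F P X where
  init : ∀ᵐ ω ∂P, X 0 ω = x₀
  eqn : ∀ t, HasItoIntegral P W (fun s ω => √(2 * X s ω)) t (fun ω => X t ω - x₀)

/-- `X` solves `dX = √(2X) ∘ dW`, `X_0 = x₀` in the sense of Stratonovich, for the given `W`. -/
structure IsStratonovichSolution {Ω : Type*} {mΩ : MeasurableSpace Ω} (F : Filtration ℝ≥0 mΩ)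
    (P : Measure Ω) (W : ℝ≥0 → Ω → ℝ) (x₀ : ℝ) (X : ℝ≥0 → Ω → ℝ) : Prop
    extends IsAdmissible F P X where
  init : ∀ᵐ ω ∂P, X 0 ω = x₀
  eqn : ∀ t, HasStratonovichIntegral P W (fun s ω => √(2 * X s ω)) t (fun ω => X t ω - x₀)

/-- The path-valued random variable `ω ↦ (X_t(ω))_{t ≥ 0}`; its law is taken with respect to the
product σ-algebra. -/
def path {Ω : Type*} (X : ℝ≥0 → Ω → ℝ) (ω : Ω) : ℝ≥0 → ℝ := fun t => X t ω

/-- `(√x₀ + W_t / √2)²`. -/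
noncomputable def squareProcess {Ω : Type*} (x₀ : ℝ) (W : ℝ≥0 → Ω → ℝ) (t : ℝ≥0) (ω : Ω) : ℝ :=
  (√x₀ + W t ω / √2) ^ 2

/-- `T_0 = 0` and `T_{n+1} = inf {t > T_n : X_t = 0}`, with `inf ∅ = ∞`. -/
noncomputable def zeroTime {Ω : Type*} (X : ℝ≥0 → Ω → ℝ) : ℕ → Ω → ℝ≥0∞
  | 0, _ => 0
  | n + 1, ω => ⨅ (t : ℝ≥0) (_ : zeroTime X n ω < t ∧ X t ω = 0), (t : ℝ≥0∞)

/-- The `n`-th zero time of `(√x₀ + W_t / √2)²`. -/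
noncomputable def squareZeroTime {Ω : Type*} (x₀ : ℝ) (W : ℝ≥0 → Ω → ℝ) (n : ℕ) (ω : Ω) : ℝ≥0∞ :=
  zeroTime (squareProcess x₀ W) n ω

/-- `(√x₀ + W_t / √2)² 1_{t < T_n}`. -/
noncomputable def killedProcess {Ω : Type*} (x₀ : ℝ) (W : ℝ≥0 → Ω → ℝ) (n : ℕ) (t : ℝ≥0)
    (ω : Ω) : ℝ :=
  if (t : ℝ≥0∞) < squareZeroTime x₀ W n ω then squareProcess x₀ W t ω else 0

/-- `(W_{t-τ}² / 2) 1_{t > τ}`. -/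
noncomputable def delayedProcess {Ω : Type*} (W : ℝ≥0 → Ω → ℝ) (τ : ℝ≥0) (t : ℝ≥0) (ω : Ω) : ℝ :=
  if τ < t then W (t - τ) ω ^ 2 / 2 else 0

/-- `(√x₀ + W_t / √2)² 1_{t < T_n} + ((W_t - W_σ)² / 2) 1_{t > σ}` with `σ = T_n + τ`: the killed
process, restarted from `0` after the delay `τ`. -/
noncomputable def restartedProcess {Ω : Type*} (x₀ : ℝ) (W : ℝ≥0 → Ω → ℝ) (n : ℕ) (τ : ℝ≥0)
    (t : ℝ≥0) (ω : Ω) : ℝ :=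
  killedProcess x₀ W n t ω +
    if squareZeroTime x₀ W n ω + τ < t then
      (W t ω - W (squareZeroTime x₀ W n ω + τ).toNNReal ω) ^ 2 / 2
    else 0

end StratFeller

/-! The Stratonovich equation `dX = √(2X) ∘ dW` obeys the ordinary chain rule, so that `X = r² / 2`
solves it as soon as `dr = dW` while `r > 0`; what happens at `r = 0` is not determined. With
`β = √(2 x₀) + W`, the square process is `β² / 2`. The solutions constructed here are
`stratSolution x₀ W τ = r² / 2`, where `r` is `β` up to its first zero `T`, then `0` during a delay
`τ`, and then `β` minus its running minimum since `T + τ` (`reflected`). The minimum only moves while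
`r = 0`, where it does not contribute: on a cell with mid-point `m`, the Stratonovich summand is the
increment of `r² / 2` up to a difference of squared increments of `W` over the two halves of the
cell, whose sum is small in `L²`, and an error that is controlled by a monotone function
(`abs_stratonovich_cell_le`, `isStratonovichSolution_stratSolution`). For `τ = ∞` the solution is the
killed process.

The laws are identified through Lévy's theorem: after `σ = T + τ`, the process
`β - min_{[σ, ·]} β` has the law of `|β - β_σ|` (`map_reflected`). For the proof, the increments of
`W` after `σ` are multiplied, on a fine grid, by the sign of `β - β_σ` at the preceding grid point.
This does not change the law of `W` (`map_signChange`), and a discrete Tanaka formula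
(`abs_signChange_sub_minFrom_sub_abs_le`) shows that the reflected path of the modified Brownian
motion converges to `|β - β_σ|`. All the times `T_n` coincide almost surely, because the zero of `β`
at `T` is not isolated from the right: otherwise `β`, or its mirror image after `T`, which has the
same law (`map_mirror`), would have a local minimum at the level zero, and the minimum of `β` over a
fixed interval has no atoms (`ae_exists_zero`). The delay is visible in the law as the length of the
longest interval on which the path vanishes (`map_stratSolution_ne`).

In the Itô equation the radial part satisfies `dr = dW - dt / (2 r)` before it reaches zero. For a
given path of `W` this is an ordinary differential equation for `W - r`; it is solved with a cut-off
drift, by an Euler scheme whose limit is a measurable functional of the path, and the cut-off is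
removed (`radius`). Absorption at zero gives a solution, by the same cell-by-cell argument
(`abs_ito_cell_le`, `isItoSolution_itoSolution`). Let `Y` be another solution. While the absorbed
solution `Z` is positive the coefficient is Lipschitz, and Itô's isometry with Gronwall's inequality
give `Y = Z`; afterwards `Z = 0 ≤ Y`. So `Y - Z ≥ 0` everywhere (`ae_le_of_absorbed`). Since `Y` and
`Z` have second moments, `Y - Z` is a limit of centred Riemann sums that are bounded in `L²`, hence it
has expectation zero and vanishes (`ae_eq_of_ae_le`). -/

namespace StratFeller

/-! ### Riemann sums against Brownian motion -/

section Orthogonality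

variable {Ω : Type*} {mΩ : MeasurableSpace Ω} {P : Measure Ω}

theorem indepFun_of_aestronglyMeasurable {E : Type*} [TopologicalSpace E]
    [TopologicalSpace.PseudoMetrizableSpace E] [MeasurableSpace E] [BorelSpace E]
    {m : MeasurableSpace Ω} {φ : Ω → E} {ξ : Ω → ℝ} (hφ : AEStronglyMeasurable[m] φ P)
    (h : Indep ((inferInstance : MeasurableSpace ℝ).comap ξ) m P) : IndepFun φ ξ P := by
  have h1 : IndepFun (hφ.mk φ) ξ P :=
    (indep_of_indep_of_le_right h hφ.stronglyMeasurable_mk.measurable.comap_le).symm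
  exact h1.congr hφ.ae_eq_mk.symm EventuallyEq.rfl

/-- Sums of martingale differences with predictable bounded coefficients: centred, square
integrable, and with pairwise orthogonal terms. -/
theorem sum_mul_indep [IsProbabilityMeasure P] {F : Filtration ℝ≥0 mΩ} {t : ℕ → ℝ≥0}
    (ht : Monotone t) {φ ξ : ℕ → Ω → ℝ} {C : ℝ}
    (hφ : ∀ i, AEStronglyMeasurable[F (t i)] (φ i) P) (hC : ∀ i ω, |φ i ω| ≤ C)
    (hξ : ∀ i, AEStronglyMeasurable[F (t (i + 1))] (ξ i) P) (hL : ∀ i, MemLp (ξ i) 2 P)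
    (h0 : ∀ i, ∫ ω, ξ i ω ∂P = 0)
    (hind : ∀ i, Indep ((inferInstance : MeasurableSpace ℝ).comap (ξ i)) (F (t i)) P) (n : ℕ) :
    AEStronglyMeasurable[F (t n)] (fun ω => ∑ i ∈ Finset.range n, φ i ω * ξ i ω) P ∧
    MemLp (fun ω => ∑ i ∈ Finset.range n, φ i ω * ξ i ω) 2 P ∧
    ∫ ω, ∑ i ∈ Finset.range n, φ i ω * ξ i ω ∂P = 0 ∧
    ∫ ω, (∑ i ∈ Finset.range n, φ i ω * ξ i ω) ^ 2 ∂P =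
      ∑ i ∈ Finset.range n, (∫ ω, φ i ω ^ 2 ∂P) * ∫ ω, ξ i ω ^ 2 ∂P := by
  have hφ' : ∀ i, AEStronglyMeasurable (φ i) P := fun i => (hφ i).mono (F.le _)
  have hφL : ∀ i, MemLp (φ i) ∞ P := fun i =>
    MemLp.of_bound (hφ' i) C (Eventually.of_forall fun ω => by simpa using hC i ω)
  have hprod : ∀ i, MemLp (fun ω => φ i ω * ξ i ω) 2 P := fun i => (hL i).mul (hφL i)
  induction n with
  | zero => simp [aestronglyMeasurable_const]
  | succ n ih =>
    obtain ⟨ih1, ih2, ih3, ih4⟩ := ih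
    simp only [Finset.sum_range_succ]
    set S : Ω → ℝ := fun ω => ∑ i ∈ Finset.range n, φ i ω * ξ i ω with hS
    have hmul : ∀ {ψ : Ω → ℝ}, AEStronglyMeasurable[F (t n)] ψ P →
        ∫ ω, ψ ω * ξ n ω ∂P = 0 := by
      intro ψ hψ
      have := (indepFun_of_aestronglyMeasurable hψ (hind n)).integral_fun_mul_eq_mul_integral
        (hψ.mono (F.le _)) (hL n).1
      rw [this, h0, mul_zero]
    have hmono : F (t n) ≤ F (t (n + 1)) := F.mono (ht n.le_succ)
    refine ⟨(ih1.mono hmono).add (((hφ n).mono hmono).mul (hξ n)), ih2.add (hprod n), ?_, ?_⟩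
    · rw [integral_add (ih2.integrable one_le_two) ((hprod n).integrable one_le_two), ih3,
        hmul (hφ n), zero_add]
    · have hcross : ∫ ω, (S ω * φ n ω) * ξ n ω ∂P = 0 := hmul (ih1.mul (hφ n))
      have hsq : ∫ ω, φ n ω ^ 2 * ξ n ω ^ 2 ∂P = (∫ ω, φ n ω ^ 2 ∂P) * ∫ ω, ξ n ω ^ 2 ∂P := by
        have h2 := (indepFun_of_aestronglyMeasurable (hφ n) (hind n)).comp
          (φ := fun x : ℝ => x ^ 2) (ψ := fun x : ℝ => x ^ 2) (by fun_prop) (by fun_prop)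
        exact h2.integral_fun_mul_eq_mul_integral ((hφ' n).pow 2) ((hL n).1.pow 2)
      have e : ∀ ω, (S ω + φ n ω * ξ n ω) ^ 2 =
          S ω ^ 2 + 2 * ((S ω * φ n ω) * ξ n ω) + φ n ω ^ 2 * ξ n ω ^ 2 := fun ω => by ring
      rw [integral_congr_ae (Eventually.of_forall e)]
      have i1 : Integrable (fun ω => S ω ^ 2) P := ih2.integrable_sq
      have i2 : Integrable (fun ω => (S ω * φ n ω) * ξ n ω) P := by
        have := ih2.integrable_mul (hprod n)
        refine this.congr (Eventually.of_forall fun ω => ?_)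
        change S ω * (φ n ω * ξ n ω) = _
        ring
      have i3 : Integrable (fun ω => φ n ω ^ 2 * ξ n ω ^ 2) P := by
        refine (hprod n).integrable_sq.congr (Eventually.of_forall fun ω => ?_)
        ring
      have i12 : Integrable (fun ω => S ω ^ 2 + 2 * ((S ω * φ n ω) * ξ n ω)) P :=
        i1.add (i2.const_mul 2)
      rw [integral_add i12 i3, integral_add i1 (i2.const_mul 2), ih4,
        integral_const_mul, hcross, hsq]
      ring

end Orthogonality

section Increments

variable {Ω : Type*} {mΩ : MeasurableSpace Ω} {P : Measure Ω}
  {F : Filtration ℝ≥0 mΩ} {W : ℝ≥0 → Ω → ℝ}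

theorem IsBrownianWrt.measurable (hW : IsBrownianWrt F P W) (t : ℝ≥0) : Measurable (W t) :=
  (hW.adapted t).mono (F.le t) le_rfl

theorem IsBrownianWrt.measurable_of_le (hW : IsBrownianWrt F P W) {s t : ℝ≥0} (h : s ≤ t) :
    Measurable[F t] (W s) :=
  (hW.adapted s).mono (F.mono h) le_rfl

theorem IsBrownianWrt.indep [IsProbabilityMeasure P] (hW : IsBrownianWrt F P W) {s t : ℝ≥0} (h : s ≤ t) :
    Indep ((inferInstance : MeasurableSpace ℝ).comap fun ω => W t ω - W s ω) (F s) P := by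
  rcases h.eq_or_lt with rfl | h
  · have : (fun ω => W s ω - W s ω) = fun _ => (0 : ℝ) := by ext; simp
    rw [this, MeasurableSpace.comap_const]
    exact indep_bot_left _
  · exact hW.indep_increment s t h

theorem IsBrownianWrt.hasLaw_increment (hW : IsBrownianWrt F P W) {s t : ℝ≥0} (h : s ≤ t) :
    HasLaw (fun ω => W t ω - W s ω) (gaussianReal 0 (t - s)) P := by
  have := hW.isBrownian.hasLaw_sub t s
  have e : nndist (t : ℝ) (s : ℝ) = t - s := by
    ext
    rw [coe_nndist, Real.dist_eq, abs_of_nonneg (sub_nonneg.2 (by exact_mod_cast h)),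
      NNReal.coe_sub h]
  rw [show nndist t.1 s.1 = t - s from e] at this
  exact this

theorem IsBrownianWrt.memLp_increment (hW : IsBrownianWrt F P W) {s t : ℝ≥0} (h : s ≤ t)
    (p : ℝ≥0) : MemLp (fun ω => W t ω - W s ω) p P := by
  have hl := hW.hasLaw_increment h
  have := memLp_id_gaussianReal (μ := 0) (v := t - s) p
  rw [← hl.map_eq, memLp_map_measure_iff (by fun_prop) hl.aemeasurable] at this
  exact this

theorem IsBrownianWrt.integral_increment (hW : IsBrownianWrt F P W) {s t : ℝ≥0} (h : s ≤ t) :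
    ∫ ω, (W t ω - W s ω) ∂P = 0 := by
  rw [(hW.hasLaw_increment h).integral_eq, integral_id_gaussianReal]

theorem IsBrownianWrt.integral_increment_sq (hW : IsBrownianWrt F P W) {s t : ℝ≥0} (h : s ≤ t) :
    ∫ ω, (W t ω - W s ω) ^ 2 ∂P = t - s := by
  have h1 := (hW.hasLaw_increment h).integral_comp (f := fun x : ℝ => x ^ 2) (by fun_prop)
  have h2 := variance_fun_id_gaussianReal (μ := 0) (v := t - s)
  rw [variance_eq_integral (by fun_prop)] at h2
  simp only [integral_id_gaussianReal, sub_zero] at h2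
  simp only [Function.comp_def] at h1
  rw [h1, h2, NNReal.coe_sub h]

/-- The variance of the square of a centred Gaussian variable, by scaling from variance `1`. -/
theorem integral_sq_sub_sq_gaussianReal (v : ℝ≥0) :
    ∫ x, (x ^ 2 - v) ^ 2 ∂(gaussianReal 0 v) =
      (∫ x, (x ^ 2 - 1) ^ 2 ∂(gaussianReal 0 1)) * v ^ 2 := by
  have h := gaussianReal_map_const_mul (μ := 0) (v := 1) (√v)
  have hv : NNReal.mk ((√v) ^ 2) (sq_nonneg _) * 1 = v := by
    ext; simp
  rw [mul_zero, hv] at h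
  rw [← h, integral_map (by fun_prop) (by fun_prop), ← integral_mul_const]
  refine integral_congr_ae (Eventually.of_forall fun x => ?_)
  have := Real.sq_sqrt v.2
  simp only [mul_pow, NNReal.val_eq_coe] at this ⊢
  rw [this]; ring

theorem IsBrownianWrt.memLp_increment_sq [IsProbabilityMeasure P] (hW : IsBrownianWrt F P W) {s t : ℝ≥0} (h : s ≤ t) :
    MemLp (fun ω => (W t ω - W s ω) ^ 2 - (t - s)) 2 P := by
  have h4 := hW.memLp_increment h 4
  have : MemLp (fun ω => (W t ω - W s ω) ^ 2) 2 P := by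
    have h2 : MemLp (fun ω => (W t ω - W s ω) * (W t ω - W s ω)) 2 P := by
      refine MemLp.mul (p := 4) (q := 4) h4 h4 (hpqr := ⟨?_⟩)
      rw [← two_mul, show (4 : ℝ≥0∞) = 2 * 2 by norm_num,
        ENNReal.mul_inv (by simp) (by simp), ← mul_assoc, ENNReal.mul_inv_cancel (by simp) (by simp),
        one_mul]
    simpa [sq] using h2
  exact this.sub (memLp_const _)

theorem IsBrownianWrt.integral_increment_sq_sub [IsProbabilityMeasure P] (hW : IsBrownianWrt F P W) {s t : ℝ≥0}
    (h : s ≤ t) : ∫ ω, ((W t ω - W s ω) ^ 2 - (t - s)) ∂P = 0 := by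
  rw [integral_sub (by simpa using (hW.memLp_increment h 2).integrable_sq) (integrable_const _),
    hW.integral_increment_sq h]
  simp

theorem IsBrownianWrt.integral_increment_sq_sub_sq (hW : IsBrownianWrt F P W) {s t : ℝ≥0}
    (h : s ≤ t) : ∫ ω, ((W t ω - W s ω) ^ 2 - (t - s)) ^ 2 ∂P =
      (∫ x, (x ^ 2 - 1) ^ 2 ∂(gaussianReal 0 1)) * ((t : ℝ) - s) ^ 2 := by
  have h1 := (hW.hasLaw_increment h).integral_comp
    (f := fun x : ℝ => (x ^ 2 - ((t : ℝ) - s)) ^ 2) (by fun_prop)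
  simp only [Function.comp_def] at h1
  rw [h1, ← NNReal.coe_sub h, integral_sq_sub_sq_gaussianReal]

/-- The first and second moments of a Riemann sum against `W`. -/
theorem IsBrownianWrt.sum_increment [IsProbabilityMeasure P] (hW : IsBrownianWrt F P W) {t : ℕ → ℝ≥0} (ht : Monotone t)
    {φ : ℕ → Ω → ℝ} {C : ℝ} (hφ : ∀ i, AEStronglyMeasurable[F (t i)] (φ i) P)
    (hC : ∀ i ω, |φ i ω| ≤ C) (n : ℕ) :
    MemLp (fun ω => ∑ i ∈ Finset.range n, φ i ω * (W (t (i + 1)) ω - W (t i) ω)) 2 P ∧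
    ∫ ω, ∑ i ∈ Finset.range n, φ i ω * (W (t (i + 1)) ω - W (t i) ω) ∂P = 0 ∧
    ∫ ω, (∑ i ∈ Finset.range n, φ i ω * (W (t (i + 1)) ω - W (t i) ω)) ^ 2 ∂P =
      ∑ i ∈ Finset.range n, (∫ ω, φ i ω ^ 2 ∂P) * (t (i + 1) - t i) := by
  have h := sum_mul_indep ht hφ hC (ξ := fun i ω => W (t (i + 1)) ω - W (t i) ω)
    (fun i => (((hW.adapted _).sub (hW.measurable_of_le (ht i.le_succ))).stronglyMeasurable
      ).aestronglyMeasurable)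
    (fun i => by simpa using hW.memLp_increment (ht i.le_succ) 2)
    (fun i => hW.integral_increment (ht i.le_succ)) (fun i => hW.indep (ht i.le_succ)) n
  refine ⟨h.2.1, h.2.2.1, h.2.2.2.trans (Finset.sum_congr rfl fun i _ => ?_)⟩
  rw [hW.integral_increment_sq (ht i.le_succ)]

/-- The compensated quadratic variation along a partition is small in `L²`. -/
theorem IsBrownianWrt.sum_increment_sq [IsProbabilityMeasure P] (hW : IsBrownianWrt F P W) {t : ℕ → ℝ≥0} (ht : Monotone t)
    {φ : ℕ → Ω → ℝ} {C : ℝ} (hφ : ∀ i, AEStronglyMeasurable[F (t i)] (φ i) P)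
    (hC : ∀ i ω, |φ i ω| ≤ C) (n : ℕ) :
    MemLp (fun ω => ∑ i ∈ Finset.range n,
      φ i ω * ((W (t (i + 1)) ω - W (t i) ω) ^ 2 - (t (i + 1) - t i))) 2 P ∧
    ∫ ω, (∑ i ∈ Finset.range n,
      φ i ω * ((W (t (i + 1)) ω - W (t i) ω) ^ 2 - (t (i + 1) - t i))) ^ 2 ∂P ≤
      C ^ 2 * (∫ x, (x ^ 2 - 1) ^ 2 ∂(gaussianReal 0 1)) *
        ∑ i ∈ Finset.range n, ((t (i + 1) : ℝ) - t i) ^ 2 := by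
  have h := sum_mul_indep ht hφ hC
    (ξ := fun i ω => (W (t (i + 1)) ω - W (t i) ω) ^ 2 - (t (i + 1) - t i))
    (fun i => (((((hW.adapted _).sub (hW.measurable_of_le (ht i.le_succ))).pow_const 2).sub_const
      _).stronglyMeasurable).aestronglyMeasurable)
    (fun i => hW.memLp_increment_sq (ht i.le_succ))
    (fun i => hW.integral_increment_sq_sub (ht i.le_succ))
    (fun i => indep_of_indep_of_le_left (hW.indep (ht i.le_succ)) (by
      refine Measurable.comap_le (Measurable.sub_const (Measurable.pow_const ?_ 2) _)
      exact comap_measurable _)) n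
  refine ⟨h.2.1, h.2.2.2.le.trans ?_⟩
  rw [Finset.mul_sum]
  refine Finset.sum_le_sum fun i _ => ?_
  rw [hW.integral_increment_sq_sub_sq (ht i.le_succ), ← mul_assoc]
  have hb : ∫ ω, φ i ω ^ 2 ∂P ≤ C ^ 2 := by
    have : ∫ ω, φ i ω ^ 2 ∂P ≤ ∫ _, C ^ 2 ∂P := by
      refine integral_mono_of_nonneg (Eventually.of_forall fun ω => sq_nonneg _)
        (integrable_const _) (Eventually.of_forall fun ω => ?_)
      exact sq_le_sq.2 ((hC i ω).trans (le_abs_self C))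
    simpa using this
  gcongr

end Increments

section Convergence

variable {Ω : Type*} {mΩ : MeasurableSpace Ω} {P : Measure Ω}

instance {T : ℝ≥0} : (diamToZero T).IsCountablyGenerated := by
  unfold diamToZero; infer_instance

theorem tendstoInMeasure_of_ae_tendsto {ι : Type*} {l : Filter ι} [l.IsCountablyGenerated]
    [IsFiniteMeasure P] {f : ι → Ω → ℝ} {g : Ω → ℝ} (hf : ∀ i, AEStronglyMeasurable (f i) P)
    (h : ∀ᵐ ω ∂P, Tendsto (fun i => f i ω) l (𝓝 (g ω))) : TendstoInMeasure P f l g := by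
  intro ε hε
  refine tendsto_of_seq_tendsto fun u hu => ?_
  exact tendstoInMeasure_of_tendsto_ae (fun n => hf (u n))
    (h.mono fun ω hω => hω.comp hu) ε hε

theorem tendstoInMeasure_zero_of_integral_sq {ι : Type*} {l : Filter ι}
    {M : ι → Ω → ℝ} (hM : ∀ i, MemLp (M i) 2 P)
    (h : Tendsto (fun i => ∫ ω, M i ω ^ 2 ∂P) l (𝓝 0)) :
    TendstoInMeasure P M l (fun _ => 0) := by
  refine tendstoInMeasure_of_tendsto_eLpNorm (p := 2) two_ne_zero (fun i => (hM i).1)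
    aestronglyMeasurable_const ?_
  have e : ∀ i, eLpNorm (M i - fun _ => 0) 2 P = ENNReal.ofReal (√(∫ ω, M i ω ^ 2 ∂P)) := by
    intro i
    have : M i - (fun _ => (0 : ℝ)) = M i := by ext; simp
    rw [this, (hM i).eLpNorm_eq_integral_rpow_norm two_ne_zero (by simp)]
    simp [Real.sqrt_eq_rpow]
  simp_rw [e]
  have := ENNReal.tendsto_ofReal ((Real.continuous_sqrt.tendsto 0).comp h)
  simpa using this

theorem tendstoInMeasure_add_zero {ι : Type*} {l : Filter ι} {f : ι → Ω → ℝ} {g : Ω → ℝ}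
    {M E : ι → Ω → ℝ} (hf : ∀ i, ∀ᵐ ω ∂P, f i ω - g ω = M i ω + E i ω)
    (hM : TendstoInMeasure P M l fun _ => 0) (hE : TendstoInMeasure P E l fun _ => 0) :
    TendstoInMeasure P f l g := by
  rw [tendstoInMeasure_iff_dist] at *
  intro ε hε
  have h := (hM (ε / 2) (half_pos hε)).add (hE (ε / 2) (half_pos hε))
  rw [add_zero] at h
  refine tendsto_of_tendsto_of_tendsto_of_le_of_le tendsto_const_nhds h (fun _ => zero_le) fun i => ?_
  refine le_trans (measure_mono_ae ?_) (measure_union_le _ _)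
  filter_upwards [hf i] with ω hω h1
  change ε ≤ dist (f i ω) (g ω) at h1
  change ε / 2 ≤ dist (M i ω) 0 ∨ ε / 2 ≤ dist (E i ω) 0
  rw [Real.dist_eq, hω] at h1
  simp only [Real.dist_eq, sub_zero]
  by_contra! hc
  linarith [abs_add_le (M i ω) (E i ω)]

/-- The form in which the stochastic integrals below are identified: the error splits into a
part that is small in `L²` and a part that tends to zero pathwise. -/
theorem tendstoInMeasure_diamToZero [IsProbabilityMeasure P] {T : ℝ≥0}
    {f : TimePartition T → Ω → ℝ} {g : Ω → ℝ}
    {M : TimePartition T → Ω → ℝ} {K : ℝ}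
    (hf : ∀ p, AEStronglyMeasurable (f p) P) (hg : AEStronglyMeasurable g P)
    (hM : ∀ p, MemLp (M p) 2 P) (hM2 : ∀ p, ∫ ω, M p ω ^ 2 ∂P ≤ K * p.diam)
    (hE : ∀ᵐ ω ∂P, Tendsto (fun p => f p ω - g ω - M p ω) (diamToZero T) (𝓝 0)) :
    TendstoInMeasure P f (diamToZero T) g := by
  refine tendstoInMeasure_add_zero (M := M) (E := fun p ω => f p ω - g ω - M p ω)
    (fun p => Eventually.of_forall fun ω => by ring)
    (tendstoInMeasure_zero_of_integral_sq hM ?_)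
    (tendstoInMeasure_of_ae_tendsto (fun p => ((hf p).sub hg).sub (hM p).1) hE)
  have hd : Tendsto (fun p : TimePartition T => K * (p.diam : ℝ)) (diamToZero T) (𝓝 0) := by
    have h1 : Tendsto TimePartition.diam (diamToZero T) (𝓝 0) := tendsto_comap
    have h2 : Tendsto (fun p : TimePartition T => (p.diam : ℝ)) (diamToZero T) (𝓝 0) := by
      exact_mod_cast (NNReal.continuous_coe.tendsto 0).comp h1
    simpa using h2.const_mul K
  exact squeeze_zero (fun p => integral_nonneg fun ω => sq_nonneg _) hM2 hd

end Convergence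

section Partition

variable {T : ℝ≥0}

theorem TimePartition.step_le_diam (p : TimePartition T) {i : ℕ} (hi : i < p.n) :
    p.pt (i + 1) - p.pt i ≤ p.diam :=
  Finset.le_sup (f := fun i => p.pt (i + 1) - p.pt i) (Finset.mem_range.2 hi)

theorem TimePartition.pt_le (p : TimePartition T) {i : ℕ} (hi : i ≤ p.n) : p.pt i ≤ T :=
  (p.mono hi).trans p.pt_last.le

theorem TimePartition.sum_step (p : TimePartition T) :
    ∑ i ∈ Finset.range p.n, ((p.pt (i + 1) : ℝ) - p.pt i) = T := by
  rw [Finset.sum_range_sub (fun i => (p.pt i : ℝ)), p.pt_last, p.pt_zero]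
  simp

theorem TimePartition.sum_step_sq_le (p : TimePartition T) :
    ∑ i ∈ Finset.range p.n, ((p.pt (i + 1) : ℝ) - p.pt i) ^ 2 ≤ T * p.diam := by
  rw [← p.sum_step, Finset.sum_mul]
  refine Finset.sum_le_sum fun i hi => ?_
  have h1 : (p.pt i : ℝ) ≤ p.pt (i + 1) := by exact_mod_cast p.mono i.le_succ
  have h2 : (p.pt (i + 1) : ℝ) - p.pt i ≤ p.diam := by
    rw [← NNReal.coe_sub (p.mono i.le_succ)]
    exact_mod_cast p.step_le_diam (Finset.mem_range.1 hi)
  rw [sq]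
  exact mul_le_mul_of_nonneg_left h2 (sub_nonneg.2 h1)

/-- The partition with the mid-points added. -/
noncomputable def TimePartition.refine (p : TimePartition T) (j : ℕ) : ℝ≥0 :=
  if j % 2 = 0 then p.pt (j / 2) else (p.pt (j / 2) + p.pt (j / 2 + 1)) / 2

/-- A continuous path oscillates little on the cells of fine partitions. -/
theorem eventually_osc_le {w : ℝ≥0 → ℝ} (hw : Continuous w) (T : ℝ≥0) {δ : ℝ} (hδ : 0 < δ) :
    ∀ᶠ p in diamToZero T, ∀ i < (p : TimePartition T).n, ∀ u ∈ Set.Icc (p.pt i) (p.pt (i + 1)),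
      ∀ v ∈ Set.Icc (p.pt i) (p.pt (i + 1)), |w u - w v| ≤ δ := by
  have hc : UniformContinuousOn w (Set.Icc 0 T) :=
    isCompact_Icc.uniformContinuousOn_of_continuous hw.continuousOn
  obtain ⟨η, hη, h⟩ := Metric.uniformContinuousOn_iff.1 hc δ hδ
  have hev : ∀ᶠ p in diamToZero T, (p : TimePartition T).diam < η.toNNReal :=
    tendsto_comap.eventually (eventually_lt_nhds (Real.toNNReal_pos.2 hη))
  filter_upwards [hev] with p hp i hi u hu v hv
  have hT := p.pt_le (Nat.succ_le_of_lt hi)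
  have hd := (p.step_le_diam hi).trans_lt hp
  refine (h u ⟨zero_le, hu.2.trans hT⟩ v ⟨zero_le, hv.2.trans hT⟩ ?_).le
  have h3 : (p.pt (i + 1) : ℝ) - p.pt i < η := by
    rw [← NNReal.coe_sub (p.mono i.le_succ)]
    have := NNReal.coe_lt_coe.2 hd
    rwa [Real.coe_toNNReal _ hη.le] at this
  have h1 : ((p.pt i : ℝ≥0) : ℝ) ≤ u := by exact_mod_cast hu.1
  have h2 : (u : ℝ) ≤ p.pt (i + 1) := by exact_mod_cast hu.2
  have h4 : ((p.pt i : ℝ≥0) : ℝ) ≤ v := by exact_mod_cast hv.1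
  have h5 : (v : ℝ) ≤ p.pt (i + 1) := by exact_mod_cast hv.2
  rw [NNReal.dist_eq, abs_lt]
  constructor <;> linarith

end Partition

end StratFeller

namespace StratFeller

/-! ### Hitting times, running minima and reflected paths -/

/-- A dense sequence of times, used to write path functionals through countably many
coordinates, so that they are measurable for the product σ-algebra. -/
noncomputable def dens (n : ℕ) : ℝ≥0 := TopologicalSpace.denseSeq ℝ≥0 n

theorem exists_dens_mem {U : Set ℝ≥0} (hU : IsOpen U) (hne : U.Nonempty) : ∃ n, dens n ∈ U :=
  (TopologicalSpace.denseRange_denseSeq ℝ≥0).exists_mem_open hU hne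

open Classical in
/-- The first time at which a path is not positive, written with countably many coordinates; for
continuous paths see `lt_hitTime_iff`. -/
noncomputable def hitTime (w : ℝ≥0 → ℝ) : ℝ≥0∞ :=
  ⨆ n, if ∃ k : ℕ, ∀ m, dens m ≤ dens n → 1 / ((k : ℝ) + 1) ≤ w (dens m) then
    (dens n : ℝ≥0∞) else 0

theorem measurable_hitTime : Measurable hitTime := by
  refine Measurable.iSup fun n => Measurable.ite ?_ measurable_const measurable_const
  simp only [Set.ofPred_exists, Set.ofPred_forall]
  refine MeasurableSet.iUnion fun k => MeasurableSet.iInter fun m => MeasurableSet.iInter fun _ => ?_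
  exact measurableSet_le measurable_const (measurable_pi_apply _)

theorem lt_hitTime_iff {w : ℝ≥0 → ℝ} (hw : Continuous w) {t : ℝ≥0} :
    (t : ℝ≥0∞) < hitTime w ↔ ∀ s ≤ t, 0 < w s := by
  constructor
  · intro h s hs
    obtain ⟨n, hn⟩ := lt_iSup_iff.1 h
    split_ifs at hn with hk
    · obtain ⟨k, hk⟩ := hk
      have htn : t < dens n := by exact_mod_cast hn
      by_contra! hc
      have hpos : (0 : ℝ) < 1 / ((k : ℝ) + 1) := by positivity
      have hU : IsOpen ({u | w u < 1 / ((k : ℝ) + 1)} ∩ Set.Iio (dens n)) :=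
        (isOpen_lt hw continuous_const).inter isOpen_Iio
      obtain ⟨m, hm1, hm2⟩ := exists_dens_mem hU ⟨s, hc.trans_lt hpos, hs.trans_lt htn⟩
      exact absurd (hk m (le_of_lt hm2)) (not_le.2 hm1)
    · simp at hn
  · intro h
    obtain ⟨u, hu, hmin⟩ := isCompact_Icc.exists_isMinOn
      (⟨0, zero_le, zero_le⟩ : (Set.Icc 0 t).Nonempty) hw.continuousOn
    obtain ⟨k, hk⟩ := exists_nat_one_div_lt (h u hu.2)
    have hev : ∀ᶠ s in 𝓝 t, 1 / ((k : ℝ) + 1) < w s :=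
      hw.continuousAt.eventually (lt_mem_nhds (hk.trans_le (hmin ⟨zero_le, le_rfl⟩)))
    obtain ⟨η, hη, hball⟩ := Metric.eventually_nhds_iff.1 hev
    have hne : (Set.Ioo t (t + ⟨η, hη.le⟩)).Nonempty :=
      Set.nonempty_Ioo.2 (lt_add_of_pos_right _ (by exact_mod_cast hη))
    obtain ⟨n, hn⟩ := exists_dens_mem isOpen_Ioo hne
    refine lt_of_lt_of_le ?_ (le_iSup _ n)
    rw [if_pos]
    · exact_mod_cast hn.1
    refine ⟨k, fun m hm => ?_⟩
    rcases le_or_gt (dens m) t with hmt | hmt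
    · exact hk.le.trans (hmin ⟨zero_le, hmt⟩)
    · refine (hball ?_).le
      have h1 : (dens m : ℝ) < t + η := by
        have := hm.trans_lt hn.2
        exact_mod_cast NNReal.coe_lt_coe.2 this
      have h2 : (t : ℝ) < dens m := by exact_mod_cast hmt
      rw [NNReal.dist_eq, abs_lt]; constructor <;> linarith

theorem eq_zero_of_hitTime_eq {w : ℝ≥0 → ℝ} (hw : Continuous w) (h0 : 0 ≤ w 0) {t : ℝ≥0}
    (h : hitTime w = t) : w t = 0 := by
  have hlt : ∀ s < t, 0 < w s := fun s hs =>
    (lt_hitTime_iff hw).1 (by rw [h]; exact_mod_cast hs) s le_rfl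
  have hnot : ¬ ∀ s ≤ t, 0 < w s := fun hc => by
    have := (lt_hitTime_iff hw).2 hc
    rw [h] at this
    exact lt_irrefl _ this
  push Not at hnot
  obtain ⟨s, hs, hws⟩ := hnot
  have hst : s = t := by
    by_contra hne
    exact absurd (hlt s (lt_of_le_of_ne hs hne)) (not_lt.2 hws)
  subst hst
  refine le_antisymm hws ?_
  rcases eq_or_ne s 0 with rfl | hs0
  · exact h0
  by_contra! hc
  have hU : IsOpen {u | w u < 0} := isOpen_lt hw continuous_const
  have hcl : s ∈ closure (Set.Iio s) := by
    rw [closure_Iio' ⟨0, pos_iff_ne_zero.2 hs0⟩]; exact Set.mem_Iic.2 le_rfl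
  obtain ⟨u, hu1, hu2⟩ := mem_closure_iff.1 hcl _ hU hc
  exact absurd (hlt u hu2) (not_lt.2 (le_of_lt hu1))

/-- The minimum of a path over `[σ, t]`, written with countably many coordinates; for continuous
paths see `minFrom_le` and `exists_minFrom_eq`. -/
noncomputable def minFrom (σ : ℝ≥0∞) (t : ℝ≥0) (w : ℝ≥0 → ℝ) : ℝ :=
  ⨅ n, if σ ≤ dens n ∧ dens n ≤ t then w (dens n) else w t

section MinFrom

variable {w : ℝ≥0 → ℝ} {s t : ℝ≥0}

theorem le_minFrom {c : ℝ} (h : ∀ u ∈ Set.Icc s t, c ≤ w u) (hst : s ≤ t) :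
    c ≤ minFrom s t w := by
  refine le_ciInf fun n => ?_
  split_ifs with hn
  · exact h _ ⟨by exact_mod_cast hn.1, hn.2⟩
  · exact h _ ⟨hst, le_rfl⟩

theorem minFrom_le (hw : Continuous w) {u : ℝ≥0} (hu : u ∈ Set.Icc s t) :
    minFrom s t w ≤ w u := by
  have hst := hu.1.trans hu.2
  obtain ⟨v, hv, hmin⟩ := isCompact_Icc.exists_isMinOn
    (⟨s, le_rfl, hst⟩ : (Set.Icc s t).Nonempty) hw.continuousOn
  have hbdd : BddBelow (Set.range fun n =>
      if (s : ℝ≥0∞) ≤ dens n ∧ dens n ≤ t then w (dens n) else w t) := by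
    refine ⟨w v, ?_⟩
    rintro _ ⟨n, rfl⟩
    dsimp only
    split_ifs with hn
    · exact hmin ⟨by exact_mod_cast hn.1, hn.2⟩
    · exact hmin ⟨hst, le_rfl⟩
  rcases hst.eq_or_lt with rfl | hlt
  · obtain rfl : u = s := le_antisymm hu.2 hu.1
    refine (ciInf_le hbdd 0).trans ?_
    split_ifs with hn
    · have : dens 0 = u := le_antisymm hn.2 (by exact_mod_cast hn.1)
      rw [this]
    · exact le_rfl
  · by_contra! hc
    have hU : IsOpen {u | w u < minFrom s t w} := isOpen_lt hw continuous_const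
    have hcl : u ∈ closure (Set.Ioo s t) := by rw [closure_Ioo hlt.ne]; exact hu
    obtain ⟨x, hx⟩ := mem_closure_iff.1 hcl _ hU hc
    obtain ⟨n, hn1, hn2⟩ := exists_dens_mem (hU.inter isOpen_Ioo) ⟨x, hx⟩
    have := ciInf_le hbdd n
    rw [if_pos ⟨by exact_mod_cast hn2.1.le, hn2.2.le⟩] at this
    exact absurd this (not_le.2 hn1)

theorem exists_minFrom_eq (hw : Continuous w) (hst : s ≤ t) :
    ∃ u ∈ Set.Icc s t, minFrom s t w = w u := by
  obtain ⟨v, hv, hmin⟩ := isCompact_Icc.exists_isMinOn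
    (⟨s, le_rfl, hst⟩ : (Set.Icc s t).Nonempty) hw.continuousOn
  exact ⟨v, hv, le_antisymm (minFrom_le hw hv) (le_minFrom (fun u hu => hmin hu) hst)⟩

theorem minFrom_self (hw : Continuous w) : minFrom s s w = w s :=
  le_antisymm (minFrom_le hw ⟨le_rfl, le_rfl⟩)
    (le_minFrom (fun u hu => by rw [le_antisymm hu.2 hu.1]) le_rfl)

theorem minFrom_anti (hw : Continuous w) {b : ℝ≥0} (hst : s ≤ t) (htb : t ≤ b) :
    minFrom s b w ≤ minFrom s t w :=
  le_minFrom (fun _ hu => minFrom_le hw ⟨hu.1, hu.2.trans htb⟩) hst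

end MinFrom

/-- The path `w` up to its first zero `T`, then `0` during a delay `τ`, then `w` reflected at its
running minimum. The delay `τ = ∞` gives the path killed at its first zero. -/
noncomputable def reflected (τ : ℝ≥0∞) (w : ℝ≥0 → ℝ) (t : ℝ≥0) : ℝ :=
  if (t : ℝ≥0∞) < hitTime w then w t
  else if (t : ℝ≥0∞) ≤ hitTime w + τ then 0
  else w t - minFrom (hitTime w + τ) t w

theorem measurable_reflected (τ : ℝ≥0∞) : Measurable (reflected τ) := by
  refine measurable_pi_lambda _ fun t => ?_
  have hT := measurable_hitTime
  refine Measurable.ite (measurableSet_lt measurable_const hT) (measurable_pi_apply _)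
    (Measurable.ite (measurableSet_le measurable_const (hT.add_const _)) measurable_const
      ((measurable_pi_apply _).sub (Measurable.iInf fun n => ?_)))
  refine Measurable.ite ?_ (measurable_pi_apply _) (measurable_pi_apply _)
  exact (measurableSet_le (hT.add_const _) measurable_const).inter (MeasurableSet.const _)

section Reflected

variable {w : ℝ≥0 → ℝ} {τ : ℝ≥0∞} {s t : ℝ≥0}

theorem reflected_of_lt (h : (t : ℝ≥0∞) < hitTime w) : reflected τ w t = w t := if_pos h

theorem reflected_of_mem (h1 : hitTime w ≤ t) (h2 : (t : ℝ≥0∞) ≤ hitTime w + τ) :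
    reflected τ w t = 0 := by
  rw [reflected, if_neg (not_lt.2 h1), if_pos h2]

theorem reflected_of_ge (hw : Continuous w) (hs : hitTime w + τ = s) (h : s ≤ t) :
    reflected τ w t = w t - minFrom s t w := by
  have h1 : hitTime w ≤ s := hs ▸ le_self_add
  have h2 : (s : ℝ≥0∞) ≤ t := by exact_mod_cast h
  rcases h.eq_or_lt with rfl | hlt
  · rw [reflected_of_mem h1 hs.ge, minFrom_self hw, sub_self]
  · rw [reflected, if_neg (not_lt.2 (h1.trans h2)), if_neg, hs]
    rw [hs, not_le]
    exact_mod_cast hlt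

theorem reflected_nonneg (hw : Continuous w) (τ : ℝ≥0∞) (t : ℝ≥0) : 0 ≤ reflected τ w t := by
  rcases lt_or_ge (t : ℝ≥0∞) (hitTime w) with h1 | h1
  · rw [reflected_of_lt h1]; exact ((lt_hitTime_iff hw).1 h1 t le_rfl).le
  rcases le_or_gt (t : ℝ≥0∞) (hitTime w + τ) with h2 | h2
  · rw [reflected_of_mem h1 h2]
  · lift hitTime w + τ to ℝ≥0 using h2.ne_top with s hs
    have hst : s ≤ t := by exact_mod_cast h2.le
    rw [reflected_of_ge hw hs.symm hst, sub_nonneg]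
    exact minFrom_le hw ⟨hst, le_rfl⟩

theorem reflected_zero (hw : Continuous w) (h0 : 0 ≤ w 0) : reflected τ w 0 = w 0 := by
  rcases lt_or_ge ((0 : ℝ≥0) : ℝ≥0∞) (hitTime w) with h1 | h1
  · exact reflected_of_lt h1
  · have : hitTime w = (0 : ℝ≥0) := le_antisymm h1 (by simp)
    rw [reflected_of_mem h1 (by simp), eq_zero_of_hitTime_eq hw h0 this]

/-- A reflected path oscillates at most twice as much as the path itself. -/
theorem abs_reflected_sub_le (hw : Continuous w) (h0 : 0 ≤ w 0) {a b : ℝ≥0} {δ : ℝ}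
    (hosc : ∀ u ∈ Set.Icc a b, ∀ v ∈ Set.Icc a b, |w u - w v| ≤ δ) :
    ∀ u ∈ Set.Icc a b, ∀ v ∈ Set.Icc a b, |reflected τ w u - reflected τ w v| ≤ 2 * δ := by
  have key : ∀ u ∈ Set.Icc a b, ∀ v ∈ Set.Icc a b, u ≤ v →
      |reflected τ w u - reflected τ w v| ≤ 2 * δ := by
    intro u hu v hv huv
    have huv' : (u : ℝ≥0∞) ≤ v := by exact_mod_cast huv
    have hδ : 0 ≤ δ := (abs_nonneg _).trans (hosc u hu v hv)
    have hru := reflected_nonneg hw τ u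
    have hrv := reflected_nonneg hw τ v
    -- after a restart inside the cell, the reflected path is at most `δ`
    have hlate : u ≤ v → hitTime w + τ < v → (u : ℝ≥0∞) ≤ hitTime w + τ →
        reflected τ w v ≤ δ := by
      intro _ h2 h3
      lift hitTime w + τ to ℝ≥0 using h2.ne_top with s hs
      have hsv : s ≤ v := by exact_mod_cast h2.le
      have hus : u ≤ s := by exact_mod_cast h3
      obtain ⟨x, hx, hmx⟩ := exists_minFrom_eq hw hsv
      rw [reflected_of_ge hw hs.symm hsv, hmx]
      exact (le_abs_self _).trans (hosc v hv x ⟨hu.1.trans (hus.trans hx.1), hx.2.trans hv.2⟩)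
    rcases lt_or_ge (u : ℝ≥0∞) (hitTime w) with h1 | h1
    · rcases lt_or_ge (v : ℝ≥0∞) (hitTime w) with h2 | h2
      · rw [reflected_of_lt h1, reflected_of_lt h2]; linarith [hosc u hu v hv]
      · have hrv' : reflected τ w v ≤ δ := by
          rcases le_or_gt (v : ℝ≥0∞) (hitTime w + τ) with h3 | h3
          · rw [reflected_of_mem h2 h3]; exact hδ
          · exact hlate huv h3 (h1.le.trans le_self_add)
        have hru' : reflected τ w u ≤ δ := by
          lift hitTime w to ℝ≥0 using (h2.trans_lt ENNReal.coe_lt_top).ne with s hs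
          have hz := eq_zero_of_hitTime_eq hw h0 hs.symm
          rw [reflected_of_lt (by rw [← hs]; exact h1)]
          have h4 : u ≤ s := by exact_mod_cast h1.le
          have h5 : s ≤ v := by exact_mod_cast h2
          have := hosc u hu s ⟨hu.1.trans h4, h5.trans hv.2⟩
          rw [hz, sub_zero] at this
          exact (le_abs_self _).trans this
        rw [abs_le]; constructor <;> linarith
    · have h2 := h1.trans huv'
      rcases le_or_gt (u : ℝ≥0∞) (hitTime w + τ) with h3 | h3
      · rw [reflected_of_mem h1 h3]
        rcases le_or_gt (v : ℝ≥0∞) (hitTime w + τ) with h4 | h4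
        · rw [reflected_of_mem h2 h4]; simpa using hδ
        · have := hlate huv h4 h3
          rw [abs_le]; constructor <;> linarith
      · lift hitTime w + τ to ℝ≥0 using h3.ne_top with s hs
        have hsu : s ≤ u := by exact_mod_cast h3.le
        rw [reflected_of_ge hw hs.symm hsu, reflected_of_ge hw hs.symm (hsu.trans huv)]
        have h6 := minFrom_anti hw hsu huv
        have h7 : minFrom s u w - δ ≤ minFrom s v w := by
          obtain ⟨x, hx, hmx⟩ := exists_minFrom_eq hw (hsu.trans huv)
          rw [hmx]
          rcases le_total x u with hxu | hxu
          · linarith [minFrom_le hw (⟨hx.1, hxu⟩ : x ∈ Set.Icc s u)]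
          · have := minFrom_le hw (⟨hsu, le_rfl⟩ : u ∈ Set.Icc s u)
            have := (abs_le.1 (hosc u hu x ⟨hu.1.trans hxu, hx.2.trans hv.2⟩)).2
            linarith
        have := abs_le.1 (hosc u hu v hv)
        rw [abs_le]; constructor <;> linarith
  intro u hu v hv
  rcases le_total u v with h | h
  · exact key u hu v hv h
  · rw [abs_sub_comm]; exact key v hv u hu h

theorem continuous_reflected (hw : Continuous w) (h0 : 0 ≤ w 0) (τ : ℝ≥0∞) :
    Continuous (reflected τ w) := by
  rw [continuous_iff_continuousAt]
  intro t
  rw [ContinuousAt, Metric.tendsto_nhds]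
  intro ε hε
  have hev := Metric.tendsto_nhds.1 (hw.tendsto t) (ε / 8) (by positivity)
  obtain ⟨η, hη, hball⟩ := Metric.eventually_nhds_iff.1 hev
  filter_upwards [Metric.ball_mem_nhds t hη] with x hx
  have hosc : ∀ u ∈ Set.Icc (min x t) (max x t), ∀ v ∈ Set.Icc (min x t) (max x t),
      |w u - w v| ≤ ε / 4 := by
    have hb : ∀ u ∈ Set.Icc (min x t) (max x t), |w u - w t| < ε / 8 := by
      intro u hu
      refine hball (lt_of_le_of_lt ?_ hx)
      rw [NNReal.dist_eq, NNReal.dist_eq]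
      have h1 : (min x t : ℝ) ≤ u := by exact_mod_cast hu.1
      have h2 : (u : ℝ) ≤ max x t := by exact_mod_cast hu.2
      grind
    intro u hu v hv
    have h1 := abs_lt.1 (hb u hu)
    have h2 := abs_lt.1 (hb v hv)
    rw [abs_le]; constructor <;> linarith
  have := abs_reflected_sub_le (τ := τ) hw h0 hosc x ⟨min_le_left _ _, le_max_left _ _⟩ t
    ⟨min_le_right _ _, le_max_right _ _⟩
  rw [Real.dist_eq]
  linarith

/-- Bookkeeping function for the error of the Stratonovich sums: the local time term plus one unit
for each of the two times at which the regime changes. -/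
noncomputable def errorClock (τ : ℝ≥0∞) (w : ℝ≥0 → ℝ) (t : ℝ≥0) : ℝ :=
  (if hitTime w + τ ≤ t then w (hitTime w + τ).toNNReal - minFrom (hitTime w + τ) t w else 0) +
    (if hitTime w ≤ t then 1 else 0) + (if hitTime w + τ < t then 1 else 0)

/-- The times at which the reflected path is driven by `w`. -/
def IsActive (τ : ℝ≥0∞) (w : ℝ≥0 → ℝ) (t : ℝ≥0) : Prop :=
  (t : ℝ≥0∞) < hitTime w ∨ hitTime w + τ ≤ t

open Classical in
/-- The indicator of `IsActive`. -/
noncomputable def active (τ : ℝ≥0∞) (w : ℝ≥0 → ℝ) (t : ℝ≥0) : ℝ :=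
  if IsActive τ w t then 1 else 0

/-- Local form of the Stratonovich equation: on a cell `[a, b]` with intermediate point `m`, the
increment of the square of the reflected path is the Stratonovich summand, up to a difference of
squared increments of `w` and an error controlled by `errorClock`. -/
theorem abs_stratonovich_cell_le (hw : Continuous w) (h0 : 0 ≤ w 0) {a m b : ℝ≥0} (ham : a ≤ m)
    (hmb : m ≤ b) {δ : ℝ} (hδ1 : δ ≤ 1)
    (hosc : ∀ u ∈ Set.Icc a b, ∀ v ∈ Set.Icc a b, |w u - w v| ≤ δ) :
    |reflected τ w b ^ 2 - reflected τ w a ^ 2 - 2 * reflected τ w m * (w b - w a) -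
      active τ w a * ((w b - w m) ^ 2 - (w m - w a) ^ 2)| ≤
      20 * δ * (errorClock τ w b - errorClock τ w a) := by
  have hab := ham.trans hmb
  have ha : a ∈ Set.Icc a b := ⟨le_rfl, hab⟩
  have hm : m ∈ Set.Icc a b := ⟨ham, hmb⟩
  have hb : b ∈ Set.Icc a b := ⟨hab, le_rfl⟩
  have hδ : 0 ≤ δ := (abs_nonneg _).trans (hosc a ha b hb)
  have hr := abs_reflected_sub_le (τ := τ) hw h0 hosc
  have ab' : (a : ℝ≥0∞) ≤ b := by exact_mod_cast hab
  have am' : (a : ℝ≥0∞) ≤ m := by exact_mod_cast ham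
  have mb' : (m : ℝ≥0∞) ≤ b := by exact_mod_cast hmb
  have hTσ : hitTime w ≤ hitTime w + τ := le_self_add
  have hLmono : (if hitTime w + τ ≤ a then
        w (hitTime w + τ).toNNReal - minFrom (hitTime w + τ) a w else 0) ≤
      (if hitTime w + τ ≤ b then
        w (hitTime w + τ).toNNReal - minFrom (hitTime w + τ) b w else 0) := by
    split_ifs with h1 h2 h2
    · lift hitTime w + τ to ℝ≥0 using (h1.trans_lt ENNReal.coe_lt_top).ne with s hs
      linarith [minFrom_anti hw (by exact_mod_cast h1 : s ≤ a) hab]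
    · exact absurd (h1.trans ab') h2
    · lift hitTime w + τ to ℝ≥0 using (h2.trans_lt ENNReal.coe_lt_top).ne with s hs
      have := minFrom_le hw (⟨le_rfl, by exact_mod_cast h2⟩ : s ∈ Set.Icc s b)
      simp only [ENNReal.toNNReal_coe]
      linarith
    · exact le_rfl
  -- a cell containing a zero of the reflected path, and a change of regime
  have crude : ∀ s ∈ Set.Icc a b, reflected τ w s = 0 →
      1 ≤ errorClock τ w b - errorClock τ w a →
      |reflected τ w b ^ 2 - reflected τ w a ^ 2 - 2 * reflected τ w m * (w b - w a) -
        active τ w a * ((w b - w m) ^ 2 - (w m - w a) ^ 2)| ≤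
        20 * δ * (errorClock τ w b - errorClock τ w a) := by
    intro s hs hs0 hV
    have hb1 : ∀ u ∈ Set.Icc a b, |reflected τ w u| ≤ 2 * δ := fun u hu => by
      simpa [hs0] using hr u hu s hs
    have e1 : reflected τ w b ^ 2 ≤ 4 * δ ^ 2 := by
      have := sq_le_sq' (abs_le.1 (hb1 b hb)).1 (abs_le.1 (hb1 b hb)).2; linarith
    have e2 : reflected τ w a ^ 2 ≤ 4 * δ ^ 2 := by
      have := sq_le_sq' (abs_le.1 (hb1 a ha)).1 (abs_le.1 (hb1 a ha)).2; linarith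
    have e3 : |2 * reflected τ w m * (w b - w a)| ≤ 4 * δ ^ 2 := by
      rw [abs_mul, abs_mul, abs_two]
      nlinarith [hb1 m hm, hosc b hb a ha, abs_nonneg (reflected τ w m), abs_nonneg (w b - w a)]
    have e4 : (w b - w m) ^ 2 ≤ δ ^ 2 :=
      sq_le_sq' (abs_le.1 (hosc b hb m hm)).1 (abs_le.1 (hosc b hb m hm)).2
    have e5 : (w m - w a) ^ 2 ≤ δ ^ 2 :=
      sq_le_sq' (abs_le.1 (hosc m hm a ha)).1 (abs_le.1 (hosc m hm a ha)).2
    have e6 : |active τ w a * ((w b - w m) ^ 2 - (w m - w a) ^ 2)| ≤ δ ^ 2 := by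
      have : |(w b - w m) ^ 2 - (w m - w a) ^ 2| ≤ δ ^ 2 := by
        rw [abs_le]; constructor <;> linarith [sq_nonneg (w b - w m), sq_nonneg (w m - w a)]
      unfold active
      split_ifs
      · simpa using this
      · simpa using sq_nonneg δ
    have e7 : 20 * δ ≤ 20 * δ * (errorClock τ w b - errorClock τ w a) := by nlinarith
    refine le_trans ?_ e7
    have h3 := abs_le.1 e3
    have h6 := abs_le.1 e6
    rw [abs_le]
    have hδ2 : δ ^ 2 ≤ δ := by nlinarith
    constructor <;> linarith [sq_nonneg (reflected τ w a), sq_nonneg (reflected τ w b)]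
  rcases lt_or_ge (a : ℝ≥0∞) (hitTime w) with h1 | h1
  · rcases lt_or_ge (b : ℝ≥0∞) (hitTime w) with h2 | h2
    · have hact : active τ w a = 1 := if_pos (Or.inl h1)
      have hV : errorClock τ w b - errorClock τ w a = 0 := by
        have n1 : ¬ hitTime w + τ ≤ b := not_le.2 (h2.trans_le hTσ)
        have n2 : ¬ hitTime w + τ ≤ a := not_le.2 (h1.trans_le hTσ)
        simp [errorClock, n1, n2, not_le.2 h1, not_le.2 h2, mt le_of_lt n1, mt le_of_lt n2]
      rw [reflected_of_lt h1, reflected_of_lt h2, reflected_of_lt (mb'.trans_lt h2), hact, hV,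
        mul_zero]
      refine le_of_eq ?_
      rw [abs_eq_zero]; ring
    · have hs : ∃ s : ℝ≥0, hitTime w = s :=
        ⟨_, (ENNReal.coe_toNNReal (h2.trans_lt ENNReal.coe_lt_top).ne).symm⟩
      obtain ⟨s, hs⟩ := hs
      refine crude s ⟨?_, ?_⟩ (reflected_of_mem hs.le (hs ▸ hTσ)) ?_
      · rw [hs] at h1; exact_mod_cast h1.le
      · rw [hs] at h2; exact_mod_cast h2
      · have n2 : ¬ hitTime w + τ ≤ a := not_le.2 (h1.trans_le hTσ)
        rw [if_neg n2] at hLmono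
        simp only [errorClock, if_neg n2, if_neg (not_le.2 h1), if_pos h2, if_neg (mt le_of_lt n2)]
        split_ifs <;> simp_all
        linarith
  · have hbT := h1.trans ab'
    rcases le_or_gt (hitTime w + τ) a with h2 | h2
    · have hact : active τ w a = 1 := if_pos (Or.inr h2)
      obtain ⟨s, hs⟩ : ∃ s : ℝ≥0, hitTime w + τ = s :=
        ⟨_, (ENNReal.coe_toNNReal (h2.trans_lt ENNReal.coe_lt_top).ne).symm⟩
      have hsa : s ≤ a := by rw [hs] at h2; exact_mod_cast h2
      have hV : minFrom s a w - minFrom s b w ≤ errorClock τ w b - errorClock τ w a := by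
        simp only [errorClock, if_pos h2, if_pos (h2.trans ab'), if_pos h1, if_pos hbT]
        rw [hs]
        have : (if (s : ℝ≥0∞) < a then (1 : ℝ) else 0) ≤ if (s : ℝ≥0∞) < b then (1 : ℝ) else 0 := by
          split_ifs with c1 c2
          · exact le_rfl
          · exact absurd (c1.trans_le ab') c2
          · norm_num
          · exact le_rfl
        linarith
      have q1 := minFrom_anti hw hsa ham
      have q2 := minFrom_anti hw (hsa.trans ham) hmb
      have hrm := reflected_nonneg hw τ m
      have hprod : reflected τ w m * (minFrom s a w - minFrom s b w) ≤
          2 * δ * (minFrom s a w - minFrom s b w) := by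
        rcases (q2.trans q1).eq_or_lt with heq | hlt
        · rw [heq]; simp
        · obtain ⟨x, hx, hmx⟩ := exists_minFrom_eq hw (hsa.trans hab)
          have hax : a ≤ x := by
            by_contra! hc
            have := minFrom_le hw (⟨hx.1, hc.le⟩ : x ∈ Set.Icc s a)
            linarith
          have hx0 : reflected τ w x = 0 := by
            rw [reflected_of_ge hw hs hx.1, sub_eq_zero]
            refine le_antisymm ?_ (minFrom_le hw ⟨hx.1, le_rfl⟩)
            rw [← hmx]; exact minFrom_anti hw hx.1 hx.2
          have := (le_abs_self _).trans (hr m hm x ⟨hax, hx.2⟩)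
          rw [hx0, sub_zero] at this
          exact mul_le_mul_of_nonneg_right this (by linarith)
      rw [hact]
      rw [reflected_of_ge hw hs hsa, reflected_of_ge hw hs (hsa.trans hab),
        reflected_of_ge hw hs (hsa.trans ham)] at *
      have c1 := abs_le.1 (hosc b hb m hm)
      have c2 := abs_le.1 (hosc m hm a ha)
      have c3 := hr b hb m hm
      have c4 := hr m hm a ha
      rw [reflected_of_ge hw hs (hsa.trans hab), reflected_of_ge hw hs (hsa.trans ham)] at c3
      rw [reflected_of_ge hw hs hsa, reflected_of_ge hw hs (hsa.trans ham)] at c4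
      have c3 := abs_le.1 c3
      have c4 := abs_le.1 c4
      set A := minFrom s a w
      set M := minFrom s m w
      set B := minFrom s b w
      have e : (w b - B) ^ 2 - (w a - A) ^ 2 - 2 * (w m - M) * (w b - w a) -
          1 * ((w b - w m) ^ 2 - (w m - w a) ^ 2) =
          2 * ((w m - M) * (A - B)) +
          (M - B) * ((w b - B - (w m - M)) + (w b - w m)) -
          (A - M) * ((w m - M - (w a - A)) + (w m - w a)) := by ring
      rw [e]
      have d1 : |(M - B) * ((w b - B - (w m - M)) + (w b - w m))| ≤ (M - B) * (3 * δ) := by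
        rw [abs_mul, abs_of_nonneg (by linarith : 0 ≤ M - B)]
        refine mul_le_mul_of_nonneg_left ?_ (by linarith)
        rw [abs_le]; constructor <;> linarith
      have d2 : |(A - M) * ((w m - M - (w a - A)) + (w m - w a))| ≤ (A - M) * (3 * δ) := by
        rw [abs_mul, abs_of_nonneg (by linarith : 0 ≤ A - M)]
        refine mul_le_mul_of_nonneg_left ?_ (by linarith)
        rw [abs_le]; constructor <;> linarith
      have d3 : 0 ≤ (w m - M) * (A - B) := mul_nonneg hrm (by linarith)
      have d1 := abs_le.1 d1
      have d2 := abs_le.1 d2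
      have d4 : 20 * δ * (A - B) ≤ 20 * δ * (errorClock τ w b - errorClock τ w a) :=
        mul_le_mul_of_nonneg_left hV (by linarith)
      have d5 : 0 ≤ δ * (A - B) := mul_nonneg hδ (by linarith)
      have d6 : (M - B) * (3 * δ) + (A - M) * (3 * δ) = 3 * (δ * (A - B)) := by ring
      have d7 : 2 * δ * (A - B) = 2 * (δ * (A - B)) := by ring
      have d8 : 20 * δ * (A - B) = 20 * (δ * (A - B)) := by ring
      rw [d7] at hprod
      rw [d8] at d4
      rw [abs_le]
      constructor <;> linarith
    · rcases le_or_gt (b : ℝ≥0∞) (hitTime w + τ) with h3 | h3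
      · have hact : active τ w a = 0 := if_neg (not_or.2 ⟨not_lt.2 h1, not_le.2 h2⟩)
        rw [reflected_of_mem h1 h2.le, reflected_of_mem hbT h3,
          reflected_of_mem (h1.trans am') (mb'.trans h3), hact]
        have hV : 0 ≤ errorClock τ w b - errorClock τ w a := by
          simp only [errorClock, if_pos h1, if_pos hbT, if_neg (not_lt.2 h3),
            if_neg (not_lt.2 h2.le)]
          linarith
        simp only [ne_eq, OfNat.ofNat_ne_zero, not_false_eq_true, zero_pow, mul_zero, zero_mul,
          sub_self, abs_zero]
        positivity
      · obtain ⟨s, hs⟩ : ∃ s : ℝ≥0, hitTime w + τ = s :=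
          ⟨_, (ENNReal.coe_toNNReal h3.ne_top).symm⟩
        refine crude s ⟨?_, ?_⟩ (reflected_of_mem (hs ▸ hTσ) hs.ge) ?_
        · rw [hs] at h2; exact_mod_cast h2.le
        · rw [hs] at h3; exact_mod_cast h3.le
        · rw [if_neg (not_le.2 h2)] at hLmono
          simp only [errorClock, if_neg (not_le.2 h2), if_pos h1, if_pos hbT, if_pos h3,
            if_neg (not_lt.2 h2.le)]
          linarith

end Reflected

end StratFeller

namespace StratFeller

/-! ### Reflected paths solve the Stratonovich equation -/

/-- The path `w` stopped at time `t`. -/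
def stopAt (t : ℝ≥0) (w : ℝ≥0 → ℝ) (s : ℝ≥0) : ℝ := w (min s t)

section Stop

variable {w : ℝ≥0 → ℝ} {s t : ℝ≥0} {τ : ℝ≥0∞}

theorem continuous_stopAt (hw : Continuous w) (t : ℝ≥0) : Continuous (stopAt t w) :=
  hw.comp (continuous_id.min continuous_const)

theorem stopAt_of_le (h : s ≤ t) : stopAt t w s = w s := by rw [stopAt, min_eq_left h]

theorem lt_hitTime_stopAt_iff (hw : Continuous w) (hst : s ≤ t) :
    (s : ℝ≥0∞) < hitTime (stopAt t w) ↔ (s : ℝ≥0∞) < hitTime w := by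
  rw [lt_hitTime_iff hw, lt_hitTime_iff (continuous_stopAt hw t)]
  refine forall₂_congr fun u hu => ?_
  rw [stopAt_of_le (hu.trans hst)]

theorem hitTime_stopAt (hw : Continuous w) (h : hitTime w ≤ t) :
    hitTime (stopAt t w) = hitTime w := by
  have h2 : hitTime (stopAt t w) ≤ t :=
    not_lt.1 fun hc => absurd ((lt_hitTime_stopAt_iff hw le_rfl).1 hc) (not_lt.2 h)
  refine le_antisymm ?_ ?_
  · refine ENNReal.le_of_forall_nnreal_lt fun r hr => ?_
    have hrt : r ≤ t := by exact_mod_cast (hr.trans_le h2).le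
    exact ((lt_hitTime_stopAt_iff hw hrt).1 hr).le
  · refine ENNReal.le_of_forall_nnreal_lt fun r hr => ?_
    have hrt : r ≤ t := by exact_mod_cast (hr.trans_le h).le
    exact ((lt_hitTime_stopAt_iff hw hrt).2 hr).le

theorem minFrom_stopAt (σ : ℝ≥0∞) (t : ℝ≥0) (w : ℝ≥0 → ℝ) :
    minFrom σ t (stopAt t w) = minFrom σ t w := by
  unfold minFrom
  congr 1; ext n
  split_ifs with h
  · exact stopAt_of_le h.2
  · exact stopAt_of_le le_rfl

theorem reflected_stopAt (hw : Continuous w) (τ : ℝ≥0∞) (t : ℝ≥0) :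
    reflected τ (stopAt t w) t = reflected τ w t := by
  rcases lt_or_ge (t : ℝ≥0∞) (hitTime w) with h | h
  · rw [reflected_of_lt h, reflected_of_lt ((lt_hitTime_stopAt_iff hw le_rfl).2 h),
      stopAt_of_le le_rfl]
  · rw [reflected, reflected, hitTime_stopAt hw h, minFrom_stopAt, stopAt_of_le le_rfl]

theorem active_stopAt (hw : Continuous w) (τ : ℝ≥0∞) (t : ℝ≥0) :
    active τ (stopAt t w) t = active τ w t := by
  have : IsActive τ (stopAt t w) t ↔ IsActive τ w t := by
    unfold IsActive
    rw [lt_hitTime_stopAt_iff hw le_rfl]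
    rcases lt_or_ge (t : ℝ≥0∞) (hitTime w) with h | h
    · simp [h]
    · rw [hitTime_stopAt hw h]
  by_cases h : IsActive τ w t
  · rw [active, active, if_pos h, if_pos (this.2 h)]
  · rw [active, active, if_neg h, if_neg (mt this.1 h)]

theorem measurable_active (τ : ℝ≥0∞) (t : ℝ≥0) : Measurable fun w => active τ w t := by
  refine Measurable.ite ?_ measurable_const measurable_const
  exact (measurableSet_lt measurable_const measurable_hitTime).union
    (measurableSet_le (measurable_hitTime.add_const _) measurable_const)

theorem abs_active_le (τ : ℝ≥0∞) (w : ℝ≥0 → ℝ) (t : ℝ≥0) : |active τ w t| ≤ 1 := by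
  unfold active; split_ifs <;> simp

end Stop

section Base

variable {Ω : Type*} {mΩ : MeasurableSpace Ω} {P : Measure Ω} {F : Filtration ℝ≥0 mΩ}
  {W : ℝ≥0 → Ω → ℝ}

/-- The path of the Brownian motion `W` started from `c`. -/
def startedAt (c : ℝ) (W : ℝ≥0 → Ω → ℝ) (ω : Ω) (t : ℝ≥0) : ℝ := c + W t ω

theorem IsBrownianWrt.measurable_startedAt (hW : IsBrownianWrt F P W) (c : ℝ) :
    Measurable (startedAt c W) :=
  measurable_pi_lambda _ fun t => (hW.measurable t).const_add c

theorem IsBrownianWrt.measurable_stopAt_startedAt (hW : IsBrownianWrt F P W) (c : ℝ) (t : ℝ≥0) :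
    Measurable[F t] fun ω => stopAt t (startedAt c W ω) :=
  @measurable_pi_lambda _ _ _ (F t) _ _ fun _ =>
    (hW.measurable_of_le (min_le_right _ _)).const_add c

theorem IsBrownianWrt.ae_continuous (hW : IsBrownianWrt F P W) (c : ℝ) :
    ∀ᵐ ω ∂P, Continuous (startedAt c W ω) ∧ startedAt c W ω 0 = c := by
  filter_upwards [hW.isBrownian.cont, hW.isBrownian.eval_zero_ae_eq_zero] with ω h1 h2
  exact ⟨continuous_const.add h1, by simp [startedAt, h2]⟩

/-- A functional of the path of `W` that at time `t` looks only at the path up to time `t` is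
adapted. -/
theorem IsBrownianWrt.adapted_of_stopAt (hW : IsBrownianWrt F P W) {c : ℝ} {t : ℝ≥0}
    {Φ : (ℝ≥0 → ℝ) → ℝ} (hΦ : Measurable Φ)
    (h : ∀ w, Continuous w → w 0 = c → Φ (stopAt t w) = Φ w) :
    AEStronglyMeasurable[F t] (fun ω => Φ (startedAt c W ω)) P := by
  refine ⟨fun ω => Φ (stopAt t (startedAt c W ω)),
    (hΦ.comp (hW.measurable_stopAt_startedAt c t)).stronglyMeasurable, ?_⟩
  filter_upwards [hW.ae_continuous c] with ω hω
  exact (h _ hω.1 hω.2).symm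

end Base

theorem sum_range_two_mul {M : Type*} [AddCommMonoid M] (f : ℕ → M) (n : ℕ) :
    ∑ j ∈ Finset.range (2 * n), f j = ∑ i ∈ Finset.range n, (f (2 * i) + f (2 * i + 1)) := by
  induction n with
  | zero => simp
  | succ n ih => rw [Nat.mul_succ, Finset.sum_range_succ, Finset.sum_range_succ, ih,
      Finset.sum_range_succ, add_assoc]

section Refine

variable {T : ℝ≥0}

theorem TimePartition.refine_even (p : TimePartition T) (i : ℕ) : p.refine (2 * i) = p.pt i := by
  simp [TimePartition.refine]

theorem TimePartition.refine_odd (p : TimePartition T) (i : ℕ) :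
    p.refine (2 * i + 1) = (p.pt i + p.pt (i + 1)) / 2 := by
  have h1 : (2 * i + 1) % 2 = 1 := by omega
  have h2 : (2 * i + 1) / 2 = i := by omega
  simp [TimePartition.refine, h1, h2]

theorem TimePartition.le_mid (p : TimePartition T) (i : ℕ) :
    p.pt i ≤ (p.pt i + p.pt (i + 1)) / 2 := by
  rw [← NNReal.coe_le_coe]
  have : (p.pt i : ℝ) ≤ p.pt (i + 1) := by exact_mod_cast p.mono i.le_succ
  push_cast; linarith

theorem TimePartition.mid_le (p : TimePartition T) (i : ℕ) :
    (p.pt i + p.pt (i + 1)) / 2 ≤ p.pt (i + 1) := by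
  rw [← NNReal.coe_le_coe]
  have : (p.pt i : ℝ) ≤ p.pt (i + 1) := by exact_mod_cast p.mono i.le_succ
  push_cast; linarith

theorem TimePartition.monotone_refine (p : TimePartition T) : Monotone p.refine := by
  refine monotone_nat_of_le_succ fun j => ?_
  rcases Nat.even_or_odd' j with ⟨i, rfl | rfl⟩
  · rw [p.refine_even, p.refine_odd]; exact p.le_mid i
  · rw [p.refine_odd, show 2 * i + 1 + 1 = 2 * (i + 1) by ring, p.refine_even]; exact p.mid_le i

theorem TimePartition.pt_half_le_refine (p : TimePartition T) (j : ℕ) :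
    p.pt (j / 2) ≤ p.refine j := by
  rcases Nat.even_or_odd' j with ⟨i, rfl | rfl⟩
  · rw [p.refine_even]; simp
  · rw [p.refine_odd, show (2 * i + 1) / 2 = i by omega]; exact p.le_mid i

end Refine

section Stratonovich

variable {Ω : Type*} {mΩ : MeasurableSpace Ω} {P : Measure Ω} {F : Filtration ℝ≥0 mΩ}
  {W : ℝ≥0 → Ω → ℝ}

/-- Half the square of the Brownian path from `√(2 x₀)` that is stopped for a time `τ` when it
reaches zero, and then reflected at zero. -/
noncomputable def stratSolution (x₀ : ℝ) (W : ℝ≥0 → Ω → ℝ) (τ : ℝ≥0∞) (t : ℝ≥0) (ω : Ω) : ℝ :=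
  reflected τ (startedAt (√(2 * x₀)) W ω) t ^ 2 / 2

/-- The differences of squared increments of `W` over the two halves of the cells of a partition
cancel in the limit. -/
theorem IsBrownianWrt.sum_halves [IsProbabilityMeasure P] (hW : IsBrownianWrt F P W) {T : ℝ≥0}
    (p : TimePartition T) {φ : ℕ → Ω → ℝ}
    (hφ : ∀ i, AEStronglyMeasurable[F (p.pt i)] (φ i) P) (hC : ∀ i ω, |φ i ω| ≤ 1) :
    MemLp (fun ω => ∑ i ∈ Finset.range p.n, φ i ω *
      ((W (p.pt (i + 1)) ω - W ((p.pt i + p.pt (i + 1)) / 2) ω) ^ 2 -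
        (W ((p.pt i + p.pt (i + 1)) / 2) ω - W (p.pt i) ω) ^ 2)) 2 P ∧
    ∫ ω, (∑ i ∈ Finset.range p.n, φ i ω *
      ((W (p.pt (i + 1)) ω - W ((p.pt i + p.pt (i + 1)) / 2) ω) ^ 2 -
        (W ((p.pt i + p.pt (i + 1)) / 2) ω - W (p.pt i) ω) ^ 2)) ^ 2 ∂P ≤
      (∫ x, (x ^ 2 - 1) ^ 2 ∂(gaussianReal 0 1)) * T * p.diam := by
  have h := hW.sum_increment_sq p.monotone_refine (C := 1)
    (φ := fun j ω => (if j % 2 = 0 then -1 else 1) * φ (j / 2) ω)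
    (fun j => ((hφ (j / 2)).mono (F.mono (p.pt_half_le_refine j))).const_mul _)
    (fun j ω => by
      rw [abs_mul]
      have : |(if j % 2 = 0 then (-1 : ℝ) else 1)| = 1 := by split_ifs <;> simp
      rw [this, one_mul]; exact hC _ ω) (2 * p.n)
  have e : ∀ ω, ∑ j ∈ Finset.range (2 * p.n), (if j % 2 = 0 then (-1 : ℝ) else 1) * φ (j / 2) ω *
      ((W (p.refine (j + 1)) ω - W (p.refine j) ω) ^ 2 - (p.refine (j + 1) - p.refine j)) =
      ∑ i ∈ Finset.range p.n, φ i ω *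
      ((W (p.pt (i + 1)) ω - W ((p.pt i + p.pt (i + 1)) / 2) ω) ^ 2 -
        (W ((p.pt i + p.pt (i + 1)) / 2) ω - W (p.pt i) ω) ^ 2) := by
    intro ω
    rw [sum_range_two_mul]
    refine Finset.sum_congr rfl fun i _ => ?_
    rw [show 2 * i + 1 + 1 = 2 * (i + 1) by ring, p.refine_even, p.refine_even, p.refine_odd,
      show (2 * i + 1) / 2 = i by omega, show (2 * i) / 2 = i by omega]
    have h1 : (2 * i + 1) % 2 = 1 := by omega
    have h2 : (2 * i) % 2 = 0 := by omega
    simp only [h1, h2, if_true, one_ne_zero, if_false]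
    push_cast
    ring
  simp_rw [e] at h
  refine ⟨h.1, h.2.trans ?_⟩
  rw [one_pow, one_mul, mul_assoc]
  refine mul_le_mul_of_nonneg_left ?_ (integral_nonneg fun x => sq_nonneg _)
  refine le_trans ?_ p.sum_step_sq_le
  rw [sum_range_two_mul]
  refine Finset.sum_le_sum fun i _ => ?_
  rw [show 2 * i + 1 + 1 = 2 * (i + 1) by ring, p.refine_even, p.refine_even, p.refine_odd]
  push_cast
  nlinarith [sq_nonneg ((p.pt (i + 1) : ℝ) - p.pt i)]

theorem isStratonovichSolution_stratSolution [IsProbabilityMeasure P] (hW : IsBrownianWrt F P W)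
    {x₀ : ℝ} (hx₀ : 0 ≤ x₀) (τ : ℝ≥0∞) :
    IsStratonovichSolution F P W x₀ (stratSolution x₀ W τ) := by
  set c := √(2 * x₀) with hc
  have hc0 : 0 ≤ c := Real.sqrt_nonneg _
  have hmeas : ∀ t, Measurable fun w => reflected τ w t := fun t =>
    (measurable_pi_apply t).comp (measurable_reflected τ)
  have hXm : ∀ t, Measurable fun ω => reflected τ (startedAt c W ω) t := fun t =>
    (hmeas t).comp (hW.measurable_startedAt c)
  refine { adapted := ?_, continuous := ?_, nonneg := ?_, init := ?_, eqn := ?_ }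
  · intro t
    refine hW.adapted_of_stopAt (Φ := fun w => reflected τ w t ^ 2 / 2)
      (((hmeas t).pow_const 2).div_const 2) fun w hw _ => ?_
    rw [reflected_stopAt hw]
  · filter_upwards [hW.ae_continuous c] with ω hω
    exact ((continuous_reflected hω.1 (hω.2.symm ▸ hc0) τ).pow 2).div_const 2
  · exact Eventually.of_forall fun ω t => by unfold stratSolution; positivity
  · filter_upwards [hW.ae_continuous c] with ω hω
    rw [stratSolution, reflected_zero hω.1 (hω.2.symm ▸ hc0), hω.2, Real.sq_sqrt (by positivity)]
    ring
  · intro u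
    have hM := fun p : TimePartition u => hW.sum_halves p
      (φ := fun i ω => active τ (startedAt c W ω) (p.pt i))
      (fun i => hW.adapted_of_stopAt (measurable_active τ _) fun w hw _ => active_stopAt hw τ _)
      (fun i ω => abs_active_le _ _ _)
    refine tendstoInMeasure_diamToZero
      (M := fun p ω => -(1 / 2) * ∑ i ∈ Finset.range p.n, active τ (startedAt c W ω) (p.pt i) *
        ((W (p.pt (i + 1)) ω - W ((p.pt i + p.pt (i + 1)) / 2) ω) ^ 2 -
        (W ((p.pt i + p.pt (i + 1)) / 2) ω - W (p.pt i) ω) ^ 2))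
      (K := 1 / 4 * ((∫ x, (x ^ 2 - 1) ^ 2 ∂(gaussianReal 0 1)) * u))
      (fun p => ?_) ?_ (fun p => (hM p).1.const_mul _) (fun p => ?_) ?_
    · refine Measurable.aestronglyMeasurable (Finset.measurable_sum _ fun i _ => ?_)
      exact ((((hXm _).pow_const 2).div_const 2).const_mul 2).sqrt.mul
        ((hW.measurable _).sub (hW.measurable _))
    · exact ((((hXm _).pow_const 2).div_const 2).sub_const _).aestronglyMeasurable
    · simp only [mul_pow, integral_const_mul]
      have := (hM p).2
      calc _ ≤ (-(1 / 2)) ^ 2 * _ := mul_le_mul_of_nonneg_left this (by positivity)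
        _ = _ := by ring
    · filter_upwards [hW.ae_continuous c] with ω hω
      obtain ⟨hwc, hw0⟩ := hω
      set w := startedAt c W ω with hw
      have h0 : 0 ≤ w 0 := hw0.symm ▸ hc0
      set V := errorClock τ w u - errorClock τ w 0 with hV
      rw [Metric.tendsto_nhds]
      intro ε hε
      obtain ⟨δ, hδ0, hδ1, hδ⟩ : ∃ δ : ℝ, 0 < δ ∧ δ ≤ 1 ∧ 10 * δ * V < ε := by
        refine ⟨min 1 (ε / (10 * (|V| + 1)) / 2), by positivity, min_le_left _ _, ?_⟩
        have h1 := min_le_right 1 (ε / (10 * (|V| + 1)) / 2)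
        set δ := min 1 (ε / (10 * (|V| + 1)) / 2)
        have h2 : δ * (2 * (10 * (|V| + 1))) ≤ ε := by
          calc _ ≤ ε / (10 * (|V| + 1)) / 2 * (2 * (10 * (|V| + 1))) := by gcongr
            _ = ε := by field_simp
        have h3 : 0 < δ := by positivity
        nlinarith [le_abs_self V, abs_nonneg V]
      filter_upwards [eventually_osc_le hwc u hδ0] with p hp
      have hcell : ∀ i ∈ Finset.range p.n, _ := fun i hi =>
        abs_stratonovich_cell_le (τ := τ) hwc h0 (p.le_mid i) (p.mid_le i) hδ1
          (hp i (Finset.mem_range.1 hi))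
      have hsum := (Finset.abs_sum_le_sum_abs _ _).trans (Finset.sum_le_sum hcell)
      rw [← Finset.mul_sum, Finset.sum_range_sub (fun i => errorClock τ w (p.pt i)), p.pt_last,
        p.pt_zero, ← hV] at hsum
      have htel : ∑ i ∈ Finset.range p.n,
          (reflected τ w (p.pt (i + 1)) ^ 2 - reflected τ w (p.pt i) ^ 2) =
          reflected τ w u ^ 2 - 2 * x₀ := by
        rw [Finset.sum_range_sub (fun i => reflected τ w (p.pt i) ^ 2), p.pt_last, p.pt_zero,
          reflected_zero hwc h0, hw0, hc, Real.sq_sqrt (by positivity)]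
      have hdiff : ∀ s s', w s - w s' = W s ω - W s' ω := fun s s' => by
        simp [hw, startedAt]
      have hsq : ∀ s, √(2 * (reflected τ w s ^ 2 / 2)) = reflected τ w s := fun s => by
        rw [mul_div_cancel₀ _ two_ne_zero, Real.sqrt_sq (reflected_nonneg hwc τ s)]
      simp only [Finset.sum_sub_distrib, hdiff] at hsum htel
      simp only [stratonovichSum, stratSolution, ← hw, ← hc, hsq, Real.dist_eq, sub_zero]
      rw [htel] at hsum
      have e : ∀ A B D : ℝ, |A - (B ^ 2 / 2 - x₀) - -(1 / 2) * D| =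
          |B ^ 2 - 2 * x₀ - 2 * A - D| / 2 := by
        intro A B D
        rw [← abs_neg, ← abs_of_pos (two_pos : (0 : ℝ) < 2), ← abs_div, abs_of_pos (two_pos : (0 : ℝ) < 2)]
        congr 1; ring
      rw [e, Finset.mul_sum]
      simp only [mul_assoc] at hsum ⊢
      linarith

end Stratonovich

end StratFeller

namespace StratFeller

/-! ### Brownian motion with predictably changed signs -/

section SignChange

variable {Ω : Type*} {mΩ : MeasurableSpace Ω} {P : Measure Ω} {F : Filtration ℝ≥0 mΩ}
  {W : ℝ≥0 → Ω → ℝ}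

/-- A process started from `0` whose increments have the conditional characteristic functions of
Brownian increments. Unlike independence, this property is easy to verify after a predictable
change of signs. -/
structure HasBrownianIncrements (F : Filtration ℝ≥0 mΩ) (P : Measure Ω) (W : ℝ≥0 → Ω → ℝ) :
    Prop where
  adapted : ∀ t, AEStronglyMeasurable[F t] (W t) P
  init : ∀ᵐ ω ∂P, W 0 ω = 0
  integral_exp : ∀ (s t : ℝ≥0), s ≤ t → ∀ (θ : ℝ) (Z : Ω → ℂ), AEStronglyMeasurable[F s] Z P →
    (∀ ω, ‖Z ω‖ ≤ 1) → ∫ ω, Z ω * Complex.exp ((θ * (W t ω - W s ω) : ℝ) * Complex.I) ∂P =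
      Complex.exp (-(θ ^ 2 * (t - s) / 2 : ℝ)) * ∫ ω, Z ω ∂P

theorem IsBrownianWrt.hasBrownianIncrements [IsProbabilityMeasure P] (hW : IsBrownianWrt F P W) :
    HasBrownianIncrements F P W where
  adapted t := (hW.adapted t).stronglyMeasurable.aestronglyMeasurable
  init := hW.isBrownian.eval_zero_ae_eq_zero
  integral_exp s t hst θ Z hZ _ := by
    have hm : Measurable fun x : ℝ => Complex.exp ((θ * x : ℝ) * Complex.I) := by fun_prop
    have hind := (indepFun_of_aestronglyMeasurable hZ (hW.indep hst)).comp
      (φ := id) measurable_id hm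
    have hl := hW.hasLaw_increment hst
    have := hind.integral_fun_mul_eq_mul_integral (hZ.mono (F.le s))
      (hm.comp_aemeasurable hl.aemeasurable).aestronglyMeasurable
    simp only [Function.comp_def, id] at this
    rw [this, mul_comm]
    congr 1
    have h1 := hl.integral_comp (f := fun x : ℝ => Complex.exp ((θ * x : ℝ) * Complex.I))
      hm.aestronglyMeasurable
    simp only [Function.comp_def] at h1
    have h2 := charFun_gaussianReal (μ := 0) (v := t - s) θ
    rw [charFun_apply_real] at h2
    rw [h1]
    push_cast
    rw [h2, NNReal.coe_sub hst]
    congr 1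
    push_cast
    ring

theorem norm_exp_ofReal_mul_I_le (x : ℝ) : ‖Complex.exp ((x : ℝ) * Complex.I)‖ ≤ 1 :=
  (Complex.norm_exp_ofReal_mul_I x).le

/-- The path `u` up to time `s`, continued by `e` times the increments of `w`. -/
noncomputable def splice (s : ℝ≥0) (e : ℝ) (u w : ℝ≥0 → ℝ) (t : ℝ≥0) : ℝ :=
  if t ≤ s then u t else u s + e * (w t - w s)

theorem HasBrownianIncrements.splice {U : ℝ≥0 → Ω → ℝ} [IsProbabilityMeasure P]
    (hU : HasBrownianIncrements F P U)
    (hW : HasBrownianIncrements F P W) {r : ℝ≥0} {ε : Ω → ℝ}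
    (hε : AEStronglyMeasurable[F r] ε P) (hval : ∀ ω, ε ω = 1 ∨ ε ω = -1) :
    HasBrownianIncrements F P fun t ω => splice r (ε ω) (fun s => U s ω) (fun s => W s ω) t := by
  -- the case of an increment after the time of the splice
  have late : ∀ (s t : ℝ≥0), r ≤ s → s ≤ t → ∀ (θ : ℝ) (Z : Ω → ℂ),
      AEStronglyMeasurable[F s] Z P → (∀ ω, ‖Z ω‖ ≤ 1) →
      ∫ ω, Z ω * Complex.exp ((θ * (ε ω * (W t ω - W s ω)) : ℝ) * Complex.I) ∂P =
        Complex.exp (-(θ ^ 2 * (t - s) / 2 : ℝ)) * ∫ ω, Z ω ∂P := by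
    intro s t hrs hst θ Z hZ hZ1
    have hε' : AEStronglyMeasurable[F s] ε P := hε.mono (F.mono hrs)
    have hmeas : ∀ a : ℝ, AEStronglyMeasurable[F s] (fun ω => Z ω * (((1 + a * ε ω) / 2 : ℝ) : ℂ)) P :=
      fun a => hZ.mul (Complex.continuous_ofReal.comp_aestronglyMeasurable
        ((by fun_prop : Continuous fun x : ℝ => (1 + a * x) / 2).comp_aestronglyMeasurable hε'))
    have hb : ∀ a : ℝ, (a = 1 ∨ a = -1) → ∀ ω, ‖Z ω * (((1 + a * ε ω) / 2 : ℝ) : ℂ)‖ ≤ 1 := by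
      intro a ha ω
      rw [norm_mul, Complex.norm_real]
      have : ‖(1 + a * ε ω) / 2‖ ≤ 1 := by
        rcases ha with rfl | rfl <;> rcases hval ω with h | h <;> rw [h] <;> norm_num
      exact mul_le_one₀ (hZ1 ω) (norm_nonneg _) this
    have hint : ∀ a : ℝ, (a = 1 ∨ a = -1) →
        Integrable (fun ω => Z ω * (((1 + a * ε ω) / 2 : ℝ) : ℂ)) P := fun a ha =>
      (integrable_const (1 : ℝ)).mono' ((hmeas a).mono (F.le s)) (Eventually.of_forall (hb a ha))
    have hD : AEStronglyMeasurable (fun ω => W t ω - W s ω) P :=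
      ((hW.adapted t).mono (F.le t)).sub ((hW.adapted s).mono (F.le s))
    have hintE : ∀ a θ' : ℝ, (a = 1 ∨ a = -1) →
        Integrable (fun ω => Z ω * (((1 + a * ε ω) / 2 : ℝ) : ℂ) *
          Complex.exp ((θ' * (W t ω - W s ω) : ℝ) * Complex.I)) P := by
      intro a θ' ha
      refine (integrable_const (1 : ℝ)).mono' ?_ (Eventually.of_forall fun ω => ?_)
      · refine ((hmeas a).mono (F.le s)).mul ?_
        have hc : Continuous fun x : ℝ => Complex.exp ((θ' * x : ℝ) * Complex.I) := by fun_prop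
        exact hc.comp_aestronglyMeasurable hD
      · rw [norm_mul]
        exact mul_le_one₀ (hb a ha ω) (norm_nonneg _) (norm_exp_ofReal_mul_I_le _)
    have e1 : ∀ ω, Z ω * Complex.exp ((θ * (ε ω * (W t ω - W s ω)) : ℝ) * Complex.I) =
        Z ω * (((1 + 1 * ε ω) / 2 : ℝ) : ℂ) *
          Complex.exp ((θ * (W t ω - W s ω) : ℝ) * Complex.I) +
        Z ω * (((1 + (-1) * ε ω) / 2 : ℝ) : ℂ) *
          Complex.exp (((-θ) * (W t ω - W s ω) : ℝ) * Complex.I) := by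
      intro ω
      rcases hval ω with h | h <;> rw [h] <;> norm_num
      left; congr 1; ring
    simp_rw [e1]
    rw [integral_add (hintE 1 θ (Or.inl rfl)) (hintE (-1) (-θ) (Or.inr rfl)),
      hW.integral_exp s t hst θ _ (hmeas 1) (hb 1 (Or.inl rfl)),
      hW.integral_exp s t hst (-θ) _ (hmeas (-1)) (hb (-1) (Or.inr rfl)), neg_sq, ← mul_add,
      ← integral_add (hint 1 (Or.inl rfl)) (hint (-1) (Or.inr rfl))]
    congr 1
    refine integral_congr_ae (Eventually.of_forall fun ω => ?_)
    push_cast; ring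
  refine ⟨fun t => ?_, ?_, fun s t hst θ Z hZ hZ1 => ?_⟩
  · rcases le_or_gt t r with h | h
    · simp only [StratFeller.splice, if_pos h]; exact hU.adapted t
    · simp only [StratFeller.splice, if_neg (not_le.2 h)]
      exact ((hU.adapted r).mono (F.mono h.le)).add ((hε.mono (F.mono h.le)).mul
        ((hW.adapted t).sub ((hW.adapted r).mono (F.mono h.le))))
  · filter_upwards [hU.init] with ω hω
    simp [StratFeller.splice, hω]
  · have hformula : ∀ t, r ≤ t → ∀ ω,
        StratFeller.splice r (ε ω) (fun s => U s ω) (fun s => W s ω) t =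
        U r ω + ε ω * (W t ω - W r ω) := by
      intro t hrt ω
      rcases hrt.eq_or_lt with rfl | h
      · simp [StratFeller.splice]
      · simp [StratFeller.splice, not_le.2 h]
    rcases le_or_gt t r with h | h
    · simp only [StratFeller.splice, if_pos h, if_pos (hst.trans h)]
      exact hU.integral_exp s t hst θ Z hZ hZ1
    rcases le_or_gt r s with h' | h'
    · rw [← late s t h' hst θ Z hZ hZ1]
      refine integral_congr_ae (Eventually.of_forall fun ω => ?_)
      simp only
      rw [hformula t h.le, hformula s h']
      congr 3
      push_cast; ring
    · -- an increment across the time of the splice is treated in two steps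
      set Z' : Ω → ℂ := fun ω => Z ω * Complex.exp ((θ * (U r ω - U s ω) : ℝ) * Complex.I) with hZ'
      have hc : Continuous fun x : ℝ => Complex.exp ((θ * x : ℝ) * Complex.I) := by fun_prop
      have hZ'm : AEStronglyMeasurable[F r] Z' P :=
        (hZ.mono (F.mono h'.le)).mul (hc.comp_aestronglyMeasurable
          ((hU.adapted r).sub ((hU.adapted s).mono (F.mono h'.le))))
      have hZ'1 : ∀ ω, ‖Z' ω‖ ≤ 1 := fun ω => by
        rw [hZ', norm_mul]
        exact mul_le_one₀ (hZ1 ω) (norm_nonneg _) (norm_exp_ofReal_mul_I_le _)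
      have h1 := late r t le_rfl h.le θ Z' hZ'm hZ'1
      rw [hU.integral_exp s r h'.le θ Z hZ hZ1, ← mul_assoc, ← Complex.exp_add] at h1
      calc _ = ∫ ω, Z' ω * Complex.exp ((θ * (ε ω * (W t ω - W r ω)) : ℝ) * Complex.I) ∂P := by
            refine integral_congr_ae (Eventually.of_forall fun ω => ?_)
            simp only [hZ']
            rw [hformula t h.le, StratFeller.splice, if_pos h'.le, mul_assoc, ← Complex.exp_add]
            congr 2
            push_cast; ring
        _ = _ := by
            rw [h1]; congr 2; push_cast; ring

theorem aestronglyMeasurable_finset_sum {ι : Type*} {m : MeasurableSpace Ω} (J : Finset ι)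
    {f : ι → Ω → ℝ} (hf : ∀ i ∈ J, AEStronglyMeasurable[m] (f i) P) :
    AEStronglyMeasurable[m] (fun ω => ∑ i ∈ J, f i ω) P := by
  classical
  induction J using Finset.induction_on with
  | empty => simpa using aestronglyMeasurable_const
  | insert a J ha ih =>
    simp only [Finset.sum_insert ha]
    exact (hf a (Finset.mem_insert_self a J)).add
      (ih fun i hi => hf i (Finset.mem_insert_of_mem hi))

/-- The finite-dimensional characteristic functions depend only on the conditional characteristic
functions of the increments. -/
theorem HasBrownianIncrements.integral_exp_sum_eq {F' : Filtration ℝ≥0 mΩ} {W' : ℝ≥0 → Ω → ℝ}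
    [IsProbabilityMeasure P] (hW : HasBrownianIncrements F P W)
    (hW' : HasBrownianIncrements F' P W') (I : Finset ℝ≥0) : ∀ θ : ℝ≥0 → ℝ,
    ∫ ω, Complex.exp ((∑ t ∈ I, θ t * W t ω : ℝ) * Complex.I) ∂P =
      ∫ ω, Complex.exp ((∑ t ∈ I, θ t * W' t ω : ℝ) * Complex.I) ∂P := by
  induction I using Finset.induction_on_max with
  | empty => simp
  | insert m J hJ ih =>
    intro θ
    have hmJ : m ∉ J := fun h => lt_irrefl _ (hJ m h)
    rcases J.eq_empty_or_nonempty with rfl | hne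
    · have key : ∀ {G : Filtration ℝ≥0 mΩ} {V : ℝ≥0 → Ω → ℝ}, HasBrownianIncrements G P V →
          ∫ ω, Complex.exp ((∑ t ∈ insert m ∅, θ t * V t ω : ℝ) * Complex.I) ∂P =
          Complex.exp (-(θ m ^ 2 * (m - (0 : ℝ≥0)) / 2 : ℝ)) := by
        intro G V hV
        have h := hV.integral_exp 0 m zero_le (θ m) (fun _ => 1) aestronglyMeasurable_const (by simp)
        simp only [one_mul, integral_const, probReal_univ, one_smul, mul_one] at h
        rw [← h]
        refine integral_congr_ae ?_
        filter_upwards [hV.init] with ω hω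
        simp [hω]
      rw [key hW, key hW']
    · set s := J.max' hne with hs
      have hsJ : s ∈ J := J.max'_mem hne
      have hsm : s < m := hJ s hsJ
      set θ' : ℝ≥0 → ℝ := fun t => θ t + if t = s then θ m else 0 with hθ'
      have key : ∀ {G : Filtration ℝ≥0 mΩ} {V : ℝ≥0 → Ω → ℝ}, HasBrownianIncrements G P V →
          ∫ ω, Complex.exp ((∑ t ∈ insert m J, θ t * V t ω : ℝ) * Complex.I) ∂P =
          Complex.exp (-(θ m ^ 2 * (m - s) / 2 : ℝ)) *
            ∫ ω, Complex.exp ((∑ t ∈ J, θ' t * V t ω : ℝ) * Complex.I) ∂P := by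
        intro G V hV
        have hc : Continuous fun x : ℝ => Complex.exp ((x : ℝ) * Complex.I) := by fun_prop
        have hsum : AEStronglyMeasurable[G s] (fun ω => ∑ t ∈ J, θ' t * V t ω) P :=
          aestronglyMeasurable_finset_sum J fun t ht =>
            ((hV.adapted t).mono (G.mono (J.le_max' t ht))).const_mul _
        rw [← hV.integral_exp s m hsm.le (θ m) _ (hc.comp_aestronglyMeasurable hsum)
          fun ω => norm_exp_ofReal_mul_I_le _]
        refine integral_congr_ae (Eventually.of_forall fun ω => ?_)
        simp only
        rw [← Complex.exp_add, Finset.sum_insert hmJ]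
        have : ∑ t ∈ J, θ' t * V t ω = ∑ t ∈ J, θ t * V t ω + θ m * V s ω := by
          simp [hθ', add_mul, Finset.sum_add_distrib, ite_mul, hsJ]
        rw [this]
        congr 1
        push_cast; ring
      rw [key hW, key hW', ih θ']

theorem HasBrownianIncrements.map_restrict_eq {F' : Filtration ℝ≥0 mΩ} {W' : ℝ≥0 → Ω → ℝ}
    [IsProbabilityMeasure P] (hW : HasBrownianIncrements F P W)
    (hW' : HasBrownianIncrements F' P W') (I : Finset ℝ≥0) :
    P.map (fun ω => I.restrict fun t => W t ω) = P.map (fun ω => I.restrict fun t => W' t ω) := by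
  have hm : ∀ {G : Filtration ℝ≥0 mΩ} {V : ℝ≥0 → Ω → ℝ}, HasBrownianIncrements G P V →
      AEMeasurable (fun ω => I.restrict fun t => V t ω) P := fun {G V} hV =>
    aemeasurable_pi_lambda _ fun t => ((hV.adapted t).mono (G.le _)).aemeasurable
  have := Measure.isProbabilityMeasure_map (hm hW)
  have := Measure.isProbabilityMeasure_map (hm hW')
  refine Measure.ext_of_charFunDual ?_
  ext L
  have key : ∀ {G : Filtration ℝ≥0 mΩ} {V : ℝ≥0 → Ω → ℝ}, HasBrownianIncrements G P V →
      charFunDual (P.map fun ω => I.restrict fun t => V t ω) L =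
      ∫ ω, Complex.exp ((∑ t ∈ I, (if h : t ∈ I then L (Pi.single ⟨t, h⟩ 1) else 0) * V t ω : ℝ) *
        Complex.I) ∂P := by
    intro G V hV
    rw [charFunDual_apply, integral_map (hm hV) (by fun_prop)]
    refine integral_congr_ae (Eventually.of_forall fun ω => ?_)
    simp only
    congr 3
    have h1 : (I.restrict fun t => V t ω) = ∑ i : I, V i ω • (Pi.single i (1 : ℝ) : I → ℝ) := by
      ext j
      simp [Finset.sum_apply, Pi.single_apply]
    rw [h1, map_sum, ← Finset.sum_coe_sort I]
    refine Finset.sum_congr rfl fun i _ => ?_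
    rw [map_smul, smul_eq_mul, dif_pos i.2, mul_comm]
  rw [key hW, key hW']
  exact hW.integral_exp_sum_eq hW' I _

/-- The path `w` with its increments over `[j h, (j + 1) h)`, `j < k`, multiplied by `e j`; the
increments after that are multiplied by the last sign `e (k - 1)`. -/
noncomputable def signChange (h : ℝ≥0) (e : ℕ → ℝ) (w : ℝ≥0 → ℝ) : ℕ → ℝ≥0 → ℝ
  | 0 => w
  | k + 1 => splice (k * h) (e k) (signChange h e w k) w

/-- Sign rules on the grid `h ℕ` that only look at the past. -/
structure IsSignRule (h : ℝ≥0) (e : ℕ → (ℝ≥0 → ℝ) → ℝ) (c : ℝ) : Prop where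
  measurable : ∀ k, Measurable (e k)
  sign : ∀ k w, e k w = 1 ∨ e k w = -1
  stopAt : ∀ k w, Continuous w → w 0 = c → e k (stopAt (k * h) w) = e k w

theorem measurable_signChange {h : ℝ≥0} {e : ℕ → (ℝ≥0 → ℝ) → ℝ} (he : ∀ k, Measurable (e k))
    (k : ℕ) : Measurable fun w => signChange h (fun j => e j w) w k := by
  induction k with
  | zero => exact measurable_id
  | succ k ih =>
    refine measurable_pi_lambda _ fun t => ?_
    simp only [signChange, splice]
    split_ifs
    · exact (measurable_pi_apply t).comp ih
    · exact ((measurable_pi_apply (k * h)).comp ih).add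
        ((he k).mul ((measurable_pi_apply _).sub (measurable_pi_apply _)))

theorem signChange_const_add (h : ℝ≥0) (e : ℕ → ℝ) (c : ℝ) (w : ℝ≥0 → ℝ) (k : ℕ) (t : ℝ≥0) :
    signChange h e (fun s => c + w s) k t = c + signChange h e w k t := by
  induction k generalizing t with
  | zero => rfl
  | succ k ih =>
    simp only [signChange, splice, ih]
    split_ifs
    · rfl
    · ring

theorem IsBrownianWrt.hasBrownianIncrements_signChange [IsProbabilityMeasure P]
    (hW : IsBrownianWrt F P W) {h : ℝ≥0} {e : ℕ → (ℝ≥0 → ℝ) → ℝ} {c : ℝ} (he : IsSignRule h e c)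
    (k : ℕ) : HasBrownianIncrements F P fun t ω =>
      signChange h (fun j => e j (startedAt c W ω)) (fun s => W s ω) k t := by
  induction k with
  | zero => exact hW.hasBrownianIncrements
  | succ k ih =>
    exact ih.splice hW.hasBrownianIncrements
      (hW.adapted_of_stopAt (he.measurable k) (he.stopAt k)) fun ω => he.sign k _

/-- Predictable changes of signs do not change the law of Brownian motion. -/
theorem IsBrownianWrt.map_signChange [IsProbabilityMeasure P] (hW : IsBrownianWrt F P W)
    {h : ℝ≥0} {e : ℕ → (ℝ≥0 → ℝ) → ℝ} {c : ℝ} (he : IsSignRule h e c) (k : ℕ) :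
    P.map (fun ω => signChange h (fun j => e j (startedAt c W ω)) (startedAt c W ω) k) =
      P.map (startedAt c W) := by
  have hm1 := (measurable_signChange (h := h) he.measurable k).comp (hW.measurable_startedAt c)
  have h1 : (fun ω => signChange h (fun j => e j (startedAt c W ω)) (startedAt c W ω) k) =
      fun ω t => c + signChange h (fun j => e j (startedAt c W ω)) (fun s => W s ω) k t := by
    ext ω t
    exact signChange_const_add _ _ _ _ _ _
  have hV := hW.hasBrownianIncrements_signChange he k
  have hVm : Measurable fun ω t =>
      signChange h (fun j => e j (startedAt c W ω)) (fun s => W s ω) k t := by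
    have : (fun ω t => signChange h (fun j => e j (startedAt c W ω)) (fun s => W s ω) k t) =
        fun ω t => signChange h (fun j => e j (startedAt c W ω)) (startedAt c W ω) k t - c := by
      ext ω t
      rw [eq_sub_iff_add_eq', ← signChange_const_add]
      rfl
    rw [this]
    exact measurable_pi_lambda _ fun t => ((measurable_pi_apply t).comp hm1).sub_const c
  have hWm : Measurable fun ω t => W t ω := measurable_pi_lambda _ hW.measurable
  have h2 := (map_eq_iff_forall_finset_map_restrict_eq hVm.aemeasurable hWm.aemeasurable).2
    fun I => hV.map_restrict_eq hW.hasBrownianIncrements I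
  have hadd : Measurable fun (w : ℝ≥0 → ℝ) t => c + w t :=
    measurable_pi_lambda _ fun t => measurable_const.add (measurable_pi_apply t)
  rw [h1]
  have h3 := congrArg (Measure.map fun (w : ℝ≥0 → ℝ) t => c + w t) h2
  rw [Measure.map_map hadd hVm, Measure.map_map hadd hWm] at h3
  exact h3

/-- If a path functional of suitable changes of signs of `W` converges, then the limit has the law
of the same functional of `W`. -/
theorem IsBrownianWrt.map_eq_of_tendsto [IsProbabilityMeasure P] (hW : IsBrownianWrt F P W)
    {c : ℝ} {h : ℕ → ℝ≥0} {e : ℕ → ℕ → (ℝ≥0 → ℝ) → ℝ} (he : ∀ N, IsSignRule (h N) (e N) c)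
    (K : ℕ → ℕ) {Φ : (ℝ≥0 → ℝ) → ℝ≥0 → ℝ} (hΦ : Measurable Φ) {Y : Ω → ℝ≥0 → ℝ}
    (hY : AEMeasurable Y P)
    (hlim : ∀ᵐ ω ∂P, ∀ t, Tendsto (fun N => Φ (signChange (h N)
      (fun j => e N j (startedAt c W ω)) (startedAt c W ω) (K N)) t) atTop (𝓝 (Y ω t))) :
    P.map (fun ω => Φ (startedAt c W ω)) = P.map Y := by
  have hS := hW.measurable_startedAt c
  have hG : ∀ N, Measurable fun ω => signChange (h N)
      (fun j => e N j (startedAt c W ω)) (startedAt c W ω) (K N) := fun N =>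
    (measurable_signChange (he N).measurable (K N)).comp hS
  refine (map_eq_iff_forall_finset_map_restrict_eq (X := fun t ω => Φ (startedAt c W ω) t)
    (Y := fun t ω => Y ω t) (hΦ.comp hS).aemeasurable hY).2 fun I => ?_
  have hYI : AEMeasurable (fun ω => I.restrict fun t => Y ω t) P :=
    (Finset.measurable_restrict I).comp_aemeasurable hY
  have hWI : Measurable fun ω => I.restrict (Φ (startedAt c W ω)) :=
    (Finset.measurable_restrict I).comp (hΦ.comp hS)
  have := Measure.isProbabilityMeasure_map hYI
  have := Measure.isProbabilityMeasure_map hWI.aemeasurable (μ := P)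
  refine ext_of_forall_integral_eq_of_IsFiniteMeasure fun f => ?_
  rw [integral_map hWI.aemeasurable (by fun_prop), integral_map hYI (by fun_prop)]
  have hconst : ∀ N, ∫ ω, f (I.restrict (Φ (signChange (h N)
      (fun j => e N j (startedAt c W ω)) (startedAt c W ω) (K N)))) ∂P =
      ∫ ω, f (I.restrict (Φ (startedAt c W ω))) ∂P := by
    intro N
    have hf : Measurable fun w : ℝ≥0 → ℝ => f (I.restrict (Φ w)) :=
      f.continuous.measurable.comp ((Finset.measurable_restrict I).comp hΦ)
    rw [← integral_map (hG N).aemeasurable hf.aestronglyMeasurable, hW.map_signChange (he N) (K N),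
      integral_map hS.aemeasurable hf.aestronglyMeasurable]
  have hT : Tendsto (fun N => ∫ ω, f (I.restrict (Φ (signChange (h N)
      (fun j => e N j (startedAt c W ω)) (startedAt c W ω) (K N)))) ∂P) atTop
      (𝓝 (∫ ω, f (I.restrict fun t => Y ω t) ∂P)) := by
    refine tendsto_integral_of_dominated_convergence (fun _ => ‖f‖) (fun N => ?_)
      (integrable_const _) (fun N => Eventually.of_forall fun ω => f.norm_coe_le_norm _) ?_
    · exact (f.continuous.measurable.comp ((Finset.measurable_restrict I).comp
        (hΦ.comp (hG N)))).aestronglyMeasurable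
    · filter_upwards [hlim] with ω hω
      refine (f.continuous.tendsto _).comp (tendsto_pi_nhds.2 fun i => ?_)
      exact hω i
  simp_rw [hconst] at hT
  exact tendsto_nhds_unique tendsto_const_nhds hT

end SignChange

end StratFeller

namespace StratFeller

/-! ### A discrete Tanaka formula and Lévy's theorem -/

section SignChangePath

variable {h : ℝ≥0} {e : ℕ → ℝ} {w : ℝ≥0 → ℝ} {k j : ℕ} {s t : ℝ≥0}

theorem continuous_splice {u : ℝ≥0 → ℝ} (hu : Continuous u) (hw : Continuous w) (s : ℝ≥0) (c : ℝ) :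
    Continuous (splice s c u w) := by
  refine Continuous.if_le hu (by fun_prop) continuous_id continuous_const ?_
  rintro x rfl
  simp

theorem continuous_signChange (hw : Continuous w) (h : ℝ≥0) (e : ℕ → ℝ) (k : ℕ) :
    Continuous (signChange h e w k) := by
  induction k with
  | zero => exact hw
  | succ k ih => exact continuous_splice ih hw _ _

theorem signChange_of_le (hjk : j ≤ k) (ht : t ≤ j * h) :
    signChange h e w k t = signChange h e w j t := by
  induction k, hjk using Nat.le_induction with
  | base => rfl
  | succ k hk ih =>
    rw [signChange, splice, if_pos (ht.trans (by gcongr)), ih]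

theorem signChange_cell (hjk : j < k) (h1 : j * h ≤ t) (h2 : t ≤ (j + 1 : ℕ) * h) :
    signChange h e w k t = signChange h e w k (j * h) + e j * (w t - w (j * h)) := by
  rw [signChange_of_le hjk h2, signChange_of_le hjk.le (le_refl (j * h)), signChange, splice]
  split_ifs with h3
  · rw [le_antisymm h3 h1]; ring
  · rfl

theorem signChange_zero_time (k : ℕ) : signChange h e w k 0 = w 0 :=
  signChange_of_le (Nat.zero_le k) (by simp)

theorem signChange_eq_self_of_nat (he : ∀ i < j, e i = 1) (hjk : j ≤ k) (ht : t ≤ j * h) :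
    signChange h e w k t = w t := by
  induction j generalizing t with
  | zero =>
    have : t = 0 := by simpa using ht
    rw [this, signChange_zero_time]
  | succ j ih =>
    have ih' := fun {t} => @ih t (fun i hi => he i (hi.trans j.lt_succ_self)) (by omega)
    rcases le_total t (j * h) with h1 | h1
    · exact ih' h1
    · rw [signChange_cell (by omega) h1 ht, ih' le_rfl, he j j.lt_succ_self]; ring

theorem signChange_eq_self (hh : 0 < h) (he : ∀ i : ℕ, (i * h : ℝ≥0) < t → e i = 1)
    (htk : t ≤ k * h) (hst : s ≤ t) : signChange h e w k s = w s := by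
  refine signChange_eq_self_of_nat (j := ⌈t / h⌉₊) (fun i hi => he i ?_) ?_ ?_
  · rw [Nat.lt_ceil, lt_div_iff₀ hh] at hi; exact hi
  · rw [Nat.ceil_le, div_le_iff₀ hh]; exact htk
  · refine hst.trans ?_
    rw [← div_le_iff₀ hh]; exact Nat.le_ceil _

theorem signChange_eq_neg {k₀ : ℕ} (he : ∀ i ≥ k₀, e i = -1) (h0 : k₀ ≤ j) (hjk : j ≤ k)
    (h1 : k₀ * h ≤ t) (h2 : t ≤ j * h) :
    signChange h e w k t = signChange h e w k (k₀ * h) - (w t - w (k₀ * h)) := by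
  induction j, h0 using Nat.le_induction generalizing t with
  | base => rw [le_antisymm h2 h1]; ring
  | succ j hj ih =>
    rcases le_total t (j * h) with h3 | h3
    · exact ih (by omega) h1 h3
    · rw [signChange_cell (by omega) h3 h2, ih (by omega) (by gcongr) le_rfl, he j hj]; ring

/-- A discrete form of Tanaka's formula. Let `G` be `w` with its increments multiplied, after the
time `s`, by the sign of `w - w s` at the preceding grid point. On the grid, the difference between
`|w - w s|` and `G - w s` is nondecreasing, and it increases only over a step in which `w - w s`
changes its sign, so it almost agrees with minus the running minimum of `G - w s`. -/
theorem abs_signChange_sub_minFrom_sub_abs_le (hw : Continuous w) (hh : 0 < h) (hst : s ≤ t) {K : ℕ}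
    (hK : t + h ≤ K * h) (hone : ∀ i : ℕ, (i * h : ℝ≥0) < s → e i = 1)
    (hsgn : ∀ i : ℕ, s ≤ i * h → e i = if w s ≤ w (i * h) then 1 else -1) {δ : ℝ}
    (hosc : ∀ u v, u ≤ v → v ≤ u + h → v ≤ t + h → |w v - w u| ≤ δ) :
    |signChange h e w K t - minFrom s t (signChange h e w K) - (|w t - w s|)| ≤ 4 * δ := by
  set G := signChange h e w K with hG
  have hGc : Continuous G := continuous_signChange hw _ _ _
  have htK : t ≤ K * h := le_self_add.trans hK
  have hδ : 0 ≤ δ := (abs_nonneg _).trans (hosc t t le_rfl le_self_add le_self_add)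
  set k₀ := ⌈s / h⌉₊ with hk₀
  have hs1 : s ≤ k₀ * h := by rw [← div_le_iff₀ hh]; exact Nat.le_ceil _
  have hs2 : (k₀ * h : ℝ≥0) ≤ s + h := by
    have h3 := (Nat.ceil_lt_add_one (a := s / h) zero_le).le
    rw [← hk₀] at h3
    calc (k₀ * h : ℝ≥0) ≤ (s / h + 1) * h := by gcongr
      _ = s + h := by rw [add_mul, div_mul_cancel₀ _ hh.ne', one_mul]
  have hk₀K : k₀ ≤ K := by
    rw [hk₀, Nat.ceil_le, div_le_iff₀ hh]; exact hst.trans htK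
  have hpre : ∀ u ≤ (k₀ * h : ℝ≥0), G u = w u := fun u hu => by
    refine signChange_eq_self_of_nat (j := k₀) (fun i hi => hone i ?_) hk₀K hu
    rw [hk₀, Nat.lt_ceil, lt_div_iff₀ hh] at hi; exact hi
  have hGs : G s = w s := hpre s hs1
  rcases lt_or_ge t (k₀ * h) with htk | htk
  · obtain ⟨x, hx, hmx⟩ := exists_minFrom_eq hGc hst
    rw [hmx, hpre t htk.le, hpre x (hx.2.trans htk.le)]
    have hle : t ≤ s + h := htk.le.trans hs2
    have h1 := abs_le.1 (hosc x t hx.2 (hle.trans (by gcongr; exact hx.1)) le_self_add)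
    have h2 := hosc s t hst hle le_self_add
    have h3 := abs_nonneg (w t - w s)
    rw [abs_le]; constructor <;> linarith
  -- the behaviour on one cell of the grid
  have cell : ∀ j : ℕ, s ≤ j * h → (j * h : ℝ≥0) ≤ t → ∀ u, j * h ≤ u → u ≤ (j + 1 : ℕ) * h →
      ∃ y : ℝ, |y| ≤ δ ∧ G u = G (j * h) + y ∧ |w u - w s| = |(|w (j * h) - w s|) + y| := by
    intro j hsj hjt u hju huj
    have hjK : j < K := by
      have h1 : (j * h : ℝ≥0) < K * h := hjt.trans_lt ((lt_add_of_pos_right t hh).trans_le hK)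
      exact_mod_cast lt_of_mul_lt_mul_right h1 hh.le
    have huj' : u ≤ j * h + h := by push_cast at huj; linarith [add_mul (j : ℝ≥0) 1 h]
    have hd := hosc (j * h) u hju huj' (huj'.trans (by gcongr))
    refine ⟨e j * (w u - w (j * h)), ?_, signChange_cell hjK hju huj, ?_⟩
    · rw [hsgn j hsj, abs_mul]
      split_ifs <;> simpa using hd
    · rw [hsgn j hsj]
      split_ifs with hc
      · rw [abs_of_nonneg (sub_nonneg.2 hc)]; congr 1; ring
      · rw [abs_of_neg (sub_neg.2 (not_le.1 hc)), ← abs_neg]; congr 1; ring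
  have main : ∀ j : ℕ, k₀ ≤ j → (j * h : ℝ≥0) ≤ t →
      0 ≤ |w (j * h) - w s| - (G (j * h) - w s) ∧
      (∀ u ∈ Set.Icc s (j * h), -(G u - w s) ≤ |w (j * h) - w s| - (G (j * h) - w s) + δ) ∧
      |w (j * h) - w s| - (G (j * h) - w s) ≤ w s - minFrom s (j * h) G + 2 * δ := by
    intro j hj
    induction j, hj using Nat.le_induction with
    | base =>
      intro hjt
      rw [hpre _ le_rfl]
      have h1 := hosc s (k₀ * h) hs1 hs2 (hjt.trans le_self_add)
      have h0 : 0 ≤ |w (k₀ * h) - w s| - (w (k₀ * h) - w s) := sub_nonneg.2 (le_abs_self _)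
      refine ⟨h0, fun u hu => ?_, ?_⟩
      · rw [hpre u hu.2]
        have := abs_le.1 (hosc s u hu.1 (hu.2.trans hs2) (hu.2.trans (hjt.trans le_self_add)))
        linarith
      · have h2 := minFrom_le hGc (⟨le_rfl, hs1⟩ : s ∈ Set.Icc s (k₀ * h))
        rw [hGs] at h2
        have := (abs_le.1 h1).1
        linarith
    | succ j hj ih =>
      intro hjt
      have hcast : ((j : ℝ≥0) * h) ≤ (j + 1 : ℕ) * h := by gcongr; simp
      have hjt' : (j * h : ℝ≥0) ≤ t := hcast.trans hjt
      have hsj : s ≤ j * h := hs1.trans (by gcongr)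
      obtain ⟨i1, i2, i3⟩ := ih hjt'
      obtain ⟨y, hy, hGy, hwy⟩ := cell j hsj hjt' _ hcast le_rfl
      have hb := abs_nonneg (w (j * h) - w s)
      have hmono : |w (j * h) - w s| - (G (j * h) - w s) ≤
          |w ((j + 1 : ℕ) * h) - w s| - (G ((j + 1 : ℕ) * h) - w s) := by
        rw [hGy, hwy]
        linarith [le_abs_self (|w (j * h) - w s| + y)]
      refine ⟨i1.trans hmono, fun u hu => ?_, ?_⟩
      · rcases le_total u (j * h) with h1 | h1
        · linarith [i2 u ⟨hu.1, h1⟩]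
        · obtain ⟨z, hz, hGz, -⟩ := cell j hsj hjt' u h1 hu.2
          have := (abs_le.1 hz).1
          rw [hGz]; linarith
      · have hsj1 := hsj.trans hcast
        rcases le_or_gt 0 (|w (j * h) - w s| + y) with hc | hc
        · rw [hGy, hwy, abs_of_nonneg hc]
          linarith [minFrom_anti hGc hsj hcast]
        · have h1 := minFrom_le hGc (⟨hsj1, le_rfl⟩ : ((j + 1 : ℕ) * h : ℝ≥0) ∈ Set.Icc s _)
          have := (abs_le.1 hy).1
          rw [hwy, abs_of_neg hc]
          linarith
  set j := ⌊t / h⌋₊ with hj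
  have hj1 : (j * h : ℝ≥0) ≤ t := by
    rw [← le_div_iff₀ hh]; exact Nat.floor_le zero_le
  have hj2 : t ≤ (j + 1 : ℕ) * h := by
    rw [← div_le_iff₀ hh]; push_cast; exact (Nat.lt_floor_add_one _).le
  have hkj : k₀ ≤ j := by
    rw [hj, Nat.le_floor_iff zero_le, le_div_iff₀ hh]; exact htk
  have hsj : s ≤ j * h := hs1.trans (by gcongr)
  obtain ⟨m1, m2, m3⟩ := main j hkj hj1
  obtain ⟨y, hy, hGy, hwy⟩ := cell j hsj hj1 t hj1 hj2
  have hb := abs_nonneg (w (j * h) - w s)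
  have hlow : |w (j * h) - w s| + y ≤ |w t - w s| := by rw [hwy]; exact le_abs_self _
  have hup : |w t - w s| ≤ |w (j * h) - w s| + δ := by
    rw [hwy]
    refine (abs_add_le _ _).trans ?_
    rw [abs_abs]; linarith
  have hy' := abs_le.1 hy
  have hmin1 := minFrom_anti hGc hsj hj1
  have hmin2 : w s - minFrom s t G ≤ |w (j * h) - w s| - (G (j * h) - w s) + δ := by
    obtain ⟨x, hx, hmx⟩ := exists_minFrom_eq hGc hst
    rw [hmx]
    rcases le_total x (j * h) with h1 | h1
    · linarith [m2 x ⟨hx.1, h1⟩]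
    · obtain ⟨z, hz, hGz, -⟩ := cell j hsj hj1 x h1 (hx.2.trans hj2)
      have := (abs_le.1 hz).1
      rw [hGz]; linarith
  rw [abs_le]; constructor <;> linarith

end SignChangePath

section EvalAt

/-- The value of a path at the time `σ`, written as a limit along times from a countable set, so
that it is jointly measurable in `σ` and the path. -/
noncomputable def evalAt (σ : ℝ≥0) (w : ℝ≥0 → ℝ) : ℝ :=
  limsup (fun n : ℕ => w ((⌊(σ : ℝ) * (n + 1)⌋₊ : ℝ≥0) / (n + 1))) atTop

theorem tendsto_floor_mul_div (σ : ℝ≥0) :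
    Tendsto (fun n : ℕ => (⌊(σ : ℝ) * (n + 1)⌋₊ : ℝ≥0) / (n + 1)) atTop (𝓝 σ) := by
  rw [← NNReal.tendsto_coe]
  have h := (tendsto_nat_floor_mul_div_atTop (R := ℝ) (a := σ) σ.2).comp
    (tendsto_natCast_atTop_atTop (R := ℝ) |>.comp (tendsto_add_atTop_nat 1))
  refine h.congr fun n => ?_
  simp

theorem evalAt_eq {w : ℝ≥0 → ℝ} (hw : Continuous w) (σ : ℝ≥0) : evalAt σ w = w σ :=
  ((hw.tendsto σ).comp (tendsto_floor_mul_div σ)).limsup_eq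

theorem measurable_evalAt {σ : (ℝ≥0 → ℝ) → ℝ≥0} (hσ : Measurable σ) :
    Measurable fun w => evalAt (σ w) w := by
  refine Measurable.limsup fun n => ?_
  have h1 : Measurable fun p : ℕ × (ℝ≥0 → ℝ) => p.2 ((p.1 : ℝ≥0) / (n + 1)) :=
    measurable_from_prod_countable_right fun k => measurable_pi_apply ((k : ℝ≥0) / (n + 1))
  exact h1.comp ((Nat.measurable_floor.comp (hσ.coe_nnreal_real.mul_const _)).prodMk measurable_id)

/-- The path `w` up to its first zero `T`, then `0` until `σ = T + τ`, then `|w - w σ|`. -/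
noncomputable def unreflected (τ : ℝ≥0∞) (w : ℝ≥0 → ℝ) (t : ℝ≥0) : ℝ :=
  if (t : ℝ≥0∞) < hitTime w then w t
  else if (t : ℝ≥0∞) ≤ hitTime w + τ then 0
  else |w t - evalAt (hitTime w + τ).toNNReal w|

theorem measurable_restart (τ : ℝ≥0∞) : Measurable fun w => (hitTime w + τ).toNNReal :=
  (measurable_hitTime.add_const τ).ennreal_toNNReal

theorem measurable_unreflected (τ : ℝ≥0∞) : Measurable (unreflected τ) := by
  refine measurable_pi_lambda _ fun t => ?_
  have hT := measurable_hitTime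
  exact Measurable.ite (measurableSet_lt measurable_const hT) (measurable_pi_apply _)
    (Measurable.ite (measurableSet_le measurable_const (hT.add_const _)) measurable_const
      ((measurable_pi_apply _).sub (measurable_evalAt (measurable_restart τ))).abs)

/-- The sign of `w - w σ` after the time `σ` at which the path restarts from zero. -/
noncomputable def tanakaSign (τ : ℝ≥0∞) (h : ℝ≥0) (k : ℕ) (w : ℝ≥0 → ℝ) : ℝ :=
  if ((k * h : ℝ≥0) : ℝ≥0∞) < hitTime w + τ then 1
  else if evalAt (hitTime w + τ).toNNReal w ≤ w (k * h) then 1 else -1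

theorem isSignRule_tanakaSign (τ : ℝ≥0∞) (h : ℝ≥0) (c : ℝ) : IsSignRule h (tanakaSign τ h) c where
  measurable k := by
    refine Measurable.ite (measurableSet_lt measurable_const (measurable_hitTime.add_const _))
      measurable_const (Measurable.ite ?_ measurable_const measurable_const)
    exact measurableSet_le (measurable_evalAt (measurable_restart τ)) (measurable_pi_apply _)
  sign k w := by unfold tanakaSign; split_ifs <;> simp
  stopAt k w hw _ := by
    have hw' := continuous_stopAt hw (k * h)
    rcases lt_or_ge ((k * h : ℝ≥0) : ℝ≥0∞) (hitTime w) with h1 | h1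
    · have h2 := (lt_hitTime_stopAt_iff hw le_rfl).2 h1
      rw [tanakaSign, tanakaSign, if_pos (h1.trans_le le_self_add), if_pos (h2.trans_le le_self_add)]
    · rw [tanakaSign, tanakaSign, hitTime_stopAt hw h1]
      split_ifs with h2 h3 h4 h4
      · rfl
      · rfl
      · rw [evalAt_eq hw'] at h3
        rw [evalAt_eq hw] at h4
        rw [StratFeller.stopAt_of_le le_rfl, StratFeller.stopAt_of_le] at h3
        · exact absurd h3 h4
        · exact (ENNReal.toNNReal_mono ENNReal.coe_ne_top (not_lt.1 h2)).trans_eq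
            (ENNReal.toNNReal_coe _)
      · rw [evalAt_eq hw'] at h3
        rw [evalAt_eq hw] at h4
        rw [StratFeller.stopAt_of_le le_rfl, StratFeller.stopAt_of_le] at h3
        · exact absurd h4 h3
        · exact (ENNReal.toNNReal_mono ENNReal.coe_ne_top (not_lt.1 h2)).trans_eq
            (ENNReal.toNNReal_coe _)
      · rfl

end EvalAt

section Limits

/-- The mesh of the `N`-th grid. -/
noncomputable def mesh (N : ℕ) : ℝ≥0 := 1 / (N + 1)

theorem mesh_pos (N : ℕ) : 0 < mesh N := by unfold mesh; positivity

/-- The number of sign changes on the `N`-th grid; they cover `[0, N + 2]`. -/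
def steps (N : ℕ) : ℕ := (N + 2) * (N + 1)

theorem steps_mul_mesh (N : ℕ) : (steps N * mesh N : ℝ≥0) = N + 2 := by
  unfold steps mesh
  push_cast
  rw [mul_assoc, mul_one_div_cancel (by positivity), mul_one]

theorem mesh_le_one (N : ℕ) : mesh N ≤ 1 := by
  unfold mesh
  rw [div_le_one (by positivity)]
  exact le_add_self

theorem tendsto_mesh : Tendsto mesh atTop (𝓝 0) := by
  unfold mesh
  exact tendsto_one_div_add_atTop_nhds_zero_nat (𝕜 := ℝ≥0)

theorem eventually_add_mesh_le (t : ℝ≥0) : ∀ᶠ N in atTop, t + mesh N ≤ steps N * mesh N := by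
  filter_upwards [eventually_ge_atTop ⌈t⌉₊] with N hN
  rw [steps_mul_mesh]
  have h1 : t ≤ N := (Nat.le_ceil t).trans (by exact_mod_cast hN)
  calc t + mesh N ≤ N + 1 := add_le_add h1 (mesh_le_one N)
    _ ≤ N + 2 := by gcongr; norm_num

variable {w : ℝ≥0 → ℝ}

/-- Uniform continuity on bounded time intervals, in terms of the mesh. -/
theorem eventually_mesh_osc_le (hw : Continuous w) (t : ℝ≥0) {δ : ℝ} (hδ : 0 < δ) :
    ∀ᶠ N in atTop, ∀ u v, u ≤ v → v ≤ u + mesh N → v ≤ t + mesh N → |w v - w u| ≤ δ := by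
  have hc : UniformContinuousOn w (Set.Icc 0 (t + 1)) :=
    isCompact_Icc.uniformContinuousOn_of_continuous hw.continuousOn
  obtain ⟨η, hη, h⟩ := Metric.uniformContinuousOn_iff.1 hc δ hδ
  have hev : ∀ᶠ N in atTop, mesh N < η.toNNReal :=
    tendsto_mesh.eventually (gt_mem_nhds (Real.toNNReal_pos.2 hη))
  filter_upwards [hev] with N hN u v huv hvu hvt
  have hvt' : v ≤ t + 1 := hvt.trans (by gcongr; exact mesh_le_one N)
  refine (h v ⟨zero_le, hvt'⟩ u ⟨zero_le, huv.trans hvt'⟩ ?_).le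
  have h1 : (u : ℝ) ≤ v := by exact_mod_cast huv
  have h2 : (v : ℝ) ≤ u + mesh N := by exact_mod_cast hvu
  have h3 : (mesh N : ℝ) < η := by
    have := NNReal.coe_lt_coe.2 hN
    rwa [Real.coe_toNNReal _ hη.le] at this
  rw [NNReal.dist_eq, abs_lt]; constructor <;> linarith

theorem hitTime_eq_of_stopAt_eq {v : ℝ≥0 → ℝ} (hv : Continuous v) (hw : Continuous w) {b : ℝ≥0}
    (h : stopAt b v = stopAt b w) (hb : hitTime w ≤ b) : hitTime v = hitTime w := by
  rw [← hitTime_stopAt hw hb, ← h, hitTime_stopAt hv]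
  refine not_lt.1 fun hc => ?_
  rw [← lt_hitTime_stopAt_iff hv le_rfl, h, lt_hitTime_stopAt_iff hw le_rfl] at hc
  exact absurd hc (not_lt.2 hb)

theorem tendsto_reflected_signChange (hw : Continuous w) (τ : ℝ≥0∞) (t : ℝ≥0) :
    Tendsto (fun N => reflected τ
      (signChange (mesh N) (fun j => tanakaSign τ (mesh N) j w) w (steps N)) t) atTop
      (𝓝 (unreflected τ w t)) := by
  have hone : ∀ N (i : ℕ) (s : ℝ≥0), (s : ℝ≥0∞) ≤ hitTime w + τ → (i * mesh N : ℝ≥0) < s →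
      tanakaSign τ (mesh N) i w = 1 := fun N i s hs hi =>
    if_pos (lt_of_lt_of_le (by exact_mod_cast hi) hs)
  have hagree : ∀ s : ℝ≥0, (s : ℝ≥0∞) ≤ hitTime w + τ → ∀ N, s ≤ steps N * mesh N →
      stopAt s (signChange (mesh N) (fun j => tanakaSign τ (mesh N) j w) w (steps N)) =
        stopAt s w := fun s hs N hN => by
    ext u
    exact signChange_eq_self (mesh_pos N) (fun i hi => hone N i s hs hi) hN (min_le_right _ _)
  rcases le_or_gt (t : ℝ≥0∞) (hitTime w + τ) with h1 | h1
  · refine tendsto_const_nhds.congr' ?_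
    filter_upwards [eventually_add_mesh_le t] with N hN
    have hGc := continuous_signChange hw (mesh N) (fun j => tanakaSign τ (mesh N) j w) (steps N)
    rw [← reflected_stopAt hGc, hagree t h1 N (le_self_add.trans hN), reflected_stopAt hw,
      reflected, unreflected, if_pos h1, if_pos h1]
  · obtain ⟨s, hs⟩ : ∃ s : ℝ≥0, hitTime w + τ = s :=
      ⟨_, (ENNReal.coe_toNNReal h1.ne_top).symm⟩
    have hst : s ≤ t := by rw [hs] at h1; exact_mod_cast h1.le
    have hTs : hitTime w ≤ s := hs ▸ le_self_add
    have hY : unreflected τ w t = |w t - w s| := by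
      rw [unreflected, if_neg (not_lt.2 (le_self_add.trans h1.le)), if_neg (not_le.2 h1), hs,
        ENNReal.toNNReal_coe, evalAt_eq hw]
    rw [hY, Metric.tendsto_nhds]
    intro ε hε
    filter_upwards [eventually_add_mesh_le t,
      eventually_mesh_osc_le hw t (show 0 < ε / 8 by positivity)] with N hN hosc
    have hGc := continuous_signChange hw (mesh N) (fun j => tanakaSign τ (mesh N) j w) (steps N)
    have hhit := hitTime_eq_of_stopAt_eq hGc hw
      (hagree s hs.ge N (hst.trans (le_self_add.trans hN))) hTs
    have hb := abs_signChange_sub_minFrom_sub_abs_le hw (mesh_pos N) hst hN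
      (e := fun j => tanakaSign τ (mesh N) j w) (fun i hi => hone N i s hs.ge hi)
      (fun i hi => by
        have : ¬ ((i * mesh N : ℝ≥0) : ℝ≥0∞) < s := not_lt.2 (by exact_mod_cast hi)
        simp only [tanakaSign, hs, if_neg this, ENNReal.toNNReal_coe, evalAt_eq hw])
      hosc
    rw [reflected_of_ge hGc (by rw [hhit, hs]) hst, Real.dist_eq]
    linarith

end Limits

section Law

variable {Ω : Type*} {mΩ : MeasurableSpace Ω} {P : Measure Ω} {F : Filtration ℝ≥0 mΩ}
  {W : ℝ≥0 → Ω → ℝ}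

/-- **Lévy's theorem**, for Brownian motion restarted from zero: reflection at the running minimum
and reflection by the absolute value give the same law. -/
theorem IsBrownianWrt.map_reflected [IsProbabilityMeasure P] (hW : IsBrownianWrt F P W) (c : ℝ)
    (τ : ℝ≥0∞) : P.map (fun ω => reflected τ (startedAt c W ω)) =
      P.map (fun ω => unreflected τ (startedAt c W ω)) := by
  refine hW.map_eq_of_tendsto (h := mesh) (e := fun N => tanakaSign τ (mesh N))
    (fun N => isSignRule_tanakaSign τ _ c) steps (measurable_reflected τ)
    ((measurable_unreflected τ).comp (hW.measurable_startedAt c)).aemeasurable ?_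
  filter_upwards [hW.ae_continuous c] with ω hω t
  exact tendsto_reflected_signChange hω.1 τ t

end Law

end StratFeller

namespace StratFeller

/-! ### Zeros of Brownian motion are not isolated from the right -/

/-- The path `w`, reflected at the level zero after its first zero. -/
noncomputable def mirror (w : ℝ≥0 → ℝ) (t : ℝ≥0) : ℝ :=
  if (t : ℝ≥0∞) ≤ hitTime w then w t else -w t

theorem measurable_mirror : Measurable mirror := by
  refine measurable_pi_lambda _ fun t => ?_
  exact Measurable.ite (measurableSet_le measurable_const measurable_hitTime)
    (measurable_pi_apply _) (measurable_pi_apply _).neg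

/-- The signs that turn a path into its mirror image. -/
noncomputable def mirrorSign (h : ℝ≥0) (k : ℕ) (w : ℝ≥0 → ℝ) : ℝ :=
  if ((k * h : ℝ≥0) : ℝ≥0∞) < hitTime w then 1 else -1

theorem isSignRule_mirrorSign (h : ℝ≥0) (c : ℝ) : IsSignRule h (mirrorSign h) c where
  measurable k := Measurable.ite (measurableSet_lt measurable_const measurable_hitTime)
    measurable_const measurable_const
  sign k w := by unfold mirrorSign; split_ifs <;> simp
  stopAt k w hw _ := by
    unfold mirrorSign
    simp only [lt_hitTime_stopAt_iff hw le_rfl]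

theorem tendsto_signChange_mirror {w : ℝ≥0 → ℝ} (hw : Continuous w) (h0 : 0 ≤ w 0) (t : ℝ≥0) :
    Tendsto (fun N => signChange (mesh N) (fun j => mirrorSign (mesh N) j w) w (steps N) t) atTop
      (𝓝 (mirror w t)) := by
  rcases le_or_gt (t : ℝ≥0∞) (hitTime w) with h1 | h1
  · rw [mirror, if_pos h1]
    refine tendsto_const_nhds.congr' ?_
    filter_upwards [eventually_add_mesh_le t] with N hN
    refine (signChange_eq_self (mesh_pos N) (fun i hi => if_pos ?_) (le_self_add.trans hN)
      le_rfl).symm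
    exact lt_of_lt_of_le (by exact_mod_cast hi) h1
  · rw [mirror, if_neg (not_le.2 h1)]
    obtain ⟨s, hs⟩ : ∃ s : ℝ≥0, hitTime w = s := ⟨_, (ENNReal.coe_toNNReal h1.ne_top).symm⟩
    have hst : s < t := by rw [hs] at h1; exact_mod_cast h1
    -- the grid point at which the signs change
    set k₀ : ℕ → ℕ := fun N => ⌈s / mesh N⌉₊ with hk₀
    have hlow : ∀ N, s ≤ k₀ N * mesh N := fun N => by
      rw [← div_le_iff₀ (mesh_pos N)]; exact Nat.le_ceil _
    have hup : ∀ N, (k₀ N * mesh N : ℝ≥0) ≤ s + mesh N := fun N => by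
      have h3 : (k₀ N : ℝ≥0) ≤ s / mesh N + 1 := (Nat.ceil_lt_add_one zero_le).le
      calc (k₀ N * mesh N : ℝ≥0) ≤ (s / mesh N + 1) * mesh N := by gcongr
        _ = s + mesh N := by rw [add_mul, div_mul_cancel₀ _ (mesh_pos N).ne', one_mul]
    have hlim : Tendsto (fun N => (k₀ N * mesh N : ℝ≥0)) atTop (𝓝 s) := by
      refine tendsto_of_tendsto_of_tendsto_of_le_of_le tendsto_const_nhds ?_ hlow hup
      simpa using tendsto_mesh.const_add s
    have hev : ∀ᶠ N in atTop, (k₀ N * mesh N : ℝ≥0) ≤ t :=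
      (hlim.eventually (gt_mem_nhds hst)).mono fun N hN => hN.le
    have hw2 : Tendsto (fun N => w (k₀ N * mesh N) - (w t - w (k₀ N * mesh N))) atTop
        (𝓝 (w s - (w t - w s))) :=
      ((hw.tendsto s).comp hlim).sub (tendsto_const_nhds.sub ((hw.tendsto s).comp hlim))
    rw [eq_zero_of_hitTime_eq hw h0 hs] at hw2
    simp only [sub_zero, zero_sub] at hw2
    refine hw2.congr' ?_
    filter_upwards [hev, eventually_add_mesh_le t] with N h2 h3
    have htK := le_self_add.trans h3
    have hkK : k₀ N ≤ steps N := by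
      have := h2.trans htK
      exact_mod_cast le_of_mul_le_mul_right this (mesh_pos N)
    have hneg : ∀ i ≥ k₀ N, mirrorSign (mesh N) i w = -1 := fun i hi => by
      refine if_neg ?_
      rw [hs, not_lt]
      have : s ≤ i * mesh N := (hlow N).trans (by gcongr)
      exact_mod_cast this
    have hpos : ∀ i < k₀ N, mirrorSign (mesh N) i w = 1 := fun i hi => by
      refine if_pos ?_
      rw [hs]
      have : i < s / mesh N := Nat.lt_ceil.1 hi
      rw [lt_div_iff₀ (mesh_pos N)] at this
      exact_mod_cast this
    rw [signChange_eq_neg (e := fun j => mirrorSign (mesh N) j w) hneg hkK le_rfl h2 htK,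
      signChange_eq_self_of_nat (e := fun j => mirrorSign (mesh N) j w) hpos hkK le_rfl]

theorem measurable_minFrom (σ : ℝ≥0∞) (t : ℝ≥0) : Measurable (minFrom σ t) := by
  refine Measurable.iInf fun n => ?_
  split_ifs
  · exact measurable_pi_apply _
  · exact measurable_pi_apply _

section Zeros

variable {Ω : Type*} {mΩ : MeasurableSpace Ω} {P : Measure Ω} {F : Filtration ℝ≥0 mΩ}
  {W : ℝ≥0 → Ω → ℝ} [IsProbabilityMeasure P]

/-- **Reflection principle**. -/
theorem IsBrownianWrt.map_mirror (hW : IsBrownianWrt F P W) {c : ℝ} (hc : 0 ≤ c) :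
    P.map (startedAt c W) = P.map fun ω => mirror (startedAt c W ω) := by
  refine hW.map_eq_of_tendsto (h := mesh) (e := fun N => mirrorSign (mesh N))
    (fun N => isSignRule_mirrorSign _ c) steps (Φ := id) measurable_id
    (measurable_mirror.comp (hW.measurable_startedAt c)).aemeasurable ?_
  filter_upwards [hW.ae_continuous c] with ω hω t
  exact tendsto_signChange_mirror hω.1 (hω.2.symm ▸ hc) t

theorem measure_add_eq_zero {X Y : Ω → ℝ} (hX : AEMeasurable X P) (hY : AEMeasurable Y P)
    (h : IndepFun X Y P) [NullSingletonClass (P.map Y)] : P {ω | X ω + Y ω = 0} = 0 := by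
  have hm : MeasurableSet {p : ℝ × ℝ | p.1 + p.2 = 0} :=
    measurableSet_eq_fun (by fun_prop) measurable_const
  have h1 := (indepFun_iff_map_prod_eq_prod_map_map hX hY).1 h
  have h2 : P {ω | X ω + Y ω = 0} = P.map (fun ω => (X ω, Y ω)) {p : ℝ × ℝ | p.1 + p.2 = 0} := by
    rw [Measure.map_apply_of_aemeasurable (hX.prodMk hY) hm]; rfl
  have := Measure.isProbabilityMeasure_map hX (μ := P)
  have := Measure.isProbabilityMeasure_map hY (μ := P)
  rw [h2, h1, Measure.measure_prod_null hm]
  refine Eventually.of_forall fun x => ?_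
  have : Prod.mk x ⁻¹' {p : ℝ × ℝ | p.1 + p.2 = 0} = {-x} := by
    ext y
    simp only [Set.mem_preimage, Set.mem_ofPred_eq, Set.mem_singleton_iff]
    constructor <;> intro h <;> linarith
  change P.map Y (Prod.mk x ⁻¹' {p : ℝ × ℝ | p.1 + p.2 = 0}) = 0
  rw [this]
  exact measure_singleton _

/-- The minimum over a fixed interval does not take a given value: given the increments after its
left end point, it is a translate of the position there, which has no atoms. -/
theorem IsBrownianWrt.ae_minFrom_ne (hW : IsBrownianWrt F P W) (c : ℝ) {p q : ℝ≥0}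
    (hp : 0 < p) (hpq : p ≤ q) : ∀ᵐ ω ∂P, minFrom p q (startedAt c W ω) ≠ 0 := by
  set V : Ω → ℝ≥0 → ℝ := fun ω t => W (p + t) ω - W p ω with hV
  set Ψ : (ℝ≥0 → ℝ) → ℝ := fun v => c + minFrom p q (fun s => v (s - p)) with hΨ
  have hΨm : Measurable Ψ := measurable_const.add ((measurable_minFrom p q).comp
    (measurable_pi_lambda _ fun s => measurable_pi_apply _))
  have hVm : Measurable V := measurable_pi_lambda _ fun t =>
    (hW.measurable _).sub (hW.measurable _)
  have hev : Measurable fun v : Set.Iic p → ℝ => v ⟨p, Set.mem_Iic.2 le_rfl⟩ :=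
    measurable_pi_apply (X := fun _ : Set.Iic p => ℝ) _
  have hind := (hW.isBrownian.indepFun_shift p).comp hΨm hev
  have hlaw := hW.isBrownian.hasLaw_eval p
  have : NullSingletonClass (P.map (W p)) := by
    rw [hlaw.map_eq]; exact nullSingletonClass_gaussianReal hp.ne'
  have h0 := measure_add_eq_zero (hΨm.comp hVm).aemeasurable (hW.measurable p).aemeasurable hind
  filter_upwards [hW.ae_continuous c, measure_eq_zero_iff_ae_notMem.1 h0] with ω hω hne hmin
  refine hne ?_
  change c + minFrom p q (fun s => V ω (s - p)) + W p ω = 0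
  have hVs : ∀ s ∈ Set.Icc p q, V ω (s - p) = startedAt c W ω s - c - W p ω := fun s hs => by
    simp only [hV, startedAt, add_tsub_cancel_of_le hs.1]; ring
  have hVc : Continuous fun s => V ω (s - p) := by
    have h2 : Continuous fun s => W s ω :=
      (hω.1.sub (continuous_const (y := c))).congr fun s => by simp [startedAt]
    have h3 : Continuous fun s : ℝ≥0 => p + (s - p) := by fun_prop
    exact (h2.comp h3).sub continuous_const
  rw [← hmin]
  obtain ⟨x, hx, hmx⟩ := exists_minFrom_eq hVc hpq
  obtain ⟨y, hy, hmy⟩ := exists_minFrom_eq hω.1 hpq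
  have h4 := minFrom_le hVc hy
  have h5 := minFrom_le hω.1 hx
  rw [hVs y hy] at h4
  rw [hVs x hx] at hmx
  linarith

/-- After its first zero the path takes the value zero again immediately: otherwise the path or
its mirror image would have a local minimum at the level zero. -/
theorem IsBrownianWrt.ae_exists_zero (hW : IsBrownianWrt F P W) {c : ℝ} (hc : 0 < c) :
    ∀ᵐ ω ∂P, ∀ s : ℝ≥0, hitTime (startedAt c W ω) = s → ∀ b > s,
      ∃ t ∈ Set.Ioo s b, startedAt c W ω t = 0 := by
  have hA : ∀ᵐ ω ∂P, ∀ i j, 0 < dens i → dens i ≤ dens j →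
      minFrom (dens i) (dens j) (startedAt c W ω) ≠ 0 := by
    refine ae_all_iff.2 fun i => ae_all_iff.2 fun j => ?_
    by_cases h : 0 < dens i ∧ dens i ≤ dens j
    · exact (hW.ae_minFrom_ne c h.1 h.2).mono fun ω hω _ _ => hω
    · exact Eventually.of_forall fun ω h1 h2 => absurd ⟨h1, h2⟩ h
  have hB : ∀ᵐ ω ∂P, ∀ i j, 0 < dens i → dens i ≤ dens j →
      minFrom (dens i) (dens j) (mirror (startedAt c W ω)) ≠ 0 := by
    have hm : MeasurableSet {w : ℝ≥0 → ℝ | ∀ i j, 0 < dens i → dens i ≤ dens j →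
        minFrom (dens i) (dens j) w ≠ 0} := by
      simp only [Set.ofPred_forall]
      refine MeasurableSet.iInter fun i => MeasurableSet.iInter fun j =>
        MeasurableSet.iInter fun _ => MeasurableSet.iInter fun _ => ?_
      exact (measurable_minFrom _ _ (measurableSet_singleton 0)).compl
    have h1 := (ae_map_iff (hW.measurable_startedAt c).aemeasurable hm).2 hA
    rw [hW.map_mirror hc.le] at h1
    exact (ae_map_iff (measurable_mirror.comp (hW.measurable_startedAt c)).aemeasurable hm).1 h1
  filter_upwards [hW.ae_continuous c, hA, hB] with ω hω hA hB s hs b hb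
  set w := startedAt c W ω with hw
  have h0 : 0 < w 0 := hω.2.symm ▸ hc
  have hws := eq_zero_of_hitTime_eq hω.1 h0.le hs
  have hs0 : 0 < s := by
    rcases eq_or_ne s 0 with rfl | h
    · rw [hws] at h0; exact absurd h0 (lt_irrefl _)
    · exact pos_iff_ne_zero.2 h
  by_contra! hno
  obtain ⟨i, hi⟩ := exists_dens_mem isOpen_Ioo (Set.nonempty_Ioo.2 hs0)
  obtain ⟨j, hj⟩ := exists_dens_mem isOpen_Ioo (Set.nonempty_Ioo.2 hb)
  have hij : dens i ≤ dens j := (hi.2.trans hj.1).le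
  have hbefore : ∀ u < s, 0 < w u := fun u hu =>
    (lt_hitTime_iff hω.1).1 (by rw [hs]; exact_mod_cast hu) u le_rfl
  -- the sign is constant between the zero and `b`
  have hconst : (∀ u ∈ Set.Ioo s b, 0 < w u) ∨ ∀ u ∈ Set.Ioo s b, w u < 0 := by
    by_contra! hcon
    obtain ⟨⟨x, hx, hwx⟩, y, hy, hwy⟩ := hcon
    have hpre : IsPreconnected (Set.Ioo s b) := isPreconnected_Ioo
    obtain ⟨z, hz, hwz⟩ := hpre.intermediate_value hx hy hω.1.continuousOn ⟨hwx, hwy⟩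
    exact hno z hz hwz
  rcases hconst with h | h
  · refine hA i j hi.1 hij (le_antisymm ?_ (le_minFrom (fun u hu => ?_) hij))
    · rw [← hws]; exact minFrom_le hω.1 ⟨hi.2.le, hj.1.le⟩
    · rcases lt_trichotomy u s with h1 | h1 | h1
      · exact (hbefore u h1).le
      · rw [h1, hws]
      · exact (h u ⟨h1, hu.2.trans_lt hj.2⟩).le
  · have hmir : ∀ u, mirror w u = if u ≤ s then w u else -w u := fun u => by
      unfold mirror; rw [hs]; simp only [ENNReal.coe_le_coe]
    have hmc : Continuous (mirror w) := by
      rw [show mirror w = fun u => if u ≤ s then w u else -w u from funext hmir]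
      refine Continuous.if_le hω.1 hω.1.neg continuous_id continuous_const ?_
      rintro x rfl
      rw [show w x = 0 from hws, neg_zero]
    have hms : mirror w s = 0 := by rw [hmir, if_pos le_rfl, hws]
    refine hB i j hi.1 hij (le_antisymm ?_ (le_minFrom (fun u hu => ?_) hij))
    · rw [← hms]; exact minFrom_le hmc ⟨hi.2.le, hj.1.le⟩
    · rw [hmir]
      rcases lt_trichotomy u s with h1 | h1 | h1
      · rw [if_pos h1.le]; exact (hbefore u h1).le
      · rw [if_pos h1.le, h1, hws]
      · rw [if_neg (not_le.2 h1)]; linarith [h u ⟨h1, hu.2.trans_lt hj.2⟩]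

end Zeros

end StratFeller

namespace StratFeller

/-! ### The family of Stratonovich solutions and their laws -/

section Laws

variable {Ω : Type*} {mΩ : MeasurableSpace Ω} {P : Measure Ω} {F : Filtration ℝ≥0 mΩ}
  {W : ℝ≥0 → Ω → ℝ}

theorem IsStratonovichSolution.congr {x₀ : ℝ} {X Y : ℝ≥0 → Ω → ℝ}
    (hX : IsStratonovichSolution F P W x₀ X) (h : ∀ᵐ ω ∂P, ∀ t, X t ω = Y t ω) :
    IsStratonovichSolution F P W x₀ Y where
  adapted t := (hX.adapted t).congr (h.mono fun _ hω => hω t)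
  continuous := by
    filter_upwards [hX.continuous, h] with ω h1 h2
    exact h1.congr h2
  nonneg := by
    filter_upwards [hX.nonneg, h] with ω h1 h2 t
    rw [← h2 t]; exact h1 t
  init := by
    filter_upwards [hX.init, h] with ω h1 h2
    rw [← h2 0, h1]
  eqn t := by
    refine TendstoInMeasure.congr (fun p => ?_) ?_ (hX.eqn t)
    · filter_upwards [h] with ω hω
      simp only [stratonovichSum, hω]
    · filter_upwards [h] with ω hω
      rw [hω t]

theorem squareProcess_eq {x₀ : ℝ} (t : ℝ≥0) (ω : Ω) :
    squareProcess x₀ W t ω = startedAt (√(2 * x₀)) W ω t ^ 2 / 2 := by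
  have h2 : √2 ≠ (0 : ℝ) := by positivity
  rw [squareProcess, startedAt, Real.sqrt_mul zero_le_two,
    show √x₀ + W t ω / √2 = (√2 * √x₀ + W t ω) / √2 by field_simp, div_pow,
    Real.sq_sqrt zero_le_two]

theorem squareProcess_eq_zero_iff {x₀ : ℝ} {t : ℝ≥0} {ω : Ω} :
    squareProcess x₀ W t ω = 0 ↔ startedAt (√(2 * x₀)) W ω t = 0 := by
  rw [squareProcess_eq]; simp

theorem measurable_sq_div_two : Measurable fun (w : ℝ≥0 → ℝ) t => w t ^ 2 / 2 :=
  measurable_pi_lambda _ fun t => ((measurable_pi_apply t).pow_const 2).div_const 2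

theorem IsBrownianWrt.measurable_path_stratSolution (hW : IsBrownianWrt F P W) (x₀ : ℝ)
    (τ : ℝ≥0∞) : Measurable (path (stratSolution x₀ W τ)) :=
  measurable_sq_div_two.comp ((measurable_reflected τ).comp (hW.measurable_startedAt _))

theorem IsBrownianWrt.measure_hitTime_lt_top_ne_zero (hW : IsBrownianWrt F P W) (c : ℝ) :
    P {ω | hitTime (startedAt c W ω) < ∞} ≠ 0 := by
  intro h0
  have hsub : ∀ᵐ ω ∂P, 0 ≤ c + W 1 ω := by
    filter_upwards [hW.ae_continuous c, measure_eq_zero_iff_ae_notMem.1 h0] with ω hω hh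
    by_contra! hc
    refine hh ?_
    have : ¬ ((1 : ℝ≥0) : ℝ≥0∞) < hitTime (startedAt c W ω) := fun h =>
      absurd ((lt_hitTime_iff hω.1).1 h 1 le_rfl) (not_lt.2 hc.le)
    exact (not_lt.1 this).trans_lt ENNReal.coe_lt_top
  have hlaw := hW.isBrownian.hasLaw_eval 1
  have h1 : gaussianReal 0 1 {x | c + x < 0} = 0 := by
    rw [← hlaw.map_eq, Measure.map_apply (hW.measurable 1)
      (measurableSet_lt (by fun_prop) measurable_const)]
    rw [measure_eq_zero_iff_ae_notMem]
    filter_upwards [hsub] with ω hω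
    exact not_lt.2 hω
  have h2 := gaussianReal_absolutelyContinuous' 0 (one_ne_zero : (1 : ℝ≥0) ≠ 0) h1
  have h3 : {x : ℝ | c + x < 0} = Set.Iio (-c) := by
    ext x; simp only [Set.mem_ofPred_eq, Set.mem_Iio]; constructor <;> intro h <;> linarith
  rw [h3, Real.volume_Iio] at h2
  exact ENNReal.top_ne_zero h2

variable [IsProbabilityMeasure P]

/-- All the zero times coincide. -/
theorem IsBrownianWrt.ae_squareZeroTime_eq (hW : IsBrownianWrt F P W) {x₀ : ℝ} (hx₀ : 0 < x₀) :
    ∀ᵐ ω ∂P, ∀ n, 1 ≤ n →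
      squareZeroTime x₀ W n ω = hitTime (startedAt (√(2 * x₀)) W ω) := by
  have hc : 0 < √(2 * x₀) := by positivity
  filter_upwards [hW.ae_continuous (√(2 * x₀)), hW.ae_exists_zero hc] with ω hω hz n hn
  set w := startedAt (√(2 * x₀)) W ω with hw
  have h0 : 0 < w 0 := hω.2.symm ▸ hc
  have hge : ∀ t : ℝ≥0, w t = 0 → hitTime w ≤ t := fun t ht => not_lt.1 fun hlt =>
    ((lt_hitTime_iff hω.1).1 hlt t le_rfl).ne' ht
  induction n, hn using Nat.le_induction with
  | base =>
    change zeroTime (squareProcess x₀ W) 1 ω = _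
    simp only [zeroTime, squareProcess_eq_zero_iff, ← hw]
    refine le_antisymm ?_ (le_iInf₂ fun t ht => hge t ht.2)
    rcases eq_or_ne (hitTime w) ∞ with h | h
    · rw [h]; exact le_top
    · obtain ⟨s, hs⟩ : ∃ s : ℝ≥0, hitTime w = s := ⟨_, (ENNReal.coe_toNNReal h).symm⟩
      have hws := eq_zero_of_hitTime_eq hω.1 h0.le hs
      have hs0 : s ≠ 0 := by rintro rfl; exact h0.ne' hws
      rw [hs]
      exact iInf₂_le s ⟨by exact_mod_cast pos_iff_ne_zero.2 hs0, hws⟩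
  | succ n hn ih =>
    change zeroTime (squareProcess x₀ W) (n + 1) ω = _
    change zeroTime (squareProcess x₀ W) n ω = _ at ih
    simp only [zeroTime, squareProcess_eq_zero_iff, ← hw, ih]
    refine le_antisymm ?_ (le_iInf₂ fun t ht => hge t ht.2)
    rcases eq_or_ne (hitTime w) ∞ with h | h
    · rw [h]; exact le_top
    · obtain ⟨s, hs⟩ : ∃ s : ℝ≥0, hitTime w = s := ⟨_, (ENNReal.coe_toNNReal h).symm⟩
      rw [hs]
      refine ENNReal.le_of_forall_pos_le_add fun ε hε _ => ?_
      obtain ⟨t, ht, hwt⟩ := hz s hs (s + ε) (lt_add_of_pos_right s hε)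
      refine (iInf₂_le t ⟨by exact_mod_cast ht.1, hwt⟩).trans ?_
      exact_mod_cast ht.2.le

/-- Up to the time `T_n + τ`, the solution with the delay `τ` is the killed process. -/
theorem IsBrownianWrt.ae_killedProcess_eq (hW : IsBrownianWrt F P W) {x₀ : ℝ} (hx₀ : 0 < x₀) :
    ∀ᵐ ω ∂P, ∀ n, 1 ≤ n → ∀ τ : ℝ≥0∞, ∀ t : ℝ≥0, (t : ℝ≥0∞) ≤ squareZeroTime x₀ W n ω + τ →
      stratSolution x₀ W τ t ω = killedProcess x₀ W n t ω := by
  filter_upwards [hW.ae_squareZeroTime_eq hx₀] with ω hω n hn τ t ht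
  rw [hω n hn] at ht
  rw [stratSolution, killedProcess, hω n hn]
  split_ifs with h
  · rw [reflected_of_lt h, squareProcess_eq]
  · rw [reflected_of_mem (not_lt.1 h) ht]; simp

/-- Lévy's theorem for the solutions, with the target process given up to indistinguishability. -/
theorem IsBrownianWrt.identDistrib_stratSolution (hW : IsBrownianWrt F P W) {x₀ : ℝ} {τ : ℝ≥0∞}
    {Z : ℝ≥0 → Ω → ℝ}
    (hZ : ∀ᵐ ω ∂P, ∀ t, Z t ω = unreflected τ (startedAt (√(2 * x₀)) W ω) t ^ 2 / 2) :
    IdentDistrib (path (stratSolution x₀ W τ)) (path Z) P P := by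
  have hS := hW.measurable_startedAt (√(2 * x₀))
  have hU : Measurable fun ω t => unreflected τ (startedAt (√(2 * x₀)) W ω) t ^ 2 / 2 :=
    measurable_sq_div_two.comp ((measurable_unreflected τ).comp hS)
  have hae : (fun ω t => unreflected τ (startedAt (√(2 * x₀)) W ω) t ^ 2 / 2) =ᵐ[P] path Z := by
    filter_upwards [hZ] with ω hω
    ext t; exact (hω t).symm
  refine ⟨(hW.measurable_path_stratSolution x₀ τ).aemeasurable, ⟨_, hU, hae.symm⟩, ?_⟩
  rw [← Measure.map_congr hae]
  have h := congrArg (Measure.map fun (w : ℝ≥0 → ℝ) t => w t ^ 2 / 2)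
    (hW.map_reflected (√(2 * x₀)) τ)
  have hR' : Measurable fun ω => reflected τ (startedAt (√(2 * x₀)) W ω) :=
    (measurable_reflected τ).comp hS
  have hU' : Measurable fun ω => unreflected τ (startedAt (√(2 * x₀)) W ω) :=
    (measurable_unreflected τ).comp hS
  rw [Measure.map_map measurable_sq_div_two hR', Measure.map_map measurable_sq_div_two hU'] at h
  exact h

theorem unreflected_of_gt {w : ℝ≥0 → ℝ} (hw : Continuous w) {τ : ℝ≥0∞} {t : ℝ≥0}
    (h : hitTime w + τ < t) :
    unreflected τ w t = |w t - w (hitTime w + τ).toNNReal| := by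
  rw [unreflected, if_neg (not_lt.2 (le_self_add.trans h.le)), if_neg (not_le.2 h), evalAt_eq hw]

theorem unreflected_of_le {w : ℝ≥0 → ℝ} {τ : ℝ≥0∞} {t : ℝ≥0}
    (h : (t : ℝ≥0∞) ≤ hitTime w + τ) : unreflected τ w t = reflected τ w t := by
  rw [unreflected, reflected, if_pos h, if_pos h]

theorem IsBrownianWrt.identDistrib_restartedProcess (hW : IsBrownianWrt F P W) {x₀ : ℝ}
    (hx₀ : 0 < x₀) {n : ℕ} (hn : 1 ≤ n) (τ : ℝ≥0) :
    IdentDistrib (path (stratSolution x₀ W τ)) (path (restartedProcess x₀ W n τ)) P P := by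
  refine hW.identDistrib_stratSolution ?_
  filter_upwards [hW.ae_continuous (√(2 * x₀)), hW.ae_squareZeroTime_eq hx₀,
    hW.ae_killedProcess_eq hx₀] with ω hω hT hK t
  rw [restartedProcess]
  split_ifs with h
  · have h' := h
    rw [hT n hn] at h'
    rw [killedProcess, if_neg (not_lt.2 (le_self_add.trans h.le)), zero_add,
      unreflected_of_gt hω.1 h', sq_abs, hT n hn]
    simp only [startedAt]
    ring
  · rw [add_zero, ← hK n hn τ t (not_lt.1 h), unreflected_of_le, stratSolution]
    rw [← hT n hn]; exact not_lt.1 h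

theorem IsBrownianWrt.identDistrib_squareProcess (hW : IsBrownianWrt F P W) {x₀ : ℝ}
    (hx₀ : 0 < x₀) :
    IdentDistrib (path (stratSolution x₀ W 0)) (path (squareProcess x₀ W)) P P := by
  refine hW.identDistrib_stratSolution ?_
  filter_upwards [hW.ae_continuous (√(2 * x₀))] with ω hω t
  have h0 : 0 ≤ startedAt (√(2 * x₀)) W ω 0 := by rw [hω.2]; positivity
  rw [squareProcess_eq]
  rcases lt_trichotomy (t : ℝ≥0∞) (hitTime (startedAt (√(2 * x₀)) W ω)) with h | h | h
  · rw [unreflected, if_pos h]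
  · rw [unreflected_of_le (by simpa using h.le), reflected_of_mem h.ge (by simpa using h.le),
      eq_zero_of_hitTime_eq hω.1 h0 h.symm]
  · have hT := ENNReal.coe_toNNReal h.ne_top
    rw [unreflected_of_gt hω.1 (by simpa using h), sq_abs, add_zero,
      eq_zero_of_hitTime_eq hω.1 h0 hT.symm, sub_zero]

theorem IsPreBrownianReal.map_eq {V V' : ℝ≥0 → Ω → ℝ} (h : IsPreBrownianReal V P)
    (h' : IsPreBrownianReal V' P) (hm : AEMeasurable (fun ω t => V t ω) P)
    (hm' : AEMeasurable (fun ω t => V' t ω) P) :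
    P.map (fun ω t => V t ω) = P.map fun ω t => V' t ω :=
  (map_eq_iff_forall_finset_map_restrict_eq hm hm').2 fun I =>
    (h.hasLaw I).map_eq.trans (h'.hasLaw I).map_eq.symm

theorem IsBrownianWrt.identDistrib_delayedProcess (hW : IsBrownianWrt F P W) (τ : ℝ≥0) :
    IdentDistrib (path (stratSolution 0 W τ)) (path (delayedProcess W τ)) P P := by
  set Ψ : (ℝ≥0 → ℝ) → ℝ≥0 → ℝ := fun v t => if τ < t then v (t - τ) ^ 2 / 2 else 0 with hΨ
  have hΨm : Measurable Ψ := by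
    refine measurable_pi_lambda _ fun t => ?_
    simp only [hΨ]
    split_ifs
    · exact ((measurable_pi_apply _).pow_const 2).div_const 2
    · exact measurable_const
  have hm : Measurable fun ω t => W t ω := measurable_pi_lambda _ hW.measurable
  have hm' : Measurable fun ω t => W (τ + t) ω - W τ ω := measurable_pi_lambda _ fun t =>
    (hW.measurable _).sub (hW.measurable _)
  have h1 : IdentDistrib (path (stratSolution 0 W τ))
      (path fun t ω => if τ < t then (W t ω - W τ ω) ^ 2 / 2 else 0) P P := by
    refine hW.identDistrib_stratSolution ?_
    filter_upwards [hW.ae_continuous (√(2 * 0))] with ω hω t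
    have hc : √(2 * 0) = (0 : ℝ) := by simp
    have hT : hitTime (startedAt (√(2 * 0)) W ω) = 0 := by
      have h0 : ¬ ((0 : ℝ≥0) : ℝ≥0∞) < hitTime (startedAt (√(2 * 0)) W ω) := fun h => by
        have := (lt_hitTime_iff hω.1).1 h 0 le_rfl
        rw [hω.2, hc] at this
        exact lt_irrefl _ this
      simpa using h0
    split_ifs with h
    · rw [unreflected_of_gt hω.1 (by rw [hT, zero_add]; exact_mod_cast h), hT, zero_add,
        ENNReal.toNNReal_coe, sq_abs]
      simp only [startedAt]
      ring
    · have h' : (t : ℝ≥0∞) ≤ τ := by exact_mod_cast not_lt.1 h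
      rw [unreflected_of_le (by rw [hT, zero_add]; exact h'),
        reflected_of_mem (by rw [hT]; exact zero_le) (by rw [hT, zero_add]; exact h')]
      simp
  have h2 := congrArg (Measure.map Ψ) (IsPreBrownianReal.map_eq
    (hW.isBrownian.toIsPreBrownianReal.shift τ) hW.isBrownian.toIsPreBrownianReal
    hm'.aemeasurable hm.aemeasurable)
  rw [Measure.map_map hΨm hm', Measure.map_map hΨm hm] at h2
  refine h1.trans ⟨h1.aemeasurable_snd, (hΨm.comp hm).aemeasurable, ?_⟩
  have e : (path fun t ω => if τ < t then (W t ω - W τ ω) ^ 2 / 2 else 0) =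
      Ψ ∘ fun ω t => W (τ + t) ω - W τ ω := by
    ext ω t
    simp only [path, hΨ, Function.comp]
    split_ifs with h
    · rw [add_tsub_cancel_of_le h.le]
    · rfl
  rw [e, h2]
  rfl

/-- The paths that vanish on an interval of length more than `δ`, in terms of countably many
coordinates. -/
def longZero (δ : ℝ≥0) : Set (ℝ≥0 → ℝ) :=
  {x | ∃ i j, dens i + δ < dens j ∧ ∀ m, dens i ≤ dens m → dens m ≤ dens j → x (dens m) = 0}

theorem measurableSet_longZero (δ : ℝ≥0) : MeasurableSet (longZero δ) := by
  simp only [longZero, Set.ofPred_exists, Set.ofPred_and, Set.ofPred_forall]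
  refine MeasurableSet.iUnion fun i => MeasurableSet.iUnion fun j =>
    (MeasurableSet.const _).inter (MeasurableSet.iInter fun m => MeasurableSet.iInter fun _ =>
      MeasurableSet.iInter fun _ => ?_)
  exact measurable_pi_apply _ (measurableSet_singleton 0)

/-- The delay can be read off from the law: it is the length of the longest interval on which the
path vanishes. -/
theorem IsBrownianWrt.map_stratSolution_ne (hW : IsBrownianWrt F P W) {x₀ : ℝ}
    {τ τ' : ℝ≥0} (h : τ ≠ τ') :
    P.map (path (stratSolution x₀ W τ)) ≠ P.map (path (stratSolution x₀ W τ')) := by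
  wlog hlt : τ < τ' generalizing τ τ'
  · exact (this h.symm (lt_of_le_of_ne (not_lt.1 hlt) h.symm)).symm
  obtain ⟨δ, hδ1, hδ2⟩ := exists_between hlt
  set c := √(2 * x₀) with hc
  have hm := hW.measurable_path_stratSolution x₀
  have hlong : P.map (path (stratSolution x₀ W τ')) (longZero δ) ≠ 0 := by
    rw [Measure.map_apply (hm _) (measurableSet_longZero δ)]
    refine fun h0 => hW.measure_hitTime_lt_top_ne_zero c (measure_mono_null (fun ω hω => ?_) h0)
    obtain ⟨s, hs⟩ : ∃ s : ℝ≥0, hitTime (startedAt c W ω) = s :=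
      ⟨_, (ENNReal.coe_toNNReal (ne_of_lt hω)).symm⟩
    have hne1 : (Set.Ioo s (s + (τ' - δ))).Nonempty :=
      Set.nonempty_Ioo.2 (lt_add_of_pos_right _ (tsub_pos_of_lt hδ2))
    obtain ⟨i, hi⟩ := exists_dens_mem isOpen_Ioo hne1
    have hij : dens i + δ < s + τ' := by
      calc dens i + δ < s + (τ' - δ) + δ := by gcongr; exact hi.2
        _ = s + τ' := by rw [add_assoc, tsub_add_cancel_of_le hδ2.le]
    obtain ⟨j, hj⟩ := exists_dens_mem isOpen_Ioo (Set.nonempty_Ioo.2 hij)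
    refine ⟨i, j, hj.1, fun m h1 h2 => ?_⟩
    rw [path, stratSolution, ← hc, reflected_of_mem]
    · simp
    · rw [hs]; exact_mod_cast hi.1.le.trans h1
    · rw [hs]; exact_mod_cast h2.trans hj.2.le
  have hshort : P.map (path (stratSolution x₀ W τ)) (longZero δ) = 0 := by
    have hid := hW.identDistrib_stratSolution (x₀ := x₀) (τ := τ)
      (Z := fun t ω => unreflected τ (startedAt (√(2 * x₀)) W ω) t ^ 2 / 2)
      (Eventually.of_forall fun ω t => rfl)
    have hmU : Measurable (path fun t ω => unreflected τ (startedAt (√(2 * x₀)) W ω) t ^ 2 / 2) :=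
      measurable_sq_div_two.comp ((measurable_unreflected τ).comp (hW.measurable_startedAt _))
    rw [hid.map_eq, Measure.map_apply hmU (measurableSet_longZero δ)]
    have hne : ∀ᵐ ω ∂P, ∀ i j, dens i < dens j → W (dens j) ω - W (dens i) ω ≠ 0 := by
      refine ae_all_iff.2 fun i => ae_all_iff.2 fun j => ?_
      by_cases hij : dens i < dens j
      · have hl := hW.hasLaw_increment hij.le
        have hna : NullSingletonClass (gaussianReal 0 (dens j - dens i)) :=
          nullSingletonClass_gaussianReal (tsub_pos_of_lt hij).ne'
        have h0 := measure_singleton (μ := gaussianReal 0 (dens j - dens i)) (0 : ℝ)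
        rw [← hl.map_eq, Measure.map_apply_of_aemeasurable hl.aemeasurable
          (measurableSet_singleton 0)] at h0
        filter_upwards [measure_eq_zero_iff_ae_notMem.1 h0] with ω hω _ h1
        exact hω h1
      · exact Eventually.of_forall fun ω h1 => absurd h1 hij
    rw [measure_eq_zero_iff_ae_notMem]
    filter_upwards [hW.ae_continuous c, hne] with ω hω hne hmem
    obtain ⟨i, j, hij, hz⟩ := hmem
    simp only [path, ← hc] at hz
    set w := startedAt c W ω with hw
    have hle : dens i ≤ dens j := le_self_add.trans hij.le
    have hT : hitTime w ≤ dens i := by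
      by_contra! hlt'
      have h1 := hz i le_rfl hle
      rw [unreflected, if_pos hlt'] at h1
      have := (lt_hitTime_iff hω.1).1 hlt' _ le_rfl
      have : 0 < w (dens i) ^ 2 / 2 := by positivity
      exact this.ne' h1
    obtain ⟨s, hs⟩ : ∃ s : ℝ≥0, hitTime w + τ = s := ⟨_, (ENNReal.coe_toNNReal
      (ENNReal.add_ne_top.2 ⟨(hT.trans_lt ENNReal.coe_lt_top).ne, ENNReal.coe_ne_top⟩)).symm⟩
    have hsj : max s (dens i) < dens j := by
      refine max_lt ?_ (lt_of_le_of_lt le_self_add hij)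
      have h1 : (s : ℝ≥0∞) ≤ dens i + τ := hs ▸ add_le_add hT le_rfl
      have h2 : s ≤ dens i + τ := by exact_mod_cast h1
      exact h2.trans_lt ((by gcongr : dens i + τ < dens i + δ).trans hij)
    obtain ⟨a, ha⟩ := exists_dens_mem isOpen_Ioo (Set.nonempty_Ioo.2 hsj)
    obtain ⟨b, hb⟩ := exists_dens_mem isOpen_Ioo (Set.nonempty_Ioo.2 ha.2)
    have hval : ∀ m, max s (dens i) < dens m → dens m < dens j → w (dens m) = w s := by
      intro m h1 h2
      have h3 := hz m ((le_max_right _ _).trans h1.le) h2.le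
      have h4 : s < dens m := (le_max_left _ _).trans_lt h1
      rw [unreflected_of_gt hω.1 (by rw [hs]; exact_mod_cast h4), hs, ENNReal.toNNReal_coe,
        sq_abs] at h3
      have h5 : (w (dens m) - w s) ^ 2 = 0 := by linarith
      exact sub_eq_zero.1 (pow_eq_zero_iff two_ne_zero |>.1 h5)
    have h1 := hval a ha.1 ha.2
    have h2 := hval b (ha.1.trans hb.1) hb.2
    refine hne a b hb.1 ?_
    simp only [hw, startedAt] at h1 h2
    linarith
  intro heq
  rw [heq] at hshort
  exact hlong hshort

end Laws

end StratFeller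

namespace StratFeller

/-! ### Equations driven by a continuous path -/

/-- The partition of `[0, T]` into `N + 1` cells of equal length. -/
noncomputable def TimePartition.uniform (T : ℝ≥0) (N : ℕ) : TimePartition T where
  n := N + 1
  pt i := i * (T / (N + 1))
  mono := fun i j h => mul_le_mul_left (by exact_mod_cast h) _
  pt_zero := by simp
  pt_last := by
    push_cast
    exact mul_div_cancel₀ T (by positivity)

theorem TimePartition.uniform_step (T : ℝ≥0) (N i : ℕ) :
    (uniform T N).pt (i + 1) = (uniform T N).pt i + T / (N + 1) := by
  simp [uniform, add_mul]

theorem tendsto_div_add_one (T : ℝ≥0) :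
    Tendsto (fun N : ℕ => T / ((N : ℝ≥0) + 1)) atTop (𝓝 0) := by
  have h := tendsto_mesh.const_mul T
  simpa only [mesh, mul_one_div, mul_zero] using h

theorem TimePartition.tendsto_uniform (T : ℝ≥0) :
    Tendsto (uniform T) atTop (diamToZero T) := by
  rw [diamToZero, tendsto_comap_iff]
  refine tendsto_of_tendsto_of_tendsto_of_le_of_le tendsto_const_nhds (tendsto_div_add_one T)
    (fun _ => zero_le) ?_
  intro N
  change (Finset.range (N + 1)).sup _ ≤ T / (N + 1)
  refine Finset.sup_le fun i _ => ?_
  rw [uniform_step, add_tsub_cancel_left]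

section Euler

variable {g g' : ℝ → ℝ} {w α : ℝ≥0 → ℝ} {T s t : ℝ≥0} {B : ℝ} {K : ℝ≥0}

/-- The Euler scheme with step `h` for the equation `α' = g (w - α)`, `α 0 = 0`. -/
noncomputable def euler (g : ℝ → ℝ) (h : ℝ≥0) (w : ℝ≥0 → ℝ) : ℕ → ℝ
  | 0 => 0
  | i + 1 => euler g h w i + h * g (w (i * h) - euler g h w i)

theorem measurable_euler (hg : Measurable g) (h : ℝ≥0) (i : ℕ) :
    Measurable fun w => euler g h w i := by
  induction i with
  | zero => exact measurable_const
  | succ i ih =>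
    exact ih.add ((hg.comp ((measurable_pi_apply _).sub ih)).const_mul _)

theorem euler_stopAt (g : ℝ → ℝ) (h : ℝ≥0) (w : ℝ≥0 → ℝ) {i : ℕ} (hi : i * h ≤ t) :
    euler g h (stopAt t w) i = euler g h w i := by
  induction i with
  | zero => rfl
  | succ i ih =>
    have h1 : i * h ≤ t := le_trans (by gcongr; simp) hi
    rw [euler, euler, ih h1, stopAt_of_le h1]

/-- `α' = g (w - α)` on `[0, T]` and `α 0 = 0`, expressed by the bounds on the increments of `α`
that the mean value theorem yields. -/
structure IsDrift (g : ℝ → ℝ) (w α : ℝ≥0 → ℝ) (T : ℝ≥0) : Prop where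
  zero : α 0 = 0
  le_sub : ∀ s u, s ≤ u → u ≤ T → ∀ C, (∀ v ∈ Set.Icc s u, C ≤ g (w v - α v)) →
    C * (u - s) ≤ α u - α s
  sub_le : ∀ s u, s ≤ u → u ≤ T → ∀ C, (∀ v ∈ Set.Icc s u, g (w v - α v) ≤ C) →
    α u - α s ≤ C * (u - s)

theorem IsDrift.mono (h : IsDrift g w α T) (ht : t ≤ T) : IsDrift g w α t :=
  ⟨h.zero, fun s u hs hu => h.le_sub s u hs (hu.trans ht),
    fun s u hs hu => h.sub_le s u hs (hu.trans ht)⟩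

theorem IsDrift.congr (h : IsDrift g w α T) {α' : ℝ≥0 → ℝ}
    (hα : ∀ v ≤ T, α' v = α v) (hg : ∀ v ≤ T, g' (w v - α v) = g (w v - α v)) :
    IsDrift g' w α' T where
  zero := by rw [hα 0 zero_le, h.zero]
  le_sub s u hs hu C hC := by
    rw [hα u hu, hα s (hs.trans hu)]
    refine h.le_sub s u hs hu C fun v hv => ?_
    have := hC v hv
    rwa [hα v (hv.2.trans hu), hg v (hv.2.trans hu)] at this
  sub_le s u hs hu C hC := by
    rw [hα u hu, hα s (hs.trans hu)]
    refine h.sub_le s u hs hu C fun v hv => ?_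
    have := hC v hv
    rwa [hα v (hv.2.trans hu), hg v (hv.2.trans hu)] at this

theorem IsDrift.le_of_nonneg (h : IsDrift g w α T) (hg : ∀ v ≤ T, 0 ≤ g (w v - α v))
    (hst : s ≤ t) (htT : t ≤ T) : α s ≤ α t := by
  have := h.le_sub s t hst htT 0 fun v hv => hg v (hv.2.trans htT)
  linarith

theorem exists_isDrift (hw : Continuous w) (hg : LipschitzWith K g) (hB : ∀ y, |g y| ≤ B)
    (T : ℝ≥0) : ∃ α, IsDrift g w α T := by
  have hB0 : 0 ≤ B := (abs_nonneg _).trans (hB 0)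
  have hpl : IsPicardLindelof (fun (t : ℝ) y => g (w t.toNNReal - y)) (tmin := 0) (tmax := T)
      ⟨0, le_rfl, T.2⟩ (0 : ℝ) (B.toNNReal * T) 0 B.toNNReal K := by
    refine ⟨fun t _ => ?_, fun y _ => ?_, fun t _ y _ => ?_, ?_⟩
    · refine LipschitzWith.lipschitzOnWith ?_
      refine LipschitzWith.of_dist_le_mul fun x y => ?_
      refine (hg.dist_le_mul _ _).trans ?_
      rw [dist_sub_left]
    · exact (hg.continuous.comp ((hw.comp continuous_real_toNNReal).sub
        continuous_const)).continuousOn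
    · rw [Real.norm_eq_abs, Real.coe_toNNReal _ hB0]; exact hB _
    · simp
  obtain ⟨α, hα0, hα⟩ := hpl.exists_eq_forall_mem_Icc_hasDerivWithinAt (x := 0) (by simp)
  have hcont : ContinuousOn α (Set.Icc 0 T) := fun t ht => (hα t ht).continuousWithinAt
  have hder : ∀ s u : ℝ≥0, u ≤ T → ∀ x ∈ Set.Ioo (s : ℝ) u,
      HasDerivAt α (g (w x.toNNReal - α x)) x := fun s u hu x hx => by
    have h2 : (u : ℝ) ≤ T := by exact_mod_cast hu
    have hx' : x ∈ Set.Ioo (0 : ℝ) T := ⟨s.2.trans_lt hx.1, hx.2.trans_le h2⟩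
    exact (hα x (Set.Ioo_subset_Icc_self hx')).hasDerivAt (Icc_mem_nhds hx'.1 hx'.2)
  have hmem : ∀ (s u : ℝ≥0), ∀ x ∈ Set.Ioo (s : ℝ) u, x.toNNReal ∈ Set.Icc s u ∧
      (x.toNNReal : ℝ) = x := fun s u x hx => by
    have hx0 : 0 ≤ x := s.2.trans hx.1.le
    have e : (x.toNNReal : ℝ) = x := Real.coe_toNNReal _ hx0
    refine ⟨⟨?_, ?_⟩, e⟩ <;> rw [← NNReal.coe_le_coe, e]
    exacts [hx.1.le, hx.2.le]
  have hsub : ∀ s u : ℝ≥0, u ≤ T → Set.Icc (s : ℝ) u ⊆ Set.Icc 0 T := fun s u hu =>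
    Set.Icc_subset_Icc s.2 (by exact_mod_cast hu)
  refine ⟨fun t => α t, hα0, fun s u hs hu C hC => ?_, fun s u hs hu C hC => ?_⟩
  · have hs' : (s : ℝ) ≤ u := by exact_mod_cast hs
    refine Convex.mul_sub_le_image_sub_of_le_deriv (convex_Icc (s : ℝ) u)
      (hcont.mono (hsub s u hu)) ?_ ?_ s (Set.left_mem_Icc.2 hs') u (Set.right_mem_Icc.2 hs') hs'
      <;> rw [interior_Icc]
    · exact fun x hx => (hder s u hu x hx).differentiableAt.differentiableWithinAt
    · intro x hx
      obtain ⟨h1, h2⟩ := hmem s u x hx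
      have := hC _ h1
      rwa [(hder s u hu x hx).deriv, ← h2, Real.toNNReal_coe]
  · have hs' : (s : ℝ) ≤ u := by exact_mod_cast hs
    refine Convex.image_sub_le_mul_sub_of_deriv_le (convex_Icc (s : ℝ) u)
      (hcont.mono (hsub s u hu)) ?_ ?_ s (Set.left_mem_Icc.2 hs') u (Set.right_mem_Icc.2 hs') hs'
      <;> rw [interior_Icc]
    · exact fun x hx => (hder s u hu x hx).differentiableAt.differentiableWithinAt
    · intro x hx
      obtain ⟨h1, h2⟩ := hmem s u x hx
      have := hC _ h1
      rwa [(hder s u hu x hx).deriv, ← h2, Real.toNNReal_coe]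

theorem IsDrift.abs_sub_le (h : IsDrift g w α T) (hB : ∀ y, |g y| ≤ B) (hst : s ≤ t)
    (htT : t ≤ T) : |α t - α s| ≤ B * (t - s) := by
  rw [abs_le]
  have h1 := h.le_sub s t hst htT (-B) fun v _ => (abs_le.1 (hB _)).1
  have h2 := h.sub_le s t hst htT B fun v _ => (abs_le.1 (hB _)).2
  constructor <;> linarith

/-- The Euler scheme converges to any solution; in particular the solution is unique. -/
theorem IsDrift.tendsto_euler (h : IsDrift g w α T) (hw : Continuous w) (hg : LipschitzWith K g)
    (hB : ∀ y, |g y| ≤ B) :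
    Tendsto (fun N : ℕ => euler g (T / (N + 1)) w (N + 1)) atTop (𝓝 (α T)) := by
  have hB0 : 0 ≤ B := (abs_nonneg _).trans (hB 0)
  rw [Metric.tendsto_nhds]
  intro ε hε
  set δ := ε / (2 * (2 * K * T * Real.exp (K * T) + 1)) with hδ
  have hδ0 : 0 < δ := by positivity
  have hh : ∀ᶠ N : ℕ in atTop, B * ((T / (N + 1) : ℝ≥0) : ℝ) < δ := by
    have h1 : Tendsto (fun N : ℕ => B * ((T / ((N : ℝ≥0) + 1) : ℝ≥0) : ℝ)) atTop (𝓝 (B * 0)) :=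
      ((NNReal.tendsto_coe.2 (tendsto_div_add_one T))).const_mul B
    rw [mul_zero] at h1
    exact h1.eventually (gt_mem_nhds hδ0)
  filter_upwards [(TimePartition.tendsto_uniform T).eventually (eventually_osc_le hw T hδ0), hh]
    with N hosc hN
  set η : ℝ≥0 := T / (N + 1) with hη
  have hηT : (N + 1 : ℕ) * η = T := (TimePartition.uniform T N).pt_last
  have hkey : ∀ i ≤ N + 1, |euler g η w i - α (i * η)| ≤
      i * η * (K * (2 * δ)) * (1 + K * η) ^ i := by
    intro i hi
    induction i with
    | zero => simp [euler, h.zero]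
    | succ i ih =>
      have hi' := ih (by omega)
      have hle : i * η ≤ (i + 1 : ℕ) * η := by gcongr; simp
      have hleT : (i + 1 : ℕ) * η ≤ T := by rw [← hηT]; gcongr
      have hstep : (((i + 1 : ℕ) * η : ℝ≥0) : ℝ) - ((i * η : ℝ≥0) : ℝ) = η := by
        push_cast; ring
      have hg' : ∀ v ∈ Set.Icc (i * η) ((i + 1 : ℕ) * η),
          |g (w v - α v) - g (w (i * η) - α (i * η))| ≤ K * (2 * δ) := by
        intro v hv
        have h1 := hosc i (by simp [TimePartition.uniform]; omega) v hv (i * η) ⟨le_rfl, hle⟩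
        have h2 := h.abs_sub_le hB hv.1 (hv.2.trans hleT)
        have h3 := hg.dist_le_mul (w v - α v) (w (i * η) - α (i * η))
        rw [Real.dist_eq, Real.dist_eq] at h3
        refine h3.trans (mul_le_mul_of_nonneg_left ?_ K.2)
        have h4 : B * ((v : ℝ) - (i * η : ℝ≥0)) ≤ B * η := by
          refine mul_le_mul_of_nonneg_left ?_ hB0
          rw [← hstep]
          have : (v : ℝ) ≤ ((i + 1 : ℕ) * η : ℝ≥0) := by exact_mod_cast hv.2
          linarith
        calc |w v - α v - (w (i * η) - α (i * η))|
            = |(w v - w (i * η)) - (α v - α (i * η))| := by ring_nf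
          _ ≤ |w v - w (i * η)| + |α v - α (i * η)| := abs_sub _ _
          _ ≤ δ + δ := add_le_add h1 (by linarith)
          _ = 2 * δ := by ring
      have hinc : |α ((i + 1 : ℕ) * η) - α (i * η) - η * g (w (i * η) - α (i * η))| ≤
          η * (K * (2 * δ)) := by
        have h1 := h.le_sub _ _ hle hleT (g (w (i * η) - α (i * η)) - K * (2 * δ)) fun v hv => by
          linarith [(abs_le.1 (hg' v hv)).1]
        have h2 := h.sub_le _ _ hle hleT (g (w (i * η) - α (i * η)) + K * (2 * δ)) fun v hv => by
          linarith [(abs_le.1 (hg' v hv)).2]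
        rw [hstep] at h1 h2
        rw [abs_le]; constructor <;> linarith
      have hlip : |g (w (i * η) - euler g η w i) - g (w (i * η) - α (i * η))| ≤
          K * |euler g η w i - α (i * η)| := by
        have h3 := hg.dist_le_mul (w (i * η) - euler g η w i) (w (i * η) - α (i * η))
        rwa [dist_sub_left, Real.dist_eq, Real.dist_eq] at h3
      have hone : (1 : ℝ) ≤ (1 + K * η) ^ (i + 1) := one_le_pow₀ (by
        have : (0 : ℝ) ≤ K * η := by positivity
        linarith)
      rw [euler]
      calc |euler g η w i + η * g (w (i * η) - euler g η w i) - α ((i + 1 : ℕ) * η)|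
          = |(euler g η w i - α (i * η)) +
              η * (g (w (i * η) - euler g η w i) - g (w (i * η) - α (i * η))) -
              (α ((i + 1 : ℕ) * η) - α (i * η) - η * g (w (i * η) - α (i * η)))| := by
            congr 1; ring
        _ ≤ |euler g η w i - α (i * η)| +
              η * (K * |euler g η w i - α (i * η)|) + η * (K * (2 * δ)) := by
            refine (abs_sub _ _).trans (add_le_add ((abs_add_le _ _).trans
              (add_le_add le_rfl ?_)) hinc)
            rw [abs_mul, NNReal.abs_eq]
            exact mul_le_mul_of_nonneg_left hlip η.2
        _ = (1 + K * η) * |euler g η w i - α (i * η)| + η * (K * (2 * δ)) * 1 := by ring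
        _ ≤ (1 + K * η) * (i * η * (K * (2 * δ)) * (1 + K * η) ^ i) +
              η * (K * (2 * δ)) * (1 + K * η) ^ (i + 1) := by gcongr
        _ = _ := by push_cast; ring
  have hlast := hkey (N + 1) le_rfl
  have hηT' : ((N + 1 : ℕ) : ℝ) * η = T := by exact_mod_cast hηT
  have hexp : (1 + K * η : ℝ) ^ (N + 1) ≤ Real.exp (K * T) := by
    calc (1 + K * η : ℝ) ^ (N + 1) ≤ Real.exp (K * η) ^ (N + 1) := by
          gcongr
          rw [add_comm]; exact Real.add_one_le_exp _
      _ = Real.exp (K * T) := by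
          rw [← Real.exp_nat_mul, ← hηT']; ring_nf
  rw [hηT, hηT'] at hlast
  rw [Real.dist_eq]
  calc |euler g η w (N + 1) - α T| ≤ T * (K * (2 * δ)) * (1 + K * η) ^ (N + 1) := hlast
    _ ≤ T * (K * (2 * δ)) * Real.exp (K * T) := by gcongr
    _ = (2 * K * T * Real.exp (K * T)) * δ := by ring
    _ < (2 * (2 * K * T * Real.exp (K * T) + 1)) * δ := by
        have : 0 ≤ 2 * K * T * Real.exp (K * T) := by positivity
        exact mul_lt_mul_of_pos_right (by linarith) hδ0
    _ = ε := by rw [hδ]; field_simp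

end Euler

end StratFeller

namespace StratFeller

/-! ### The radial path and its absorption at zero -/

/-- The drift `1 / (2 y)`, cut off below the level `1 / (n + 1)`. -/
noncomputable def cutDrift (n : ℕ) (y : ℝ) : ℝ := 1 / (2 * max y (1 / (n + 1)))

section Radial

variable {w α : ℝ≥0 → ℝ} {s t T : ℝ≥0} {n m : ℕ}

theorem cutDrift_of_le {y : ℝ} (h : 1 / ((n : ℝ) + 1) ≤ y) : cutDrift n y = 1 / (2 * y) := by
  rw [cutDrift, max_eq_left h]

theorem abs_cutDrift_le (n : ℕ) (y : ℝ) : |cutDrift n y| ≤ n + 1 := by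
  have h1 : 0 < 1 / ((n : ℝ) + 1) := by positivity
  have h2 := le_max_right y (1 / ((n : ℝ) + 1))
  have h3 : 0 < max y (1 / ((n : ℝ) + 1)) := h1.trans_le h2
  rw [cutDrift, abs_of_nonneg (by positivity), div_le_iff₀ (by positivity)]
  have h4 : ((n : ℝ) + 1) * (1 / (n + 1)) = 1 := by field_simp
  have h5 : ((n : ℝ) + 1) * (1 / (n + 1)) ≤ (n + 1) * max y (1 / (n + 1)) := by gcongr
  linarith

theorem lipschitzWith_cutDrift (n : ℕ) : LipschitzWith ((n + 1) ^ 2) (cutDrift n) := by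
  refine LipschitzWith.of_dist_le_mul fun x y => ?_
  have h1 : 0 < 1 / ((n : ℝ) + 1) := by positivity
  have hx := le_max_right x (1 / ((n : ℝ) + 1))
  have hy := le_max_right y (1 / ((n : ℝ) + 1))
  have hab := abs_max_sub_max_le_abs x y (1 / ((n : ℝ) + 1))
  simp only [Real.dist_eq, cutDrift]
  set a := max x (1 / ((n : ℝ) + 1))
  set b := max y (1 / ((n : ℝ) + 1))
  have ha : 0 < a := h1.trans_le hx
  have hb : 0 < b := h1.trans_le hy
  have e : 1 / (2 * a) - 1 / (2 * b) = (b - a) / (2 * a * b) := by field_simp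
  rw [e, abs_div, abs_of_pos (by positivity : 0 < 2 * a * b), abs_sub_comm,
    div_le_iff₀ (by positivity)]
  have h4 : 1 ≤ ((n : ℝ) + 1) * a := by
    calc (1 : ℝ) = (n + 1) * (1 / (n + 1)) := by field_simp
      _ ≤ _ := by gcongr
  have h5 : 1 ≤ ((n : ℝ) + 1) * b := by
    calc (1 : ℝ) = (n + 1) * (1 / (n + 1)) := by field_simp
      _ ≤ _ := by gcongr
  push_cast
  calc |a - b| ≤ |x - y| * 1 := by rw [mul_one]; exact hab
    _ ≤ |x - y| * (2 * ((((n : ℝ) + 1) * a) * ((n + 1) * b))) := by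
        gcongr; nlinarith
    _ = _ := by ring

/-- The solution of `α' = cutDrift n (w - α)`, `α 0 = 0`, as a functional of the path `w`. -/
noncomputable def pathDrift (n : ℕ) (w : ℝ≥0 → ℝ) (t : ℝ≥0) : ℝ :=
  limsup (fun N : ℕ => euler (cutDrift n) (t / (N + 1)) w (N + 1)) atTop

theorem measurable_pathDrift (n : ℕ) (t : ℝ≥0) : Measurable fun w => pathDrift n w t :=
  Measurable.limsup fun _ => measurable_euler (lipschitzWith_cutDrift n).continuous.measurable _ _

theorem pathDrift_stopAt (n : ℕ) (w : ℝ≥0 → ℝ) (hst : s ≤ t) :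
    pathDrift n (stopAt t w) s = pathDrift n w s := by
  unfold pathDrift
  congr 1; ext N
  refine euler_stopAt _ _ _ ?_
  push_cast
  rwa [mul_div_cancel₀ s (by positivity)]

theorem IsDrift.pathDrift_eq (h : IsDrift (cutDrift n) w α T) (hw : Continuous w) :
    pathDrift n w T = α T :=
  (h.tendsto_euler hw (lipschitzWith_cutDrift n) (abs_cutDrift_le n)).limsup_eq

theorem isDrift_pathDrift (hw : Continuous w) (n : ℕ) (T : ℝ≥0) :
    IsDrift (cutDrift n) w (pathDrift n w) T := by
  obtain ⟨α, hα⟩ := exists_isDrift hw (lipschitzWith_cutDrift n) (abs_cutDrift_le n) T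
  exact hα.congr (fun v hv => (hα.mono hv).pathDrift_eq hw) fun _ _ => rfl

theorem pathDrift_zero (hw : Continuous w) (n : ℕ) : pathDrift n w 0 = 0 :=
  (isDrift_pathDrift hw n 0).zero

theorem continuous_pathDrift (hw : Continuous w) (n : ℕ) : Continuous (pathDrift n w) := by
  have hle : ∀ s t, s ≤ t → dist (pathDrift n w t) (pathDrift n w s) ≤ ((n : ℝ≥0) + 1 : ℝ≥0) *
      dist t s := fun s t hst => by
    have h1 : (s : ℝ) ≤ t := by exact_mod_cast hst
    rw [Real.dist_eq, NNReal.dist_eq, abs_of_nonneg (sub_nonneg.2 h1)]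
    push_cast
    exact (isDrift_pathDrift hw n t).abs_sub_le (abs_cutDrift_le n) hst le_rfl
  refine LipschitzWith.continuous (K := (n : ℝ≥0) + 1) (LipschitzWith.of_dist_le_mul fun s t => ?_)
  rcases le_total s t with h | h
  · rw [dist_comm, dist_comm s]; exact hle s t h
  · exact hle t s h

/-- As long as it stays above the cut-off level, a solution with the drift `1 / (2 y)` is the
solution with the cut-off drift. -/
theorem IsDrift.pathDrift_eq_of_le (h : IsDrift (fun y => 1 / (2 * y)) w α T) (hw : Continuous w)
    (hle : ∀ v ≤ T, 1 / ((n : ℝ) + 1) ≤ w v - α v) : pathDrift n w T = α T :=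
  (h.congr (fun _ _ => rfl) fun v hv => cutDrift_of_le (hle v hv)).pathDrift_eq hw

/-- Before the time `t` the path `w - pathDrift n w` stays above its cut-off level, for some
`n`. -/
def IsAlive (w : ℝ≥0 → ℝ) (t : ℝ≥0) : Prop :=
  ∃ n : ℕ, (t : ℝ≥0∞) < hitTime fun s => w s - pathDrift n w s - 1 / (n + 1)

theorem lt_hitTime_pathDrift_iff (hw : Continuous w) :
    ((t : ℝ≥0∞) < hitTime fun s => w s - pathDrift n w s - 1 / (n + 1)) ↔
      ∀ s ≤ t, 1 / ((n : ℝ) + 1) < w s - pathDrift n w s := by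
  have hc : Continuous fun s => w s - pathDrift n w s - 1 / ((n : ℝ) + 1) :=
    (hw.sub (continuous_pathDrift hw n)).sub continuous_const
  rw [lt_hitTime_iff hc]
  simp only [sub_pos]

theorem isAlive_iff (hw : Continuous w) :
    IsAlive w t ↔ ∃ n : ℕ, ∀ s ≤ t, 1 / ((n : ℝ) + 1) < w s - pathDrift n w s :=
  exists_congr fun _ => lt_hitTime_pathDrift_iff hw

theorem IsAlive.mono (h : IsAlive w t) (hst : s ≤ t) : IsAlive w s := by
  obtain ⟨n, hn⟩ := h
  exact ⟨n, lt_of_le_of_lt (by exact_mod_cast hst) hn⟩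

theorem measurableSet_isAlive (t : ℝ≥0) : MeasurableSet {w | IsAlive w t} := by
  simp only [IsAlive, Set.ofPred_exists]
  refine MeasurableSet.iUnion fun n => measurableSet_lt measurable_const
    (measurable_hitTime.comp (measurable_pi_lambda _ fun s => ?_))
  exact ((measurable_pi_apply s).sub (measurable_pathDrift n s)).sub_const _

theorem isAlive_stopAt (hw : Continuous w) (hst : s ≤ t) :
    IsAlive (stopAt t w) s ↔ IsAlive w s := by
  rw [isAlive_iff hw, isAlive_iff (continuous_stopAt hw t)]
  refine exists_congr fun n => forall₂_congr fun u hu => ?_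
  rw [stopAt_of_le (hu.trans hst), pathDrift_stopAt n w (hu.trans hst)]

open Classical in
/-- The solution of `dr = dw - 1 / (2 r) dt`, `r 0 = w 0`, absorbed when it reaches zero. -/
noncomputable def radius (w : ℝ≥0 → ℝ) (t : ℝ≥0) : ℝ :=
  if IsAlive w t then w t - limsup (fun n => pathDrift n w t) atTop else 0

theorem measurable_radius (t : ℝ≥0) : Measurable fun w => radius w t := by
  refine Measurable.ite (measurableSet_isAlive t) ?_ measurable_const
  exact (measurable_pi_apply t).sub (Measurable.limsup fun n => measurable_pathDrift n t)

theorem radius_stopAt (hw : Continuous w) (t : ℝ≥0) : radius (stopAt t w) t = radius w t := by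
  have e : (fun n => pathDrift n (stopAt t w) t) = fun n => pathDrift n w t :=
    funext fun n => pathDrift_stopAt n w le_rfl
  by_cases h : IsAlive w t
  · rw [radius, radius, if_pos h, if_pos ((isAlive_stopAt hw le_rfl).2 h), e,
      stopAt_of_le le_rfl]
  · rw [radius, radius, if_neg h, if_neg (mt (isAlive_stopAt hw le_rfl).1 h)]

theorem radius_of_not_isAlive (h : ¬ IsAlive w t) : radius w t = 0 := if_neg h

theorem isDrift_of_forall_lt (hw : Continuous w)
    (h : ∀ s ≤ t, 1 / ((n : ℝ) + 1) < w s - pathDrift n w s) :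
    IsDrift (fun y => 1 / (2 * y)) w (pathDrift n w) t :=
  (isDrift_pathDrift hw n t).congr (fun _ _ => rfl) fun v hv => (cutDrift_of_le (h v hv).le).symm

theorem radius_of_forall_lt (hw : Continuous w)
    (h : ∀ s ≤ t, 1 / ((n : ℝ) + 1) < w s - pathDrift n w s) :
    radius w t = w t - pathDrift n w t := by
  rw [radius, if_pos ((isAlive_iff hw).2 ⟨n, h⟩)]
  congr 1
  refine Tendsto.limsup_eq (tendsto_const_nhds.congr' ?_)
  filter_upwards [eventually_ge_atTop n] with m hm
  refine ((isDrift_of_forall_lt hw h).pathDrift_eq_of_le hw fun v hv => le_trans ?_ (h v hv).le).symm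
  gcongr

theorem IsAlive.exists_lt_radius (h : IsAlive w t) (hw : Continuous w) :
    ∃ n : ℕ, ∀ s ≤ t, 1 / ((n : ℝ) + 1) < radius w s := by
  obtain ⟨n, hn⟩ := (isAlive_iff hw).1 h
  refine ⟨n, fun s hs => ?_⟩
  rw [radius_of_forall_lt hw fun v hv => hn v (hv.trans hs)]
  exact hn s hs

theorem IsAlive.isDrift (h : IsAlive w t) (hw : Continuous w) :
    IsDrift (fun y => 1 / (2 * y)) w (fun s => w s - radius w s) t := by
  obtain ⟨n, hn⟩ := (isAlive_iff hw).1 h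
  refine (isDrift_of_forall_lt hw hn).congr (fun v hv => ?_) fun _ _ => rfl
  rw [radius_of_forall_lt hw fun u hu => hn u (hu.trans hv), sub_sub_cancel]

theorem radius_pos_iff (hw : Continuous w) : 0 < radius w t ↔ IsAlive w t := by
  refine ⟨fun h => ?_, fun h => ?_⟩
  · by_contra hc
    rw [radius_of_not_isAlive hc] at h
    exact h.false
  · obtain ⟨n, hn⟩ := h.exists_lt_radius hw
    exact lt_trans (by positivity) (hn t le_rfl)

theorem radius_nonneg (hw : Continuous w) (t : ℝ≥0) : 0 ≤ radius w t := by
  by_cases h : IsAlive w t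
  · exact ((radius_pos_iff hw).2 h).le
  · exact (radius_of_not_isAlive h).ge

theorem radius_zero (hw : Continuous w) (h0 : 0 < w 0) : radius w 0 = w 0 := by
  obtain ⟨n, hn⟩ := exists_nat_one_div_lt h0
  have h : ∀ s ≤ (0 : ℝ≥0), 1 / ((n : ℝ) + 1) < w s - pathDrift n w s := by
    intro s hs
    rwa [le_antisymm hs zero_le, pathDrift_zero hw, sub_zero]
  rw [radius_of_forall_lt hw h, pathDrift_zero hw, sub_zero]

theorem IsAlive.sub_radius_le (h : IsAlive w t) (hw : Continuous w) (hst : s ≤ t) :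
    w s - radius w s ≤ w t - radius w t := by
  refine (h.isDrift hw).le_of_nonneg (fun v hv => ?_) hst le_rfl
  rw [sub_sub_cancel]
  have := radius_nonneg hw v
  positivity

/-- If the path were bounded away from zero before its absorption, it would survive. -/
theorem isAlive_of_forall_le (hw : Continuous w) (ht : 0 < t) {c : ℝ} (hc : 0 < c)
    (h : ∀ s < t, IsAlive w s ∧ c ≤ radius w s) : IsAlive w t := by
  obtain ⟨m, hm⟩ := exists_nat_one_div_lt hc
  have heq : ∀ s < t, c ≤ w s - pathDrift m w s := fun s hs => by
    have := ((h s hs).1.isDrift hw).pathDrift_eq_of_le (n := m) hw fun v hv => by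
      rw [sub_sub_cancel]
      exact hm.le.trans (h v (hv.trans_lt hs)).2
    rw [this, sub_sub_cancel]
    exact (h s hs).2
  have hne : (𝓝[<] t).NeBot := nhdsLT_neBot_of_exists_lt ⟨0, ht⟩
  have hlast : c ≤ w t - pathDrift m w t := by
    have hcont : Continuous fun s => w s - pathDrift m w s := hw.sub (continuous_pathDrift hw m)
    refine ge_of_tendsto ((hcont.tendsto t).mono_left (nhdsWithin_le_nhds (s := Set.Iio t))) ?_
    exact eventually_nhdsWithin_of_forall heq
  refine (isAlive_iff hw).2 ⟨m, fun s hs => hm.trans_le ?_⟩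
  rcases hs.eq_or_lt with rfl | hs
  exacts [hlast, heq s hs]

theorem continuous_radius (hw : Continuous w) : Continuous (radius w) := by
  rw [continuous_iff_continuousAt]
  intro t
  by_cases ht : IsAlive w t
  · obtain ⟨n, hn⟩ := ht
    have hev : ∀ᶠ s : ℝ≥0 in 𝓝 t,
        (s : ℝ≥0∞) < hitTime fun s => w s - pathDrift n w s - 1 / (n + 1) :=
      (ENNReal.continuous_coe.tendsto t).eventually (gt_mem_nhds hn)
    refine ((hw.sub (continuous_pathDrift hw n)).continuousAt).congr ?_
    filter_upwards [hev] with s hs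
    exact (radius_of_forall_lt hw ((lt_hitTime_pathDrift_iff hw).1 hs)).symm
  rw [ContinuousAt, radius_of_not_isAlive ht]
  by_cases hex : ∃ s < t, ¬ IsAlive w s
  · obtain ⟨s, hs, hs'⟩ := hex
    refine tendsto_const_nhds.congr' ?_
    filter_upwards [lt_mem_nhds hs] with u hu
    exact (radius_of_not_isAlive fun hc => hs' (hc.mono hu.le)).symm
  push Not at hex
  rcases eq_zero_or_pos t with rfl | ht0
  · refine tendsto_const_nhds.congr fun u => ?_
    exact (radius_of_not_isAlive fun hc => ht (hc.mono zero_le)).symm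
  -- the compensator is monotone and bounded, so that the path has a limit
  rw [Metric.tendsto_nhds]
  intro ε hε
  obtain ⟨C, hC⟩ := isCompact_Icc.bddAbove_image (hw.continuousOn (s := Set.Icc 0 t))
  have hC' : ∀ s < t, w s - radius w s ≤ C := fun s hs => by
    have := hC ⟨s, ⟨zero_le, hs.le⟩, rfl⟩
    linarith [radius_nonneg hw s]
  have hbdd : BddAbove ((fun s => w s - radius w s) '' Set.Iio t) := ⟨C, by
    rintro _ ⟨s, hs, rfl⟩; exact hC' s hs⟩
  obtain ⟨_, ⟨s₁, hs₁, rfl⟩, hlt⟩ := exists_lt_of_lt_csSup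
    (Set.Nonempty.image (fun s => w s - radius w s) (s := Set.Iio t) ⟨0, ht0⟩) (sub_lt_self _ (by positivity : 0 < ε / 8))
  have hosc : ∀ᶠ s in 𝓝 t, |w s - w t| < ε / 8 :=
    hw.continuousAt.eventually (Metric.ball_mem_nhds _ (by positivity))
  obtain ⟨s₂, hs₂, hs₂'⟩ := (mem_nhdsLE_iff_exists_Ioc_subset' ht0).1
    (mem_nhdsWithin_of_mem_nhds hosc)
  have hs₃ : max s₁ s₂ < t := max_lt hs₁ hs₂
  filter_upwards [lt_mem_nhds hs₃] with s hs
  rw [Real.dist_eq, sub_zero, abs_of_nonneg (radius_nonneg hw s)]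
  rcases le_or_gt t s with hts | hts
  · rwa [radius_of_not_isAlive fun hc => ht (hc.mono hts)]
  by_contra! hge
  refine ht ?_
  obtain ⟨n, hn⟩ := (hex s hts).exists_lt_radius hw
  refine isAlive_of_forall_le hw ht0 (c := min (1 / ((n : ℝ) + 1)) (ε / 2)) (by positivity)
    fun u hu => ⟨hex u hu, ?_⟩
  rcases le_total u s with hus | hus
  · exact (min_le_left _ _).trans (hn u hus).le
  · refine (min_le_right _ _).trans ?_
    have h1 : w u - radius w u ≤ _ := le_csSup hbdd ⟨u, hu, rfl⟩
    have h2 := (hex s hts).sub_radius_le hw ((le_max_left s₁ s₂).trans hs.le)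
    have h3 : |w u - w t| < ε / 8 := hs₂' ⟨((le_max_right s₁ s₂).trans_lt hs).trans_le hus, hu.le⟩
    have h4 : |w s - w t| < ε / 8 := hs₂' ⟨(le_max_right s₁ s₂).trans_lt hs, hts.le⟩
    rw [abs_lt] at h3 h4
    linarith

end Radial

end StratFeller

namespace StratFeller

/-! ### Squares of absorbed radial paths solve the Itô equation -/

section Cell

variable {w : ℝ≥0 → ℝ} {a b : ℝ≥0} {δ : ℝ}

open Classical in
/-- `1` before absorption and `0` afterwards. -/
noncomputable def alive (w : ℝ≥0 → ℝ) (t : ℝ≥0) : ℝ := if IsAlive w t then 1 else 0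

theorem measurable_alive (t : ℝ≥0) : Measurable fun w => alive w t :=
  Measurable.ite (measurableSet_isAlive t) measurable_const measurable_const

theorem alive_stopAt (hw : Continuous w) (t : ℝ≥0) : alive (stopAt t w) t = alive w t := by
  by_cases h : IsAlive w t
  · rw [alive, alive, if_pos h, if_pos ((isAlive_stopAt hw le_rfl).2 h)]
  · rw [alive, alive, if_neg h, if_neg (mt (isAlive_stopAt hw le_rfl).1 h)]

theorem abs_alive_le (w : ℝ≥0 → ℝ) (t : ℝ≥0) : |alive w t| ≤ 1 := by
  unfold alive; split_ifs <;> simp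

open Classical in
/-- A clock that controls the errors of the Riemann sums: the compensator `w - radius w` before
absorption, and a jump at absorption (`C` is a bound for the path). -/
noncomputable def absorptionClock (C : ℝ) (w : ℝ≥0 → ℝ) (t : ℝ≥0) : ℝ :=
  if IsAlive w t then w t - radius w t else C + 1

theorem abs_ito_cell_le (hw : Continuous w) (hab : a ≤ b) (hδ1 : δ ≤ 1)
    (hstep : (b : ℝ) - a ≤ δ) {C : ℝ} (hC : w a ≤ C)
    (hosc : ∀ u ∈ Set.Icc a b, ∀ v ∈ Set.Icc a b, |w u - w v| ≤ δ)
    (hosc' : ∀ u ∈ Set.Icc a b, ∀ v ∈ Set.Icc a b, |radius w u - radius w v| ≤ δ) :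
    |radius w a * (w b - w a) - (radius w b ^ 2 / 2 - radius w a ^ 2 / 2) +
      1 / 2 * (alive w a * ((w b - w a) ^ 2 - (b - a)))| ≤
      3 * δ * (absorptionClock C w b - absorptionClock C w a) := by
  have hab' : (a : ℝ) ≤ b := by exact_mod_cast hab
  have ha : a ∈ Set.Icc a b := ⟨le_rfl, hab⟩
  have hb : b ∈ Set.Icc a b := ⟨hab, le_rfl⟩
  have hδ0 : 0 ≤ δ := (abs_nonneg _).trans (hosc a ha a ha)
  have hW := abs_le.1 (hosc b hb a ha)
  have hR := abs_le.1 (hosc' b hb a ha)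
  have hra := radius_nonneg hw a
  by_cases hB : IsAlive w b
  · have hA := hB.mono hab
    rw [absorptionClock, absorptionClock, if_pos hA, if_pos hB, alive, if_pos hA, one_mul]
    have hD := hB.isDrift hw
    set V := w b - radius w b - (w a - radius w a) with hV
    have hV0 : 0 ≤ V := sub_nonneg.2 (hB.sub_radius_le hw hab)
    have hVδ : V ≤ 2 * δ := by linarith
    have hpos : ∀ v ∈ Set.Icc a b, 0 < radius w v := fun v hv =>
      (radius_pos_iff hw).2 (hB.mono hv.2)
    -- `2 r dA = dt`, up to the oscillation of `r`
    have hlo : (b : ℝ) - a ≤ 2 * radius w a * V + 2 * δ * V := by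
      have h1 := hD.le_sub a b hab le_rfl (1 / (2 * (radius w a + δ))) fun v hv => by
        rw [sub_sub_cancel]
        have h2 := (abs_le.1 (hosc' v hv a ha)).2
        exact one_div_le_one_div_of_le (by have := hpos v hv; positivity) (by linarith)
      have h3 : 0 < radius w a + δ := by have := hpos a ha; positivity
      rw [← hV, div_mul_eq_mul_div, one_mul, div_le_iff₀ (by positivity)] at h1
      linarith
    have hhi : 2 * radius w a * V ≤ (b - a) + 2 * δ * V := by
      rcases le_or_gt (radius w a) δ with hle | hgt
      · have : radius w a * V ≤ δ * V := by gcongr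
        linarith
      · have h1 := hD.sub_le a b hab le_rfl (1 / (2 * (radius w a - δ))) fun v hv => by
          rw [sub_sub_cancel]
          have h2 := (abs_le.1 (hosc' v hv a ha)).1
          exact one_div_le_one_div_of_le (by linarith) (by linarith)
        rw [← hV, div_mul_eq_mul_div, one_mul, le_div_iff₀ (by linarith)] at h1
        linarith
    have e : radius w a * (w b - w a) - (radius w b ^ 2 / 2 - radius w a ^ 2 / 2) +
        1 / 2 * ((w b - w a) ^ 2 - ((b : ℝ) - a)) =
        (2 * radius w a * V - (b - a)) / 2 + (w b - w a) * V - V * V / 2 := by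
      rw [hV]; ring
    rw [e, abs_le]
    have h5 : (w b - w a) * V ≤ δ * V := by gcongr; exact hW.2
    have h6 : -δ * V ≤ (w b - w a) * V := by gcongr; exact hW.1
    have h7 : V * V ≤ 2 * δ * V := by gcongr
    have h8 : 0 ≤ V * V := by positivity
    constructor <;> linarith
  have hrb : radius w b = 0 := radius_of_not_isAlive hB
  by_cases hA : IsAlive w a
  · rw [absorptionClock, absorptionClock, if_neg hB, if_pos hA, alive, if_pos hA, one_mul, hrb]
    rw [hrb] at hR
    have h1 : 1 ≤ C + 1 - (w a - radius w a) := by linarith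
    have h2 : 3 * δ * 1 ≤ 3 * δ * (C + 1 - (w a - radius w a)) := by gcongr
    refine le_trans ?_ h2
    have h3 : |radius w a * (w b - w a)| ≤ δ * 1 := by
      rw [abs_mul, abs_of_nonneg hra]
      exact mul_le_mul (by linarith) ((hosc b hb a ha).trans hδ1) (abs_nonneg _) hδ0
    have h4 : radius w a ^ 2 ≤ δ * 1 := by
      rw [sq]; exact mul_le_mul (by linarith) (by linarith) hra hδ0
    have h5 : (w b - w a) ^ 2 ≤ δ * 1 := by
      rw [← sq_abs, sq]
      exact mul_le_mul (hosc b hb a ha) ((hosc b hb a ha).trans hδ1) (abs_nonneg _) hδ0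
    have h6 := abs_le.1 h3
    rw [abs_le]
    constructor <;> nlinarith [sq_nonneg (w b - w a), sq_nonneg (radius w a)]
  · rw [absorptionClock, absorptionClock, if_neg hB, if_neg hA, alive, if_neg hA, hrb,
      radius_of_not_isAlive hA]
    simp

end Cell

section Ito

variable {Ω : Type*} {mΩ : MeasurableSpace Ω} {P : Measure Ω} {F : Filtration ℝ≥0 mΩ}
  {W : ℝ≥0 → Ω → ℝ}

/-- Half the square of the radial path driven by `W` and started from `√(2 x₀)`. -/
noncomputable def itoSolution (x₀ : ℝ) (W : ℝ≥0 → Ω → ℝ) (t : ℝ≥0) (ω : Ω) : ℝ :=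
  radius (startedAt (√(2 * x₀)) W ω) t ^ 2 / 2

theorem isItoSolution_itoSolution [IsProbabilityMeasure P] (hW : IsBrownianWrt F P W)
    {x₀ : ℝ} (hx₀ : 0 < x₀) : IsItoSolution F P W x₀ (itoSolution x₀ W) := by
  set c := √(2 * x₀) with hc
  have hc0 : 0 < c := Real.sqrt_pos.2 (by positivity)
  have hXm : ∀ t, Measurable fun ω => radius (startedAt c W ω) t := fun t =>
    (measurable_radius t).comp (hW.measurable_startedAt c)
  refine { adapted := ?_, continuous := ?_, nonneg := ?_, init := ?_, eqn := ?_ }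
  · intro t
    refine hW.adapted_of_stopAt (Φ := fun w => radius w t ^ 2 / 2)
      (((measurable_radius t).pow_const 2).div_const 2) fun w hw _ => ?_
    rw [radius_stopAt hw]
  · filter_upwards [hW.ae_continuous c] with ω hω
    exact ((continuous_radius hω.1).pow 2).div_const 2
  · exact Eventually.of_forall fun ω t => by unfold itoSolution; positivity
  · filter_upwards [hW.ae_continuous c] with ω hω
    rw [itoSolution, radius_zero hω.1 (hω.2.symm ▸ hc0), hω.2, Real.sq_sqrt (by positivity)]
    ring
  · intro u
    have hM := fun p : TimePartition u => hW.sum_increment_sq p.mono (C := 1)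
      (φ := fun i ω => alive (startedAt c W ω) (p.pt i))
      (fun i => hW.adapted_of_stopAt (measurable_alive _) fun w hw _ => alive_stopAt hw _)
      (fun i ω => abs_alive_le _ _) p.n
    refine tendstoInMeasure_diamToZero
      (M := fun p ω => -(1 / 2) * ∑ i ∈ Finset.range p.n, alive (startedAt c W ω) (p.pt i) *
        ((W (p.pt (i + 1)) ω - W (p.pt i) ω) ^ 2 - (p.pt (i + 1) - p.pt i)))
      (K := 1 / 4 * ((∫ x, (x ^ 2 - 1) ^ 2 ∂(gaussianReal 0 1)) * u))
      (fun p => ?_) ?_ (fun p => (hM p).1.const_mul _) (fun p => ?_) ?_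
    · refine Measurable.aestronglyMeasurable (Finset.measurable_sum _ fun i _ => ?_)
      exact ((((hXm _).pow_const 2).div_const 2).const_mul 2).sqrt.mul
        ((hW.measurable _).sub (hW.measurable _))
    · exact ((((hXm _).pow_const 2).div_const 2).sub_const _).aestronglyMeasurable
    · simp only [mul_pow, integral_const_mul]
      have h1 := (hM p).2
      have h2 : (∫ x, (x ^ 2 - 1) ^ 2 ∂(gaussianReal 0 1)) * _ ≤ _ :=
        mul_le_mul_of_nonneg_left p.sum_step_sq_le (integral_nonneg fun x => sq_nonneg (x ^ 2 - 1))
      rw [one_pow, one_mul] at h1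
      calc _ ≤ (-(1 / 2)) ^ 2 * _ := mul_le_mul_of_nonneg_left (h1.trans h2) (by positivity)
        _ = _ := by ring
    · filter_upwards [hW.ae_continuous c] with ω hω
      obtain ⟨hwc, hw0⟩ := hω
      set w := startedAt c W ω with hw
      have h0 : 0 < w 0 := hw0.symm ▸ hc0
      obtain ⟨C, hC⟩ := isCompact_Icc.bddAbove_image (hwc.continuousOn (s := Set.Icc 0 u))
      have hC' : ∀ s ≤ u, w s ≤ C := fun s hs => hC ⟨s, ⟨zero_le, hs⟩, rfl⟩
      set V := absorptionClock C w u - absorptionClock C w 0 with hV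
      rw [Metric.tendsto_nhds]
      intro ε hε
      obtain ⟨δ, hδ0, hδ1, hδ⟩ : ∃ δ : ℝ, 0 < δ ∧ δ ≤ 1 ∧ 3 * δ * V < ε := by
        refine ⟨min 1 (ε / (3 * (|V| + 1)) / 2), by positivity, min_le_left _ _, ?_⟩
        have h1 := min_le_right 1 (ε / (3 * (|V| + 1)) / 2)
        set δ := min 1 (ε / (3 * (|V| + 1)) / 2)
        have h2 : δ * (2 * (3 * (|V| + 1))) ≤ ε := by
          calc _ ≤ ε / (3 * (|V| + 1)) / 2 * (2 * (3 * (|V| + 1))) := by gcongr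
            _ = ε := by field_simp
        have h3 : 0 < δ := by positivity
        nlinarith [le_abs_self V, abs_nonneg V]
      have hdiam : ∀ᶠ p : TimePartition u in diamToZero u, (p.diam : ℝ) < δ := by
        have h1 : Tendsto (fun p : TimePartition u => (p.diam : ℝ)) (diamToZero u) (𝓝 0) :=
          NNReal.tendsto_coe.2 tendsto_comap
        exact h1.eventually (gt_mem_nhds hδ0)
      filter_upwards [eventually_osc_le hwc u hδ0, eventually_osc_le (continuous_radius hwc) u hδ0,
        hdiam] with p hp hp' hpd
      have hcell : ∀ i ∈ Finset.range p.n, _ := fun i hi =>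
        abs_ito_cell_le hwc (p.mono i.le_succ) hδ1 (by
          have h1 := p.step_le_diam (Finset.mem_range.1 hi)
          have h2 : ((p.pt (i + 1) - p.pt i : ℝ≥0) : ℝ) ≤ p.diam := by exact_mod_cast h1
          rw [NNReal.coe_sub (p.mono i.le_succ)] at h2
          exact h2.trans hpd.le) (hC' _ (p.pt_le (Finset.mem_range.1 hi).le))
          (hp i (Finset.mem_range.1 hi)) (hp' i (Finset.mem_range.1 hi))
      have hsum := (Finset.abs_sum_le_sum_abs _ _).trans (Finset.sum_le_sum hcell)
      rw [← Finset.mul_sum, Finset.sum_range_sub (fun i => absorptionClock C w (p.pt i)), p.pt_last,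
        p.pt_zero, ← hV] at hsum
      have htel : ∑ i ∈ Finset.range p.n,
          (radius w (p.pt (i + 1)) ^ 2 / 2 - radius w (p.pt i) ^ 2 / 2) =
          radius w u ^ 2 / 2 - x₀ := by
        rw [Finset.sum_range_sub (fun i => radius w (p.pt i) ^ 2 / 2), p.pt_last, p.pt_zero,
          radius_zero hwc h0, hw0, hc, Real.sq_sqrt (by positivity)]
        ring
      have hdiff : ∀ s s', w s - w s' = W s ω - W s' ω := fun s s' => by
        simp [hw, startedAt]
      have hsq : ∀ s, √(2 * (radius w s ^ 2 / 2)) = radius w s := fun s => by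
        rw [mul_div_cancel₀ _ two_ne_zero, Real.sqrt_sq (radius_nonneg hwc s)]
      simp only [Finset.sum_add_distrib, Finset.sum_sub_distrib, hdiff, ← Finset.mul_sum]
        at hsum htel
      simp only [itoSum, itoSolution, ← hw, ← hc, hsq, Real.dist_eq, sub_zero]
      rw [htel] at hsum
      rw [neg_mul, sub_neg_eq_add]
      exact hsum.trans_lt hδ

end Ito

end StratFeller

namespace StratFeller

/-! ### Second moment estimates for Itô integrals -/

section Moment

variable {Ω : Type*} {mΩ : MeasurableSpace Ω} {P : Measure Ω} {F : Filtration ℝ≥0 mΩ}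
  {W : ℝ≥0 → Ω → ℝ}

/-- Fatou's lemma for second moments. -/
theorem memLp_two_of_ae_tendsto [IsFiniteMeasure P] {f : ℕ → Ω → ℝ} {g : Ω → ℝ} {b : ℝ}
    (hf : ∀ n, MemLp (f n) 2 P) (hb : ∀ n, ∫ ω, f n ω ^ 2 ∂P ≤ b)
    (h : ∀ᵐ ω ∂P, Tendsto (fun n => f n ω) atTop (𝓝 (g ω))) :
    MemLp g 2 P ∧ ∫ ω, g ω ^ 2 ∂P ≤ b := by
  have hgm : AEStronglyMeasurable g P := aestronglyMeasurable_of_tendsto_ae _ (fun n => (hf n).1) h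
  have hle : ∀ n, eLpNorm (f n) 2 P ≤ ENNReal.ofReal (√b) := fun n => by
    rw [(hf n).eLpNorm_eq_integral_rpow_norm two_ne_zero (by simp)]
    refine ENNReal.ofReal_le_ofReal ?_
    simpa [Real.sqrt_eq_rpow] using Real.sqrt_le_sqrt (hb n)
  have hg : eLpNorm g 2 P ≤ ENNReal.ofReal (√b) :=
    Lp.eLpNorm_le_of_ae_tendsto (Eventually.of_forall hle) (fun n => (hf n).1) h
  have hgL : MemLp g 2 P := ⟨hgm, hg.trans_lt ENNReal.ofReal_lt_top⟩
  refine ⟨hgL, ?_⟩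
  have hb0 : 0 ≤ b := (integral_nonneg fun ω => sq_nonneg (f 0 ω)).trans (hb 0)
  rw [hgL.eLpNorm_eq_integral_rpow_norm two_ne_zero (by simp),
    ENNReal.ofReal_le_ofReal_iff (Real.sqrt_nonneg b)] at hg
  have h2 : √(∫ ω, g ω ^ 2 ∂P) ≤ √b := by simpa [Real.sqrt_eq_rpow] using hg
  exact (Real.sqrt_le_sqrt_iff hb0).1 h2

/-- A discrete form of Gronwall's inequality, for a bounded function that is not known to be
measurable. -/
theorem le_exp_of_forall_sum_le {u : ℝ≥0 → ℝ} {a B C : ℝ} (ha : 0 ≤ a) (hC : 0 ≤ C)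
    (hB : ∀ t, u t ≤ B)
    (h : ∀ t b, (∀ N, a + C * ∑ i ∈ Finset.range (N + 1), u ((TimePartition.uniform t N).pt i) *
      ((TimePartition.uniform t N).pt (i + 1) - (TimePartition.uniform t N).pt i) ≤ b) → u t ≤ b)
    (t : ℝ≥0) : u t ≤ a * Real.exp (C * t) := by
  have key : ∀ n : ℕ, ∀ t : ℝ≥0, u t ≤ a * Real.exp (C * t) + |B| * ((C * t) ^ n / n.factorial) := by
    intro n
    induction n with
    | zero =>
      intro t
      have : 0 ≤ a * Real.exp (C * t) := by positivity
      simp only [pow_zero, Nat.factorial_zero, Nat.cast_one, div_one, mul_one]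
      linarith [hB t, le_abs_self B]
    | succ n ih =>
      intro t
      refine h t _ fun N => ?_
      set p := TimePartition.uniform t N with hp
      set ψ : ℝ → ℝ := fun x => a * Real.exp (C * x) + |B| * ((C * x) ^ (n + 1) / (n + 1).factorial)
        with hψ
      have hn : ((n + 1).factorial : ℝ) = (n + 1) * n.factorial := by
        rw [Nat.factorial_succ]; push_cast; ring
      have hcell : ∀ i, C * (u (p.pt i) * ((p.pt (i + 1) : ℝ) - p.pt i)) ≤
          ψ (p.pt (i + 1)) - ψ (p.pt i) := by
        intro i
        have hle : (p.pt i : ℝ) ≤ p.pt (i + 1) := by exact_mod_cast p.mono i.le_succ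
        set x : ℝ := NNReal.toReal (p.pt i)
        set y : ℝ := NNReal.toReal (p.pt (i + 1))
        have hx : 0 ≤ x := (p.pt i).2
        have h1 : u (p.pt i) * (y - x) ≤
            (a * Real.exp (C * x) + |B| * ((C * x) ^ n / n.factorial)) * (y - x) :=
          mul_le_mul_of_nonneg_right (ih (p.pt i)) (by linarith)
        have h2 : Real.exp (C * x) * (C * (y - x)) ≤ Real.exp (C * y) - Real.exp (C * x) := by
          have h3 : Real.exp (C * y) = Real.exp (C * x) * Real.exp (C * (y - x)) := by
            rw [← Real.exp_add]; ring_nf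
          have h4 := Real.add_one_le_exp (C * (y - x))
          have h5 := Real.exp_pos (C * x)
          nlinarith
        have h6 : ((n : ℝ) + 1) * (C * x) ^ n * (C * (y - x)) ≤
            (C * y) ^ (n + 1) - (C * x) ^ (n + 1) := by
          have h7 := Commute.geom_sum₂_mul (Commute.all (C * y) (C * x)) (n + 1)
          rw [← h7, ← mul_sub]
          have h8 : 0 ≤ C * (y - x) := mul_nonneg hC (by linarith)
          refine mul_le_mul_of_nonneg_right ?_ h8
          have h9 : ∀ j ∈ Finset.range (n + 1), (C * x) ^ n ≤
              (C * y) ^ j * (C * x) ^ (n + 1 - 1 - j) := fun j hj => by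
            have hj' : j + (n + 1 - 1 - j) = n := by have := Finset.mem_range.1 hj; omega
            calc (C * x) ^ n = (C * x) ^ j * (C * x) ^ (n + 1 - 1 - j) := by
                  rw [← pow_add, hj']
              _ ≤ _ := by gcongr
          have h10 := Finset.sum_le_sum h9
          rw [Finset.sum_const, Finset.card_range, nsmul_eq_mul] at h10
          exact_mod_cast h10
        have h11 : |B| * (((n : ℝ) + 1) * (C * x) ^ n * (C * (y - x)) / (n + 1).factorial) ≤
            |B| * (((C * y) ^ (n + 1) - (C * x) ^ (n + 1)) / (n + 1).factorial) := by gcongr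
        have h12 : |B| * (((n : ℝ) + 1) * (C * x) ^ n * (C * (y - x)) / (n + 1).factorial) =
            C * (|B| * ((C * x) ^ n / n.factorial) * (y - x)) := by
          rw [hn]; field_simp
        have h13 := mul_le_mul_of_nonneg_left h2 ha
        have h14 := mul_le_mul_of_nonneg_left h1 hC
        rw [h12] at h11
        simp only [hψ]
        rw [sub_div] at h11
        linarith
      have hsum := Finset.sum_le_sum fun i (_ : i ∈ Finset.range (N + 1)) => hcell i
      have hlast : p.pt (N + 1) = t := p.pt_last
      rw [Finset.sum_range_sub (fun i => ψ (p.pt i)), ← Finset.mul_sum, p.pt_zero, hlast] at hsum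
      have h0 : ψ ((0 : ℝ≥0) : ℝ) = a := by simp [hψ]
      rw [h0] at hsum
      linarith
  have hlim : Tendsto (fun n : ℕ => a * Real.exp (C * t) + |B| * ((C * t) ^ n / n.factorial)) atTop
      (𝓝 (a * Real.exp (C * t) + |B| * 0)) :=
    tendsto_const_nhds.add ((FloorSemiring.tendsto_pow_div_factorial_atTop (C * t : ℝ)).const_mul _)
  rw [mul_zero, add_zero] at hlim
  exact ge_of_tendsto' hlim fun n => key n t

open Classical in
/-- The indicator of the event that `G` has not been negative up to time `t`, written with
countably many times. -/
noncomputable def stays (G : ℝ≥0 → Ω → ℝ) (t : ℝ≥0) (ω : Ω) : ℝ :=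
  if 0 ≤ G 0 ω ∧ ∀ m, dens m ≤ t → 0 ≤ G (dens m) ω then 1 else 0

section Stays

variable {G : ℝ≥0 → Ω → ℝ} {s t : ℝ≥0} {ω : Ω}

theorem stays_eq_zero_or_one (G : ℝ≥0 → Ω → ℝ) (t : ℝ≥0) (ω : Ω) :
    stays G t ω = 0 ∨ stays G t ω = 1 := by
  unfold stays; split_ifs <;> simp

theorem stays_eq_one (h : ∀ s ≤ t, 0 ≤ G s ω) : stays G t ω = 1 :=
  if_pos ⟨h 0 zero_le, fun _ hm => h _ hm⟩

theorem stays_mono (hst : s ≤ t) (h : stays G t ω = 1) : stays G s ω = 1 := by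
  have h1 : 0 ≤ G 0 ω ∧ ∀ m, dens m ≤ t → 0 ≤ G (dens m) ω := by
    by_contra hc
    rw [stays, if_neg hc] at h
    exact zero_ne_one h
  exact if_pos ⟨h1.1, fun m hm => h1.2 m (hm.trans hst)⟩

theorem nonneg_of_stays (hG : Continuous fun t => G t ω) (h : stays G t ω = 1) : 0 ≤ G t ω := by
  have h1 : 0 ≤ G 0 ω ∧ ∀ m, dens m ≤ t → 0 ≤ G (dens m) ω := by
    by_contra hc
    rw [stays, if_neg hc] at h
    exact zero_ne_one h
  by_contra! hneg
  rcases eq_zero_or_pos t with rfl | ht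
  · exact hneg.not_ge h1.1
  obtain ⟨l, hl, hl'⟩ := (mem_nhdsLE_iff_exists_Ioc_subset' ht).1
    (mem_nhdsWithin_of_mem_nhds (hG.continuousAt.eventually (gt_mem_nhds hneg)))
  obtain ⟨m, hm⟩ := exists_dens_mem (U := Set.Ioo l t) isOpen_Ioo (Set.nonempty_Ioo.2 hl)
  have h2 : G (dens m) ω < 0 := hl' ⟨hm.1, hm.2.le⟩
  exact h2.not_ge (h1.2 m hm.2.le)

theorem aestronglyMeasurable_stays (hG : ∀ t, AEStronglyMeasurable[F t] (G t) P) (t : ℝ≥0) :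
    AEStronglyMeasurable[F t] (stays G t) P := by
  classical
  refine ⟨fun ω => if 0 ≤ (hG 0).mk (G 0) ω ∧ ∀ m, dens m ≤ t →
    0 ≤ (hG (dens m)).mk (G (dens m)) ω then 1 else 0, ?_, ?_⟩
  · refine StronglyMeasurable.ite ?_ stronglyMeasurable_const stronglyMeasurable_const
    have hset : ∀ s ≤ t, MeasurableSet[F t] {ω | 0 ≤ (hG s).mk (G s) ω} := fun s hs =>
      (hG s).stronglyMeasurable_mk.measurable.mono (F.mono hs) le_rfl measurableSet_Ici
    have e : {ω | 0 ≤ (hG 0).mk (G 0) ω ∧ ∀ m, dens m ≤ t → 0 ≤ (hG (dens m)).mk (G (dens m)) ω} =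
        {ω | 0 ≤ (hG 0).mk (G 0) ω} ∩
          ⋂ (m) (_ : dens m ≤ t), {ω | 0 ≤ (hG (dens m)).mk (G (dens m)) ω} := by
      ext ω; simp
    rw [e]
    refine (hset 0 zero_le).inter ?_
    exact MeasurableSet.iInter fun m => MeasurableSet.iInter fun hm => hset _ hm
  · filter_upwards [(hG 0).ae_eq_mk, ae_all_iff.2 fun m => (hG (dens m)).ae_eq_mk] with ω h0 h
    simp only [stays, h0, h]

end Stays

/-- Truncation of a real number to `[-L, L]`. -/
noncomputable def clamp (L x : ℝ) : ℝ := max (-L) (min L x)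

theorem continuous_clamp (L : ℝ) : Continuous (clamp L) := by unfold clamp; fun_prop

theorem clamp_of_abs_le {L x : ℝ} (h : |x| ≤ L) : clamp L x = x := by
  rw [abs_le] at h
  rw [clamp, min_eq_right h.2, max_eq_right h.1]

theorem abs_clamp_le {L : ℝ} (hL : 0 ≤ L) (x : ℝ) : |clamp L x| ≤ L :=
  abs_le.2 ⟨le_max_left _ _, max_le (by linarith) (min_le_left _ _)⟩

theorem abs_clamp_le_abs {L : ℝ} (hL : 0 ≤ L) (x : ℝ) : |clamp L x| ≤ |x| := by
  rcases le_or_gt |x| L with h | h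
  · rw [clamp_of_abs_le h]
  · exact (abs_clamp_le hL x).trans h.le

/-- Along some sequence of uniform partitions, the Riemann sums of `f` converge almost surely
to `I`. -/
def HasSeqItoIntegral (P : Measure Ω) (W f : ℝ≥0 → Ω → ℝ) (t : ℝ≥0) (I : Ω → ℝ) : Prop :=
  ∃ ns : ℕ → ℕ, ∀ᵐ ω ∂P,
    Tendsto (fun k => itoSum W f (TimePartition.uniform t (ns k)) ω) atTop (𝓝 (I ω))

theorem HasItoIntegral.hasSeqItoIntegral {f : ℝ≥0 → Ω → ℝ} {t : ℝ≥0} {I : Ω → ℝ}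
    (h : HasItoIntegral P W f t I) : HasSeqItoIntegral P W f t I := by
  obtain ⟨ns, -, hns⟩ := (TendstoInMeasure.comp h
    (TimePartition.tendsto_uniform t)).exists_seq_tendsto_ae
  exact ⟨ns, hns⟩

theorem HasItoIntegral.sub_hasSeqItoIntegral {f g : ℝ≥0 → Ω → ℝ} {t : ℝ≥0} {I J : Ω → ℝ}
    (hf : HasItoIntegral P W f t I) (hg : HasItoIntegral P W g t J) :
    HasSeqItoIntegral P W (fun s ω => f s ω - g s ω) t (fun ω => I ω - J ω) := by
  have hu := TimePartition.tendsto_uniform t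
  obtain ⟨ns, hmono, hns⟩ := (TendstoInMeasure.comp hf hu).exists_seq_tendsto_ae
  obtain ⟨ms, hmono', hms⟩ :=
    (TendstoInMeasure.comp hg (hu.comp hmono.tendsto_atTop)).exists_seq_tendsto_ae
  refine ⟨fun k => ns (ms k), ?_⟩
  filter_upwards [hns, hms] with ω h1 h2
  refine ((h1.comp hmono'.tendsto_atTop).sub h2).congr fun k => ?_
  simp [itoSum, sub_mul, Finset.sum_sub_distrib]

/-- Itô's isometry as an inequality, for the integral of `f` up to the time when `G` becomes
negative. -/
theorem IsBrownianWrt.integral_stays_mul_sq_le [IsProbabilityMeasure P] (hW : IsBrownianWrt F P W)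
    {G f : ℝ≥0 → Ω → ℝ} {t : ℝ≥0} {I : Ω → ℝ} {C b : ℝ}
    (hG : ∀ t, AEStronglyMeasurable[F t] (G t) P) (hf : ∀ t, AEStronglyMeasurable[F t] (f t) P)
    (hI : HasSeqItoIntegral P W f t I) (hC0 : 0 ≤ C)
    (hC : ∀ᵐ ω ∂P, ∀ s, stays G s ω = 1 → |f s ω| ≤ C)
    (hb : ∀ N, ∑ i ∈ Finset.range (N + 1),
      (∫ ω, stays G ((TimePartition.uniform t N).pt i) ω *
        f ((TimePartition.uniform t N).pt i) ω ^ 2 ∂P) *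
      ((TimePartition.uniform t N).pt (i + 1) - (TimePartition.uniform t N).pt i) ≤ b) :
    MemLp (fun ω => stays G t ω * I ω) 2 P ∧ ∫ ω, (stays G t ω * I ω) ^ 2 ∂P ≤ b := by
  obtain ⟨ns, hns⟩ := hI
  set φ : ℝ≥0 → Ω → ℝ := fun s ω => stays G s ω * clamp C (f s ω) with hφ
  have hχ := aestronglyMeasurable_stays (P := P) hG
  have hφm : ∀ s, AEStronglyMeasurable[F s] (φ s) P := fun s =>
    (hχ s).mul ((continuous_clamp C).comp_aestronglyMeasurable (hf s))
  have hφC : ∀ s ω, |φ s ω| ≤ C := fun s ω => by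
    rw [hφ]
    rcases stays_eq_zero_or_one G s ω with h | h
    · simpa [h] using hC0
    · simpa [h] using abs_clamp_le hC0 _
  have hS := fun N => hW.sum_increment (TimePartition.uniform t N).mono
    (φ := fun i => φ ((TimePartition.uniform t N).pt i)) (fun i => hφm _) (fun i => hφC _) (N + 1)
  have hsq : ∀ s, ∫ ω, φ s ω ^ 2 ∂P = ∫ ω, stays G s ω * f s ω ^ 2 ∂P := fun s => by
    refine integral_congr_ae ?_
    filter_upwards [hC] with ω hω
    rcases stays_eq_zero_or_one G s ω with h | h
    · simp [hφ, h]
    · simp [hφ, h, clamp_of_abs_le (hω s h)]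
  set S : ℕ → Ω → ℝ := fun N ω => ∑ i ∈ Finset.range (N + 1),
    φ ((TimePartition.uniform t N).pt i) ω *
      (W ((TimePartition.uniform t N).pt (i + 1)) ω - W ((TimePartition.uniform t N).pt i) ω)
    with hSdef
  have hχt : AEStronglyMeasurable (stays G t) P := (hχ t).mono (F.le t)
  have hdom : ∀ N, MemLp (fun ω => stays G t ω * S N ω) 2 P := fun N => by
    refine (hS N).1.mono (hχt.mul (hS N).1.1) (Eventually.of_forall fun ω => ?_)
    rcases stays_eq_zero_or_one G t ω with h | h <;> simp [h, hSdef]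
  refine memLp_two_of_ae_tendsto (f := fun k ω => stays G t ω * S (ns k) ω) (fun k => hdom _)
    (fun k => ?_) ?_
  · refine le_trans (integral_mono (hdom _).integrable_sq (hS (ns k)).1.integrable_sq
      fun ω => ?_) (le_trans (hS (ns k)).2.2.le ?_)
    · rcases stays_eq_zero_or_one G t ω with h | h <;> simp [h, hSdef, sq_nonneg]
    · simp only [hsq]
      exact hb _
  · filter_upwards [hns, hC] with ω hω hCω
    rcases stays_eq_zero_or_one G t ω with h | h
    · simp [h]
    refine (hω.const_mul (stays G t ω)).congr fun k => ?_
    rw [h, one_mul, one_mul]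
    refine Finset.sum_congr rfl fun i hi => ?_
    have hle : (TimePartition.uniform t (ns k)).pt i ≤ t :=
      (TimePartition.uniform t (ns k)).pt_le (Finset.mem_range.1 hi).le
    have h1 := stays_mono hle h
    simp only [hφ]
    rw [h1, one_mul, clamp_of_abs_le (hCω _ h1)]

end Moment

end StratFeller

namespace StratFeller

/-! ### Uniqueness for the Itô equation -/

section Uniqueness

variable {Ω : Type*} {mΩ : MeasurableSpace Ω} {P : Measure Ω} {F : Filtration ℝ≥0 mΩ}
  {W : ℝ≥0 → Ω → ℝ} {x₀ : ℝ} {X Y Z : ℝ≥0 → Ω → ℝ}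

theorem IsItoSolution.adapted_sqrt (hY : IsItoSolution F P W x₀ Y) (t : ℝ≥0) :
    AEStronglyMeasurable[F t] (fun ω => √(2 * Y t ω)) P :=
  Real.continuous_sqrt.comp_aestronglyMeasurable ((hY.adapted t).const_mul 2)

/-- Solutions of the Itô equation have second moments. -/
theorem IsItoSolution.integral_sub_sq_le [IsProbabilityMeasure P] (hW : IsBrownianWrt F P W)
    (hx₀ : 0 ≤ x₀) (hY : IsItoSolution F P W x₀ Y) (t : ℝ≥0) :
    MemLp (fun ω => Y t ω - x₀) 2 P ∧
      ∫ ω, (Y t ω - x₀) ^ 2 ∂P ≤ (2 * x₀ + 1) * Real.exp t := by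
  set G : ℕ → ℝ≥0 → Ω → ℝ := fun K s ω => K - Y s ω with hGdef
  have hG : ∀ K t, AEStronglyMeasurable[F t] (G K t) P := fun K t =>
    aestronglyMeasurable_const.sub (hY.adapted t)
  have hstay : ∀ K, ∀ᵐ ω ∂P, ∀ s, stays (G K) s ω = 1 → Y s ω ≤ K := fun K => by
    filter_upwards [hY.continuous] with ω hω s hs
    have h1 : Continuous fun s => G K s ω := continuous_const.sub hω
    exact sub_nonneg.1 (nonneg_of_stays h1 hs)
  have hmem : ∀ K s, ∀ᵐ ω ∂P, ‖stays (G K) s ω * (Y s ω - x₀)‖ ≤ K + x₀ := fun K s => by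
    filter_upwards [hstay K, hY.nonneg] with ω h1 h2
    rcases stays_eq_zero_or_one (G K) s ω with h | h
    · rw [h, zero_mul, norm_zero]; positivity
    · rw [h, one_mul, Real.norm_eq_abs, abs_le]
      constructor <;> linarith [h1 s h, h2 s, (K.cast_nonneg : (0 : ℝ) ≤ K)]
  have hL : ∀ K s, MemLp (fun ω => stays (G K) s ω * (Y s ω - x₀)) 2 P := fun K s =>
    MemLp.of_bound (((aestronglyMeasurable_stays (hG K) s).mul
      ((hY.adapted s).sub aestronglyMeasurable_const)).mono (F.le s)) _ (hmem K s)
  have hcoef : ∀ K s, ∫ ω, stays (G K) s ω * √(2 * Y s ω) ^ 2 ∂P ≤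
      ∫ ω, (stays (G K) s ω * (Y s ω - x₀)) ^ 2 ∂P + (2 * x₀ + 1) := fun K s => by
    have e : ∫ ω, (stays (G K) s ω * (Y s ω - x₀)) ^ 2 ∂P + (2 * x₀ + 1) =
        ∫ ω, ((stays (G K) s ω * (Y s ω - x₀)) ^ 2 + (2 * x₀ + 1)) ∂P := by
      rw [integral_add (hL K s).integrable_sq (integrable_const _)]; simp
    rw [e]
    refine integral_mono_of_nonneg (Eventually.of_forall fun ω => ?_)
      ((hL K s).integrable_sq.add (integrable_const _)) ?_
    · rcases stays_eq_zero_or_one (G K) s ω with h | h <;> simp [h]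
    · filter_upwards [hY.nonneg] with ω hω
      rw [Real.sq_sqrt (by linarith [hω s])]
      rcases stays_eq_zero_or_one (G K) s ω with h | h <;> rw [h] <;>
        nlinarith [sq_nonneg (Y s ω - x₀ - 1)]
  have hbound : ∀ K t, ∫ ω, (stays (G K) t ω * (Y t ω - x₀)) ^ 2 ∂P ≤
      (2 * x₀ + 1) * Real.exp t := fun K t => by
    have := le_exp_of_forall_sum_le (a := 2 * x₀ + 1) (C := 1) (B := (K + x₀) ^ 2 + (2 * x₀ + 1))
      (u := fun t => ∫ ω, (stays (G K) t ω * (Y t ω - x₀)) ^ 2 ∂P + (2 * x₀ + 1))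
      (by positivity) zero_le_one (fun t => ?_) (fun t b hb => ?_) t
    · rw [one_mul] at this
      linarith
    · have h1 : ∫ ω, (stays (G K) t ω * (Y t ω - x₀)) ^ 2 ∂P ≤ ∫ _, (K + x₀) ^ 2 ∂P := by
        refine integral_mono_ae (hL K t).integrable_sq (integrable_const _) ?_
        filter_upwards [hmem K t] with ω hω
        exact sq_le_sq' (abs_le.1 hω).1 (abs_le.1 hω).2
      have h2 : ∫ _, ((K : ℝ) + x₀) ^ 2 ∂P = (K + x₀) ^ 2 := by simp
      linarith
    · have := (hW.integral_stays_mul_sq_le (hG K) hY.adapted_sqrt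
        (hY.eqn t).hasSeqItoIntegral (Real.sqrt_nonneg (2 * K)) (b := b - (2 * x₀ + 1)) ?_
        fun N => ?_).2
      · linarith
      · filter_upwards [hstay K] with ω hω s hs
        rw [abs_of_nonneg (Real.sqrt_nonneg _)]
        exact Real.sqrt_le_sqrt (by linarith [hω s hs])
      · have h1 := hb N
        rw [one_mul] at h1
        refine le_trans (Finset.sum_le_sum fun i _ => ?_) (le_sub_iff_add_le'.2 h1)
        refine mul_le_mul_of_nonneg_right (hcoef K _) (sub_nonneg.2 ?_)
        exact_mod_cast (TimePartition.uniform t N).mono i.le_succ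
  refine memLp_two_of_ae_tendsto (fun K => hL K t) (fun K => hbound K t) ?_
  filter_upwards [hY.continuous] with ω hω
  obtain ⟨C, hC⟩ := isCompact_Icc.bddAbove_image (hω.continuousOn (s := Set.Icc 0 t))
  refine tendsto_const_nhds.congr' ?_
  filter_upwards [eventually_ge_atTop ⌈C⌉₊] with K hK
  have h1 : C ≤ K := (Nat.le_ceil C).trans (by exact_mod_cast hK)
  rw [stays_eq_one fun s hs => ?_, one_mul]
  have h2 : Y s ω ≤ C := hC ⟨s, ⟨zero_le, hs⟩, rfl⟩
  simp only [hGdef]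
  linarith

theorem integral_add_const_sq [IsProbabilityMeasure P] {S : Ω → ℝ} (hS : MemLp S 2 P) (a : ℝ) :
    ∫ ω, (S ω + a) ^ 2 ∂P = ∫ ω, S ω ^ 2 ∂P + 2 * a * ∫ ω, S ω ∂P + a ^ 2 := by
  have h1 : Integrable (fun ω => 2 * a * S ω) P := (hS.integrable one_le_two).const_mul _
  have h2 : Integrable (fun ω => S ω ^ 2 + 2 * a * S ω) P := hS.integrable_sq.add h1
  have e : ∀ ω, (S ω + a) ^ 2 = S ω ^ 2 + 2 * a * S ω + a ^ 2 := fun ω => by ring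
  simp_rw [e]
  rw [integral_add h2 (integrable_const _), integral_add hS.integrable_sq h1, integral_const_mul]
  simp

theorem sqrt_sub_sqrt_sq_mul_le {y z : ℝ} (hy : 0 ≤ y) (hz : 0 ≤ z) :
    (√(2 * y) - √(2 * z)) ^ 2 * z ≤ 2 * (y - z) ^ 2 := by
  have h1 : √(2 * y) ^ 2 = 2 * y := Real.sq_sqrt (by positivity)
  have h2 : √(2 * z) ^ 2 = 2 * z := Real.sq_sqrt (by positivity)
  set a := √(2 * y) with ha
  set b := √(2 * z) with hb
  have ha0 : 0 ≤ a := Real.sqrt_nonneg _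
  have hb0 : 0 ≤ b := Real.sqrt_nonneg _
  have e1 : z = b ^ 2 / 2 := by linarith
  have e2 : y = a ^ 2 / 2 := by linarith
  rw [e1, e2]
  have h3 : b ^ 2 ≤ (a + b) ^ 2 := by gcongr; linarith
  have h4 : (a - b) ^ 2 * b ^ 2 ≤ (a - b) ^ 2 * (a + b) ^ 2 := by gcongr
  nlinarith

theorem sqrt_sub_sqrt_sq_le {y z : ℝ} (hy : 0 ≤ y) (hz : 0 ≤ z) :
    (√(2 * y) - √(2 * z)) ^ 2 ≤ 2 * y + 2 * z := by
  have h1 : √(2 * y) ^ 2 = 2 * y := Real.sq_sqrt (by positivity)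
  have h2 : √(2 * z) ^ 2 = 2 * z := Real.sq_sqrt (by positivity)
  have h3 : 0 ≤ √(2 * y) * √(2 * z) := by positivity
  nlinarith

/-- A solution that is absorbed at zero lies below any other solution: both agree as long as the
absorbed solution is positive, since there the coefficient is Lipschitz. -/
theorem IsItoSolution.ae_le_of_absorbed [IsProbabilityMeasure P] (hW : IsBrownianWrt F P W)
    (hY : IsItoSolution F P W x₀ Y) (hZ : IsItoSolution F P W x₀ Z)
    (habs : ∀ᵐ ω ∂P, ∀ s t, s ≤ t → 0 < Z t ω → 0 < Z s ω) : ∀ᵐ ω ∂P, ∀ t, Z t ω ≤ Y t ω := by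
  set G : ℕ → ℝ≥0 → Ω → ℝ := fun K s ω => min (K - (Y s ω + Z s ω)) (Z s ω - 1 / (K + 1))
    with hGdef
  have hG : ∀ K t, AEStronglyMeasurable[F t] (G K t) P := fun K t => by
    have h1 : Continuous fun q : ℝ × ℝ => min ((K : ℝ) - (q.1 + q.2)) (q.2 - 1 / (K + 1)) := by
      fun_prop
    exact h1.comp_aestronglyMeasurable ((hY.adapted t).prodMk (hZ.adapted t))
  have hstay : ∀ K, ∀ᵐ ω ∂P, ∀ s, stays (G K) s ω = 1 →
      Y s ω + Z s ω ≤ K ∧ 1 / ((K : ℝ) + 1) ≤ Z s ω := fun K => by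
    filter_upwards [hY.continuous, hZ.continuous] with ω h1 h2 s hs
    have h3 : Continuous fun s => G K s ω :=
      (continuous_const.sub (h1.add h2)).min (h2.sub continuous_const)
    have h4 := le_min_iff.1 (nonneg_of_stays h3 hs)
    exact ⟨sub_nonneg.1 h4.1, sub_nonneg.1 h4.2⟩
  have hmem : ∀ K s, ∀ᵐ ω ∂P, ‖stays (G K) s ω * (Y s ω - x₀ - (Z s ω - x₀))‖ ≤ K := fun K s => by
    filter_upwards [hstay K, hY.nonneg, hZ.nonneg] with ω h1 h2 h3
    rcases stays_eq_zero_or_one (G K) s ω with h | h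
    · rw [h, zero_mul, norm_zero]; positivity
    · rw [h, one_mul, Real.norm_eq_abs, abs_le]
      constructor <;> linarith [(h1 s h).1, h2 s, h3 s]
  have hL : ∀ K s, MemLp (fun ω => stays (G K) s ω * (Y s ω - x₀ - (Z s ω - x₀))) 2 P := fun K s =>
    MemLp.of_bound (((aestronglyMeasurable_stays (hG K) s).mul
      (((hY.adapted s).sub aestronglyMeasurable_const).sub
        ((hZ.adapted s).sub aestronglyMeasurable_const))).mono (F.le s)) _ (hmem K s)
  have hcoef : ∀ K s, ∫ ω, stays (G K) s ω * (√(2 * Y s ω) - √(2 * Z s ω)) ^ 2 ∂P ≤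
      2 * (K + 1) * ∫ ω, (stays (G K) s ω * (Y s ω - x₀ - (Z s ω - x₀))) ^ 2 ∂P := fun K s => by
    rw [← integral_const_mul]
    refine integral_mono_of_nonneg (Eventually.of_forall fun ω => ?_)
      ((hL K s).integrable_sq.const_mul _) ?_
    · rcases stays_eq_zero_or_one (G K) s ω with h | h <;> simp [h, sq_nonneg]
    · filter_upwards [hY.nonneg, hZ.nonneg, hstay K] with ω h1 h2 h3
      rcases stays_eq_zero_or_one (G K) s ω with h | h
      · simp [h]
      rw [h, one_mul, one_mul]
      have h4 := sqrt_sub_sqrt_sq_mul_le (h1 s) (h2 s)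
      have h5 := mul_le_mul_of_nonneg_left (h3 s h).2
        (sq_nonneg (√(2 * Y s ω) - √(2 * Z s ω)))
      rw [mul_one_div] at h5
      have h6 := (div_le_iff₀ (by positivity)).1 (h5.trans h4)
      calc _ ≤ _ := h6
        _ = _ := by ring
  have hzero : ∀ K t, ∀ᵐ ω ∂P, stays (G K) t ω * (Y t ω - x₀ - (Z t ω - x₀)) = 0 := fun K t => by
    have := le_exp_of_forall_sum_le (a := 0) (C := 2 * (K + 1)) (B := K ^ 2)
      (u := fun t => ∫ ω, (stays (G K) t ω * (Y t ω - x₀ - (Z t ω - x₀))) ^ 2 ∂P)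
      le_rfl (by positivity) (fun t => ?_) (fun t b hb => ?_) t
    · rw [zero_mul] at this
      have h0 := (integral_eq_zero_iff_of_nonneg (fun ω => sq_nonneg _)
        (hL K t).integrable_sq).1 (le_antisymm this (integral_nonneg fun ω => sq_nonneg _))
      filter_upwards [h0] with ω hω
      exact pow_eq_zero_iff two_ne_zero |>.1 hω
    · have h1 : ∫ ω, (stays (G K) t ω * (Y t ω - x₀ - (Z t ω - x₀))) ^ 2 ∂P ≤
          ∫ _, (K : ℝ) ^ 2 ∂P := by
        refine integral_mono_ae (hL K t).integrable_sq (integrable_const _) ?_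
        filter_upwards [hmem K t] with ω hω
        exact sq_le_sq' (abs_le.1 hω).1 (abs_le.1 hω).2
      simpa using h1
    · refine (hW.integral_stays_mul_sq_le (hG K)
        (fun s => (hY.adapted_sqrt s).sub (hZ.adapted_sqrt s))
        ((hY.eqn t).sub_hasSeqItoIntegral (hZ.eqn t)) (Real.sqrt_nonneg (2 * K)) ?_
        fun N => ?_).2
      · filter_upwards [hstay K, hY.nonneg, hZ.nonneg] with ω h1 h2 h3 s hs
        refine Real.abs_le_sqrt ((sqrt_sub_sqrt_sq_le (h2 s) (h3 s)).trans ?_)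
        linarith [(h1 s hs).1]
      · have h1 := hb N
        rw [zero_add, Finset.mul_sum] at h1
        refine le_trans (Finset.sum_le_sum fun i _ => ?_) h1
        rw [← mul_assoc]
        refine mul_le_mul_of_nonneg_right (hcoef K _) (sub_nonneg.2 ?_)
        exact_mod_cast (TimePartition.uniform t N).mono i.le_succ
  filter_upwards [ae_all_iff.2 fun K : ℕ => ae_all_iff.2 fun m => hzero K (dens m), hY.continuous,
    hZ.continuous, hY.nonneg, hZ.nonneg, habs] with ω h0 hYc hZc hY0 hZ0 habs t
  rcases (hZ0 t).eq_or_lt with hz | hz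
  · exact hz ▸ hY0 t
  by_contra! hlt
  have hopen : IsOpen ({s | 0 < Z s ω} ∩ {s | Y s ω < Z s ω}) :=
    (isOpen_lt continuous_const hZc).inter (isOpen_lt hYc hZc)
  obtain ⟨m, hm, hm'⟩ := exists_dens_mem hopen ⟨t, hz, hlt⟩
  obtain ⟨C, hC⟩ := isCompact_Icc.bddAbove_image ((hYc.add hZc).continuousOn (s := Set.Icc 0 (dens m)))
  obtain ⟨s₀, hs₀⟩ := isCompact_Icc.exists_isMinOn (Set.nonempty_Icc.2 (zero_le (a := dens m)))
    (hZc.continuousOn (s := Set.Icc 0 (dens m)))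
  obtain ⟨hs₀m, hs₀⟩ := hs₀
  obtain ⟨n, hn⟩ := exists_nat_one_div_lt (habs s₀ (dens m) hs₀m.2 hm)
  have hstay : stays (G (max n ⌈C⌉₊)) (dens m) ω = 1 := by
    refine stays_eq_one fun s hs => le_min ?_ ?_
    · have h1 : Y s ω + Z s ω ≤ C := hC ⟨s, ⟨zero_le, hs⟩, rfl⟩
      have h2 : C ≤ (max n ⌈C⌉₊ : ℕ) :=
        (Nat.le_ceil C).trans (by exact_mod_cast le_max_right n ⌈C⌉₊)
      linarith
    · have h1 : Z s₀ ω ≤ Z s ω := hs₀ ⟨zero_le, hs⟩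
      have h2 : 1 / (((max n ⌈C⌉₊ : ℕ) : ℝ) + 1) ≤ 1 / ((n : ℝ) + 1) := by
        gcongr; exact le_max_left _ _
      linarith
  have h1 := h0 (max n ⌈C⌉₊) m
  rw [hstay, one_mul] at h1
  have h2 : Y (dens m) ω < Z (dens m) ω := hm'
  linarith

/-- A nonnegative difference of two solutions vanishes, since it has expectation zero. -/
theorem IsItoSolution.ae_eq_of_ae_le [IsProbabilityMeasure P] (hW : IsBrownianWrt F P W)
    (hx₀ : 0 ≤ x₀) (hY : IsItoSolution F P W x₀ Y) (hZ : IsItoSolution F P W x₀ Z)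
    (hle : ∀ᵐ ω ∂P, ∀ t, Z t ω ≤ Y t ω) (t : ℝ≥0) : ∀ᵐ ω ∂P, Y t ω = Z t ω := by
  set H : ℝ≥0 → Ω → ℝ := fun s ω => √(2 * Y s ω) - √(2 * Z s ω) with hH
  set c := 4 * ((2 * x₀ + 1) * Real.exp t) with hc
  have hHm : ∀ s, AEStronglyMeasurable[F s] (H s) P := fun s =>
    (hY.adapted_sqrt s).sub (hZ.adapted_sqrt s)
  have hclamp : ∀ s ≤ t, ∀ L : ℕ, ∫ ω, clamp L (H s ω) ^ 2 ∂P ≤ c := fun s hs L => by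
    obtain ⟨h1, h2⟩ := hY.integral_sub_sq_le hW hx₀ s
    obtain ⟨h3, h4⟩ := hZ.integral_sub_sq_le hW hx₀ s
    have h5 : ∫ ω, clamp L (H s ω) ^ 2 ∂P ≤
        ∫ ω, ((Y s ω - x₀) ^ 2 + (Z s ω - x₀) ^ 2 + 2 * (2 * x₀ + 1)) ∂P := by
      refine integral_mono_of_nonneg (Eventually.of_forall fun ω => sq_nonneg _)
        ((h1.integrable_sq.add h3.integrable_sq).add (integrable_const _)) ?_
      filter_upwards [hY.nonneg, hZ.nonneg] with ω hy hz
      have h6 := sqrt_sub_sqrt_sq_le (hy s) (hz s)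
      have h7 := sq_le_sq.2 (abs_clamp_le_abs L.cast_nonneg (H s ω))
      have h8 : clamp L (H s ω) ^ 2 ≤ 2 * Y s ω + 2 * Z s ω := h7.trans h6
      nlinarith [sq_nonneg (Y s ω - x₀ - 1), sq_nonneg (Z s ω - x₀ - 1)]
    have h6 : Integrable (fun ω => (Y s ω - x₀) ^ 2 + (Z s ω - x₀) ^ 2) P :=
      h1.integrable_sq.add h3.integrable_sq
    rw [integral_add h6 (integrable_const _), integral_add h1.integrable_sq h3.integrable_sq] at h5
    simp only [integral_const, probReal_univ, one_smul] at h5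
    have h9 : (2 * x₀ + 1) * Real.exp s ≤ (2 * x₀ + 1) * Real.exp t := by gcongr
    have h10 : (2 * x₀ + 1) * 1 ≤ (2 * x₀ + 1) * Real.exp t := by
      gcongr; exact Real.one_le_exp t.2
    linarith
  -- the bounds hold for the sums with truncated coefficients, and pass to the limit
  have hS : ∀ (a : ℝ) (N : ℕ), MemLp (fun ω => itoSum W H (TimePartition.uniform t N) ω + a) 2 P ∧
      ∫ ω, (itoSum W H (TimePartition.uniform t N) ω + a) ^ 2 ∂P ≤ c * t + a ^ 2 := by
    intro a N
    set p := TimePartition.uniform t N with hp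
    have hT := fun L : ℕ => hW.sum_increment p.mono (φ := fun i ω => clamp L (H (p.pt i) ω))
      (fun i => (continuous_clamp L).comp_aestronglyMeasurable (hHm _))
      (fun i ω => abs_clamp_le L.cast_nonneg _) p.n
    refine memLp_two_of_ae_tendsto
      (f := fun (L : ℕ) ω => ∑ i ∈ Finset.range p.n,
        clamp L (H (p.pt i) ω) * (W (p.pt (i + 1)) ω - W (p.pt i) ω) + a)
      (fun L => (hT L).1.add (memLp_const a)) (fun L => ?_) (Eventually.of_forall fun ω => ?_)
    · obtain ⟨h1, h2, h3⟩ := hT L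
      have h4 : ∑ i ∈ Finset.range p.n, (∫ ω, clamp L (H (p.pt i) ω) ^ 2 ∂P) *
          ((p.pt (i + 1) : ℝ) - p.pt i) ≤ c * t := by
        rw [← p.sum_step, Finset.mul_sum]
        refine Finset.sum_le_sum fun i hi => mul_le_mul_of_nonneg_right
          (hclamp _ (p.pt_le (Finset.mem_range.1 hi).le) L) (sub_nonneg.2 ?_)
        exact_mod_cast p.mono i.le_succ
      rw [integral_add_const_sq h1 a, h2, h3]
      simpa using h4
    · refine (tendsto_finsetSum _ fun i _ => ?_).add_const a
      refine Tendsto.mul_const _ (tendsto_const_nhds.congr' ?_)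
      filter_upwards [eventually_ge_atTop ⌈|H (p.pt i) ω|⌉₊] with L hL
      exact (clamp_of_abs_le ((Nat.le_ceil _).trans (by exact_mod_cast hL))).symm
  obtain ⟨ns, hns⟩ := (hY.eqn t).sub_hasSeqItoIntegral (hZ.eqn t)
  have hD := fun a : ℝ => memLp_two_of_ae_tendsto (fun k => (hS a (ns k)).1)
    (fun k => (hS a (ns k)).2) (hns.mono fun ω hω => hω.add_const a)
  set D : Ω → ℝ := fun ω => Y t ω - x₀ - (Z t ω - x₀) with hDdef
  have hD2 : MemLp D 2 P := by simpa [hDdef] using (hD 0).1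
  have hmean : ∀ a : ℝ, 2 * a * ∫ ω, D ω ∂P ≤ c * t := fun a => by
    have h1 := (hD a).2
    rw [integral_add_const_sq hD2 a] at h1
    have h2 : 0 ≤ ∫ ω, D ω ^ 2 ∂P := integral_nonneg fun ω => sq_nonneg _
    linarith
  have hD0 : 0 ≤ᵐ[P] D := by
    filter_upwards [hle] with ω hω
    simp only [hDdef, Pi.zero_apply]
    linarith [hω t]
  have hint : ∫ ω, D ω ∂P = 0 := by
    refine le_antisymm ?_ (integral_nonneg_of_ae hD0)
    by_contra! hpos
    have h1 := hmean ((c * t + 1) / (2 * ∫ ω, D ω ∂P))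
    have h2 : 2 * ((c * t + 1) / (2 * ∫ ω, D ω ∂P)) * ∫ ω, D ω ∂P = c * t + 1 := by field_simp
    linarith
  filter_upwards [(integral_eq_zero_iff_of_nonneg_ae hD0 (hD2.integrable one_le_two)).1 hint]
    with ω hω
  simp only [hDdef, Pi.zero_apply] at hω
  linarith

/-- Two solutions of the Itô equation are indistinguishable if one of them is absorbed at zero. -/
theorem IsItoSolution.indistinguishable [IsProbabilityMeasure P] (hW : IsBrownianWrt F P W)
    (hx₀ : 0 ≤ x₀) (hY : IsItoSolution F P W x₀ Y) (hZ : IsItoSolution F P W x₀ Z)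
    (habs : ∀ᵐ ω ∂P, ∀ s t, s ≤ t → 0 < Z t ω → 0 < Z s ω) : ∀ᵐ ω ∂P, ∀ t, Y t ω = Z t ω := by
  have hle := hY.ae_le_of_absorbed hW hZ habs
  filter_upwards [ae_all_iff.2 fun m => hY.ae_eq_of_ae_le hW hx₀ hZ hle (dens m), hY.continuous,
    hZ.continuous] with ω h hYc hZc t
  exact congrFun (hYc.ext_on (TopologicalSpace.denseRange_denseSeq ℝ≥0) hZc
    (by rintro _ ⟨m, rfl⟩; exact h m)) t

theorem itoSolution_absorbed (hW : IsBrownianWrt F P W) (x₀ : ℝ) :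
    ∀ᵐ ω ∂P, ∀ s t, s ≤ t → 0 < itoSolution x₀ W t ω → 0 < itoSolution x₀ W s ω := by
  filter_upwards [hW.ae_continuous √(2 * x₀)] with ω hω s t hst h
  have hpos : ∀ t, 0 < itoSolution x₀ W t ω ↔ IsAlive (startedAt √(2 * x₀) W ω) t := fun t => by
    rw [← radius_pos_iff hω.1, itoSolution]
    have := radius_nonneg hω.1 t
    refine ⟨fun h => this.lt_of_ne fun h0 => ?_, fun h => by positivity⟩
    rw [← h0] at h
    simp at h
  exact (hpos s).2 (((hpos t).1 h).mono hst)

end Uniqueness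

end StratFeller

namespace StratFeller

/-! ### Uncountably many laws -/

/-- Different delays give different laws, so that there are as many laws as positive reals. -/
theorem IsBrownianWrt.not_countable_laws {Ω : Type*} {mΩ : MeasurableSpace Ω} {P : Measure Ω}
    [IsProbabilityMeasure P] {F : Filtration ℝ≥0 mΩ} {W : ℝ≥0 → Ω → ℝ}
    (hW : IsBrownianWrt F P W) {x₀ : ℝ} (hx₀ : 0 ≤ x₀) :
    ¬ {ν : Measure (ℝ≥0 → ℝ) | ∃ X, IsStratonovichSolution F P W x₀ X ∧
      ν = P.map (path X)}.Countable := by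
  intro hc
  have hinj : Set.InjOn (fun r : ℝ => P.map (path (stratSolution x₀ W
      ((Real.exp r).toNNReal : ℝ≥0)))) Set.univ := by
    intro r _ r' _ h
    by_contra hne
    refine hW.map_stratSolution_ne (fun h' => hne ?_) h
    have := congrArg NNReal.toReal h'
    rw [Real.coe_toNNReal _ (Real.exp_pos r).le, Real.coe_toNNReal _ (Real.exp_pos r').le] at this
    exact Real.exp_injective this
  refine Cardinal.not_countable_real (Set.MapsTo.countable_of_injOn ?_ hinj hc)
  exact fun r _ => ⟨_, isStratonovichSolution_stratSolution hW hx₀ _, rfl⟩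

end StratFeller

theorem mainTheorem5 {Ω : Type*} {mΩ : MeasurableSpace Ω} (P : Measure Ω)
    [IsProbabilityMeasure P] (F : Filtration ℝ≥0 mΩ) (W : ℝ≥0 → Ω → ℝ)
    (hW : StratFeller.IsBrownianWrt F P W) (x₀ : ℝ) (hx₀ : 0 < x₀) :
    -- the Stratonovich equation driven by `W` has uncountably many solutions, even in law
    (¬ {ν : Measure (ℝ≥0 → ℝ) | ∃ X, StratFeller.IsStratonovichSolution F P W x₀ X ∧
        ν = P.map (StratFeller.path X)}.Countable) ∧
    -- the killed processes are solutions
    (∀ n, 1 ≤ n →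
      StratFeller.IsStratonovichSolution F P W x₀ (StratFeller.killedProcess x₀ W n)) ∧
    -- a solution, up to its first zero and in law, is `(√x₀ + W_t / √2)²`
    (∃ X, StratFeller.IsStratonovichSolution F P W x₀ X ∧
      (∀ᵐ ω ∂P, ∀ t : ℝ≥0, (t : ℝ≥0∞) ≤ StratFeller.squareZeroTime x₀ W 1 ω →
        X t ω = StratFeller.squareProcess x₀ W t ω) ∧
      IdentDistrib (StratFeller.path X) (StratFeller.path (StratFeller.squareProcess x₀ W)) P P) ∧
    -- started from `0`, a solution has the law of `(W_{t-τ}² / 2) 1_{t > τ}`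
    (∀ τ : ℝ≥0, ∃ X, StratFeller.IsStratonovichSolution F P W 0 X ∧
      IdentDistrib (StratFeller.path X) (StratFeller.path (StratFeller.delayedProcess W τ)) P P) ∧
    -- the combined family, and its members with different delays differ in law
    (∃ X : ℕ → ℝ≥0 → ℝ≥0 → Ω → ℝ,
      (∀ n τ, 1 ≤ n →
        StratFeller.IsStratonovichSolution F P W x₀ (X n τ) ∧
        (∀ᵐ ω ∂P, ∀ t : ℝ≥0, (t : ℝ≥0∞) ≤ StratFeller.squareZeroTime x₀ W n ω + τ →
          X n τ t ω = StratFeller.killedProcess x₀ W n t ω) ∧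
        IdentDistrib (StratFeller.path (X n τ))
          (StratFeller.path (StratFeller.restartedProcess x₀ W n τ)) P P) ∧
      ∀ n m τ τ', 1 ≤ n → 1 ≤ m → τ ≠ τ' →
        P.map (StratFeller.path (X n τ)) ≠ P.map (StratFeller.path (X m τ'))) ∧
    -- the Itô equation driven by `W` has exactly one solution, up to indistinguishability
    (∃ X, StratFeller.IsItoSolution F P W x₀ X ∧
      ∀ Y, StratFeller.IsItoSolution F P W x₀ Y → ∀ᵐ ω ∂P, ∀ t, Y t ω = X t ω) := by

  refine ⟨fun hc => ?_, fun n hn => ?_, ?_, fun τ => ?_, ?_, ?_⟩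
  · exact hW.not_countable_laws hx₀.le hc
  · refine (StratFeller.isStratonovichSolution_stratSolution hW hx₀.le ∞).congr ?_
    filter_upwards [hW.ae_killedProcess_eq hx₀] with ω h t
    exact h n hn ∞ t (by simp)
  · refine ⟨_, StratFeller.isStratonovichSolution_stratSolution hW hx₀.le 0, ?_,
      hW.identDistrib_squareProcess hx₀⟩
    filter_upwards [hW.ae_killedProcess_eq hx₀, hW.ae_squareZeroTime_eq hx₀,
      hW.ae_continuous √(2 * x₀)] with ω h1 h2 h3 t ht
    rw [h1 1 le_rfl 0 t (by simpa using ht), StratFeller.killedProcess]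
    split_ifs with hlt
    · rfl
    · have he : StratFeller.hitTime (StratFeller.startedAt √(2 * x₀) W ω) = t := by
        rw [← h2 1 le_rfl]; exact le_antisymm (not_lt.1 hlt) ht
      exact (StratFeller.squareProcess_eq_zero_iff.2 (StratFeller.eq_zero_of_hitTime_eq h3.1
        (h3.2.symm ▸ Real.sqrt_nonneg _) he)).symm
  · exact ⟨_, StratFeller.isStratonovichSolution_stratSolution hW le_rfl τ,
      hW.identDistrib_delayedProcess τ⟩
  · refine ⟨fun _ τ => StratFeller.stratSolution x₀ W τ, fun n τ hn =>
      ⟨StratFeller.isStratonovichSolution_stratSolution hW hx₀.le τ, ?_,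
        hW.identDistrib_restartedProcess hx₀ hn τ⟩,
      fun _ _ _ _ _ _ h => hW.map_stratSolution_ne h⟩
    filter_upwards [hW.ae_killedProcess_eq hx₀] with ω h t ht
    exact h n hn τ t ht
  · refine ⟨_, StratFeller.isItoSolution_itoSolution hW hx₀, fun Y hY => ?_⟩
    exact hY.indistinguishable hW hx₀.le (StratFeller.isItoSolution_itoSolution hW hx₀)
      (StratFeller.itoSolution_absorbed hW x₀)
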